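/- **Setting.** Let $k$ be a field. A scheme below is a connected (in particular non-empty) reduced quasi-projective $k$-scheme $X$, i.e. one with a locally closed immersion over $k$ into some $\mathbf P^n_k$. Let $k^X$ be the ring of global sections of $X$ algebraic over $k$; it is a field. For an algebraically closed field $F\supseteq k$ and a $k$-homomorphism $\alpha:k^X\to F$ put $k[\alpha]=\alpha(k^X)$ and let $X_\alpha(F)$ be the set of $F$-points of $X$ over $k$ at which every $c\in k^X$ takes the value $\alpha(c)$. Let $L^X$ be the two-sorted language (variety sort, field sort) with symbols for addition and multiplication on the field sort, for each element of $k$, for each affine open $U\subseteq X$, and for each regular function $a\in\Gamma(U,\mathcal O_X)$ (through its graph). Let $T^X$ be the first-order $L^X$-theory of all the structures $(X_\alpha(F),F_{/k})$. For a morphism $f:Y\to X$ of $k$-schemes write also $f:k^X\to k^Y$ for pull-back. A pair $(\alpha,\beta)$, with $\alpha:k^X\to F$ and $\beta:k^Y\to F$, is *appropriate* for $f$ if $\alpha=\beta\circ f$; then $y\mapsto f(y)$ is a map $f^*_{\beta,\alpha}:Y_\beta(F)\to X_\alpha(F)$, and $f^*$ is the family of all these maps. The *category of theories* has the theories $T^X$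 as objects; a morphism $T^X\to T^Y$ consists of a $k$-homomorphism $e:k^X\to k^Y$ and maps $Y_\beta(F)\to X_{\beta\circ e}(F)$ for all $F,\beta$, which are regular over $k$ uniformly in $F,\beta$: the preimage of each affine open $U\subseteq X$ is a union of affine opens $V\subseteq Y$, on each of which each $a\in\Gamma(U,\mathcal O_X)$ pulls back to some $b\in\Gamma(V,\mathcal O_Y)$, with the $V$ and $b$ not depending on $F,\beta$. An *interpretation* of a structure $N$ in a structure $M$ is a bijection $g:N\to D/E$, with $D\subseteq M^n$ and the equivalence relation $E$ on $D$ definable without parameters, such that the images of the basic relations of $N$ are definable without parameters. It is an *embedding-interpretation* if every relation on $g(N)$ definable in $M$ is the image of a relation definable in $N$. We say that $f^*$ *determines* an interpretation of $T^X$ in $T^Y$ given by certain formulas of $L^Y$ if, for every appropriate pair, these same formulas give an interpretation $g$ of $(X_\alpha(F),F_{/k})$ in $(Y_\beta(F),F_{/k})$ for which the compositions of $g$ with $f^*_{\beta,\alpha}$ and with $\mathrm{id}_F$ are definable, by a formula not depending on the pair. **Theorem.** 1. The models of $T^X$ are, up to isomorphism, exactly the structures $(X_\alpha(F),F_{/k})$,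 and $X\mapsto T^X$, $f\mapsto f^*$ is an equivalence from the opposite of the category of connected reduced quasi-projective $k$-schemes (so that for affine schemes $f$ is a homomorphism $A\to B$ of coordinate rings and $f^*:T^A\to T^B$) to the category of theories. 2. For every $f:Y\to X$ and every appropriate pair, $f:k^X\to k^Y$ is injective and $k[\alpha]\subseteq k[\beta]$; with the coordinates given by finite systems of generators of the rings $\Gamma(U,\mathcal O)$, $U$ affine open, $X_\alpha(F)$ is an (abstract, separated) variety defined over $k[\alpha]$, $Y_\beta(F)$ is one defined over $k[\beta]$, and $f^*_{\beta,\alpha}:Y_\beta(F)\to X_\alpha(F)$ is a regular map defined over $k[\beta]$. 3. For every $f:Y\to X$, in particular if $f$ is an embedding (i.e. $\mathcal O_X\to f_*\mathcal O_Y$ is injective), $f^*$ determines an interpretation of $T^X$ in $T^Y$, which is unique up to definable bijections, uniformly in the models. For the appropriate pairs for which $f^*_{\beta,\alpha}$ is surjective it can be taken, again with uniform formulas, to be the identification of $X_\alpha(F)$ with the quotient of $Y_\beta(F)$ by the equivalence relation $f^*_{\beta,\alpha}(y)=f^*_{\beta,\alpha}(y')$. 4. If $f(k^X)=k^Y$,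 the interpretations determined by $f^*$ are embedding-interpretations. This holds both when "definable" means first-order definable without parameters and when it means invariant under all automorphisms. -/

import Mathlib

open AlgebraicGeometry CategoryTheory Opposite

universe u

noncomputable section

namespace VarietyTheory

/-! ### Quasi-projective schemes over a field -/

/-- Schemes over the field `k`. -/
abbrev KScheme (k : Type u) [Field k] := Over (Spec (CommRingCat.of k))

attribute [local instance] MvPolynomial.gradedAlgebra in
/-- Projective `n`-space over `k`, as `Proj k[T₀, …, Tₙ]`. -/
def projectiveSpace (k : Type u) [Field k] (n : ℕ) : KScheme k :=
  Over.mk (Proj.toSpecZero (MvPolynomial.homogeneousSubmodule (Fin (n + 1)) k) ≫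
    Spec.map (CommRingCat.ofHom
      (algebraMap k (MvPolynomial.homogeneousSubmodule (Fin (n + 1)) k 0))))

/-- Connected (in particular non-empty) reduced quasi-projective `k`-schemes: those which admit
a locally closed immersion over `k` into some projective space. -/
def isQuasiProjective (k : Type u) [Field k] : ObjectProperty (KScheme k) := fun X =>
  IsReduced X.left ∧ ConnectedSpace X.left ∧
    ∃ (n : ℕ) (i : X ⟶ projectiveSpace k n), IsImmersion i.left

/-- The category of connected reduced quasi-projective `k`-schemes and `k`-morphisms. -/
abbrev QProj (k : Type u) [Field k] := (isQuasiProjective k).FullSubcategory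

section Scheme

variable {k : Type u} [Field k]

/-- The structure homomorphism from `k` to the sections over an open set. -/
def kmap (X : KScheme k) (U : X.left.Opens) : k →+* Γ(X.left, U) :=
  (X.hom.appLE ⊤ U (show U ≤ X.hom ⁻¹ᵁ ⊤ from fun _ _ => trivial)).hom.comp (Scheme.ΓSpecIso (CommRingCat.of k)).inv.hom

/-- The ring of global sections. -/
def Glob (X : KScheme k) : Type u := Γ(X.left, ⊤)

instance (X : KScheme k) : CommRing (Glob X) := inferInstanceAs (CommRing Γ(X.left, ⊤))

instance (X : KScheme k) : Algebra k (Glob X) := RingHom.toAlgebra (kmap X ⊤)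

/-- The field of constants `k^X`: all global sections that are algebraic over `k`. For a connected
reduced scheme this is the largest subfield of the ring of global sections algebraic over `k`. -/
def constField (X : KScheme k) : Subalgebra k (Glob X) := integralClosure k (Glob X)

/-- `Spec F` as a `k`-scheme, for an extension field `F` of `k`. -/
def specField (k : Type u) [Field k] (F : Type u) [Field F] [Algebra k F] : KScheme k :=
  Over.mk (Spec.map (CommRingCat.ofHom (algebraMap k F)))

/-- The `F`-rational points of the `k`-scheme `X`. -/
abbrev Point (X : KScheme k) (F : Type u) [Field F] [Algebra k F] := specField k F ⟶ X

section Point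

variable {X Y : KScheme k} {F : Type u} [Field F] [Algebra k F]

/-- The point `p` lies in the open set `U`, that is, `p` factors through `U`. -/
def Point.Mem (p : Point X F) (U : X.left.Opens) : Prop :=
  (⊤ : (specField k F).left.Opens) ≤ p.left ⁻¹ᵁ U

theorem Point.mem_top (p : Point X F) : p.Mem ⊤ := le_top

theorem Point.exists_affine (p : Point X F) (U : X.left.Opens) (h : p.Mem U) :
    ∃ V : X.left.affineOpens, (V : X.left.Opens) ≤ U ∧ p.Mem V := by
  let pt : (specField k F).left := IsLocalRing.closedPoint F
  obtain ⟨_, ⟨V, hV, rfl⟩, hxV, hVU⟩ := X.left.isBasis_affineOpens.exists_subset_of_mem_open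
    (show p.left pt ∈ (U : Set X.left) from h (x := pt) trivial) U.isOpen
  refine ⟨⟨V, hV⟩, hVU, fun x _ => ?_⟩
  have hx : x = pt := Subsingleton.elim (α := PrimeSpectrum F) _ _
  subst hx
  exact hxV

/-- The value `a(p) ∈ F` of a section `a` over `U` at a point `p` of `U`, as a ring homomorphism
in `a`. -/
def Point.value (p : Point X F) (U : X.left.Opens) (h : p.Mem U) : Γ(X.left, U) →+* F :=
  (Scheme.ΓSpecIso (CommRingCat.of F)).hom.hom.comp (p.left.appLE U ⊤ h).hom

/-- The value of a global section at a point. -/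
def Point.globValue (p : Point X F) : Glob X →+* F := p.value ⊤ p.mem_top

/-- The image of a point under a morphism. -/
def Point.map (f : Y ⟶ X) (p : Point Y F) : Point X F := p ≫ f

end Point

theorem appLE_kmap {X Y : KScheme k} (f : Y ⟶ X) (U : X.left.Opens) (V : Y.left.Opens)
    (e : V ≤ f.left ⁻¹ᵁ U) (c : k) : (f.left.appLE U V e).hom (kmap X U c) = kmap Y V c := by
  have h := Over.w f
  simp only [kmap, RingHom.comp_apply]
  rw [← CommRingCat.comp_apply, Scheme.Hom.appLE_comp_appLE]
  simp only [h]

/-- Pull-back of global sections along a morphism. -/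
def globMap {X Y : KScheme k} (f : Y ⟶ X) : Glob X →ₐ[k] Glob Y :=
  { (f.left.appLE ⊤ ⊤ (show ⊤ ≤ f.left ⁻¹ᵁ ⊤ from fun _ _ => trivial)).hom with
    commutes' := fun c => appLE_kmap f ⊤ ⊤ _ c }

/-- The homomorphism `k^X → k^Y` of fields of constants induced by a morphism `Y ⟶ X`. -/
def constMap {X Y : KScheme k} (f : Y ⟶ X) : constField X →ₐ[k] constField Y :=
  ((globMap f).comp (constField X).val).codRestrict (constField Y)
    (fun c => IsIntegral.map (globMap f) c.2)

theorem constMap_id (X : KScheme k) : constMap (𝟙 X) = AlgHom.id k (constField X) := by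
  ext c
  have h : (𝟙 X.left : X.left ⟶ X.left).appLE ⊤ ⊤ (fun _ _ => trivial) = 𝟙 Γ(X.left, ⊤) := by
    simp only [Scheme.Hom.appLE, Scheme.Hom.id_app]
    exact X.left.presheaf.map_id _
  exact congrArg (fun t : Γ(X.left, ⊤) ⟶ Γ(X.left, ⊤) => t.hom (c : Glob X)) h

theorem constMap_comp {X Y Z : KScheme k} (g : Z ⟶ Y) (f : Y ⟶ X) :
    constMap (g ≫ f) = (constMap g).comp (constMap f) := by
  ext c
  have h : (g.left ≫ f.left).appLE ⊤ ⊤ (fun _ _ => trivial) =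
      f.left.appLE ⊤ ⊤ (fun _ _ => trivial) ≫ g.left.appLE ⊤ ⊤ (fun _ _ => trivial) :=
    (Scheme.Hom.appLE_comp_appLE ..).symm
  exact congrArg (fun t : Γ(X.left, ⊤) ⟶ Γ(Z.left, ⊤) => t.hom (c : Glob X)) h

/-! ### The varieties `X_α(F)` -/

/-- The variety `X_α(F)` attached to a `k`-embedding `α : k^X → F` : the `F`-rational points of `X`
at which every constant `c ∈ k^X` takes the value `α c`. -/
structure VPoint (X : KScheme k) {F : Type u} [Field F] [Algebra k F]
    (α : constField X →ₐ[k] F) : Type u where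
  /-- the underlying `F`-rational point -/
  pt : Point X F
  const : ∀ c : constField X, pt.globValue c = α c

section VPoint

variable {X Y Z : KScheme k} {F : Type u} [Field F] [Algebra k F]

theorem VPoint.ext' {α : constField X →ₐ[k] F} {p q : VPoint X α} (h : p.pt = q.pt) : p = q := by
  cases p; cases q; cases h; rfl

theorem Point.map_mem_iff (f : Y ⟶ X) (p : Point Y F) (U : X.left.Opens) :
    (p.map f).Mem U ↔ p.Mem (f.left ⁻¹ᵁ U) := Iff.rfl

theorem Point.value_map (f : Y ⟶ X) (p : Point Y F) (U : X.left.Opens) (V : Y.left.Opens)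
    (e : V ≤ f.left ⁻¹ᵁ U) (hV : p.Mem V) (hU : (p.map f).Mem U) (a : Γ(X.left, U)) :
    (p.map f).value U hU a = p.value V hV ((f.left.appLE U V e).hom a) := by
  have h : (p.left ≫ f.left).appLE U ⊤ hU =
      f.left.appLE U V e ≫ p.left.appLE V ⊤ hV := (Scheme.Hom.appLE_comp_appLE ..).symm
  change (Scheme.ΓSpecIso (CommRingCat.of F)).hom.hom (((p.left ≫ f.left).appLE U ⊤ hU).hom a) = _
  rw [h]
  rfl

theorem Point.globValue_map (f : Y ⟶ X) (p : Point Y F) (a : Glob X) :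
    (p.map f).globValue a = p.globValue (globMap f a) :=
  Point.value_map f p ⊤ ⊤ (fun _ _ => trivial) p.mem_top (p.map f).mem_top a

/-- The regular map `f^*_{β,α} : Y_β(F) → X_α(F)` induced by a morphism `f : Y ⟶ X`, for an
appropriate pair `(α, β)`, that is, when `β` extends `α` along `f : k^X → k^Y`. -/
def VPoint.map (f : Y ⟶ X) {α : constField X →ₐ[k] F} {β : constField Y →ₐ[k] F}
    (h : β.comp (constMap f) = α) (y : VPoint Y β) : VPoint X α where
  pt := y.pt.map f
  const c := by
    rw [Point.globValue_map, ← h]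
    exact y.const (constMap f c)

end VPoint

/-! ### The language and the theory of a scheme -/

/-- The relation symbols of the language of `X`: the two sorts, the graphs of addition and
multiplication of the field sort, names for the elements of `k`, and for every affine open set `U`
a name for `U` and names for (the graphs of) all regular functions on `U` defined over `k`. -/
inductive VarRel (X : KScheme k) : ℕ → Type u
  | sortX : VarRel X 1
  | sortF : VarRel X 1
  | add : VarRel X 3
  | mul : VarRel X 3
  | const (c : k) : VarRel X 1
  | mem (U : X.left.affineOpens) : VarRel X 1
  | fn (U : X.left.affineOpens) (a : Γ(X.left, U)) : VarRel X 2

/-- The language of `X`. -/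
def lang (X : KScheme k) : FirstOrder.Language.{u, u} where
  Functions := fun _ => PEmpty
  Relations := VarRel X

/-- The universe of the two-sorted structure `(X_α(F), F_{/k})`. -/
def Model (X : KScheme k) {F : Type u} [Field F] [Algebra k F]
    (α : constField X →ₐ[k] F) : Type u := VPoint X α ⊕ F

/-- Interpretation of the symbols in `(X_α(F), F_{/k})`. -/
def relMap (X : KScheme k) {F : Type u} [Field F] [Algebra k F] (α : constField X →ₐ[k] F) :
    ∀ {n : ℕ}, VarRel X n → (Fin n → VPoint X α ⊕ F) → Prop
  | _, .sortX, v => ∃ x, v 0 = Sum.inl x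
  | _, .sortF, v => ∃ t, v 0 = Sum.inr t
  | _, .add, v => ∃ s t, v 0 = Sum.inr s ∧ v 1 = Sum.inr t ∧ v 2 = Sum.inr (s + t)
  | _, .mul, v => ∃ s t, v 0 = Sum.inr s ∧ v 1 = Sum.inr t ∧ v 2 = Sum.inr (s * t)
  | _, .const c, v => v 0 = Sum.inr (algebraMap k F c)
  | _, .mem U, v => ∃ x, v 0 = Sum.inl x ∧ x.pt.Mem U
  | _, .fn U a, v => ∃ x, ∃ h : x.pt.Mem U, v 0 = Sum.inl x ∧ v 1 = Sum.inr (x.pt.value U h a)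

instance (X : KScheme k) {F : Type u} [Field F] [Algebra k F] (α : constField X →ₐ[k] F) :
    (lang X).Structure (Model X α) where
  funMap := fun f _ => f.elim
  RelMap := fun R v => relMap X α R v

/-- The first-order theory of the structures `(X_α(F), F_{/k})`, for all algebraically closed
`F ⊇ k` and all embeddings `α`. -/
def theory (X : KScheme k) : (lang X).Theory :=
  {φ | ∀ (F : Type u) [Field F] [IsAlgClosed F] [Algebra k F] (α : constField X →ₐ[k] F),
    FirstOrder.Language.Sentence.Realize (Model X α) φ}

/-- The map of two-sorted structures which is `φ` on the variety sort and the identity on the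
field sort. -/
def modelMap {X Y : KScheme k} {F : Type u} [Field F] [Algebra k F] {α : constField X →ₐ[k] F}
    {β : constField Y →ₐ[k] F} (φ : VPoint Y β → VPoint X α) : Model Y β → Model X α :=
  Sum.map φ id

end Scheme

/-! ### The category of theories -/

/-- The theories `T^X` of connected reduced quasi-projective `k`-schemes `X`. -/
structure VarTheory (k : Type u) [Field k] where
  /-- the scheme of which this is the theory -/
  scheme : QProj k

namespace VarTheory

variable {k : Type u} [Field k]

/-- The underlying `k`-scheme. -/
abbrev X (T : VarTheory k) : KScheme k := T.scheme.obj

/-- The language of the theory `T^X`. -/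
abbrev language (T : VarTheory k) : FirstOrder.Language.{u, u} := lang T.X

/-- The set of sentences `T^X`. -/
abbrev sentences (T : VarTheory k) : T.language.Theory := theory T.X

/-- A morphism `T^X → T^Y`: a homomorphism `e : k^X → k^Y` of the fields of constants together
with maps `Y_β(F) → X_α(F)` for all appropriate pairs of models (those with `α = β ∘ e`), which
are regular over `k`, uniformly in the models: the preimage of each named affine open set `U` of
`X` is a union of named affine open sets of `Y`, on each of which the pull-back of every named
regular function on `U` is a named regular function. -/
@[ext]
structure Hom (S T : VarTheory k) where
  /-- the homomorphism of fields of constants -/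
  const : constField S.X →ₐ[k] constField T.X
  /-- the maps between the variety sorts of appropriate pairs of models -/
  map : ∀ (F : Type u) [Field F] [IsAlgClosed F] [Algebra k F] (α : constField S.X →ₐ[k] F)
    (β : constField T.X →ₐ[k] F), β.comp const = α → VPoint T.X β → VPoint S.X α
  regular : ∀ U : S.X.left.affineOpens, ∃ 𝒱 : Set T.X.left.affineOpens,
    (∀ (F : Type u) [Field F] [IsAlgClosed F] [Algebra k F] (α : constField S.X →ₐ[k] F)
      (β : constField T.X →ₐ[k] F) (h : β.comp const = α) (y : VPoint T.X β),
      (map F α β h y).pt.Mem U ↔ ∃ V ∈ 𝒱, y.pt.Mem V) ∧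
    ∀ V ∈ 𝒱, ∀ a : Γ(S.X.left, U), ∃ b : Γ(T.X.left, V),
      ∀ (F : Type u) [Field F] [IsAlgClosed F] [Algebra k F] (α : constField S.X →ₐ[k] F)
        (β : constField T.X →ₐ[k] F) (h : β.comp const = α) (y : VPoint T.X β)
        (hV : y.pt.Mem V) (hU : (map F α β h y).pt.Mem U),
        (map F α β h y).pt.value U hU a = y.pt.value V hV b

theorem Hom.ext' {S T : VarTheory k} {φ ψ : Hom S T} (hc : φ.const = ψ.const)
    (hm : ∀ (F : Type u) [Field F] [IsAlgClosed F] [Algebra k F] (α : constField S.X →ₐ[k] F)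
      (β : constField T.X →ₐ[k] F) (h : β.comp φ.const = α) (h' : β.comp ψ.const = α)
      (y : VPoint T.X β), (φ.map F α β h y).pt = (ψ.map F α β h' y).pt) : φ = ψ := by
  obtain ⟨c, m, r⟩ := φ
  obtain ⟨c', m', r'⟩ := ψ
  dsimp only at hc hm
  subst hc
  have : m = m' := by
    funext F _ _ _ α β h y
    exact VPoint.ext' (hm F α β h h y)
  subst this
  rfl

/-- The identity morphism of a theory. -/
def Hom.id (T : VarTheory k) : Hom T T where
  const := AlgHom.id k _
  map F _ _ _ α β h y := ⟨y.pt, fun c => by rw [y.const c, ← h]; rfl⟩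
  regular U := ⟨{U}, fun F _ _ _ α β h y => by simp, by
    rintro V rfl a
    exact ⟨a, fun F _ _ _ α β h y hV hU => rfl⟩⟩

/-- Composition of morphisms of theories. -/
def Hom.comp {R S T : VarTheory k} (φ : Hom R S) (ψ : Hom S T) : Hom R T where
  const := ψ.const.comp φ.const
  map F _ _ _ α γ h z := φ.map F α (γ.comp ψ.const) ((AlgHom.comp_assoc ..).trans h) (ψ.map F _ γ rfl z)
  regular U := by
    obtain ⟨𝒱, h𝒱, hval⟩ := φ.regular U
    choose 𝒲 h𝒲 hval' using ψ.regular
    refine ⟨{W | ∃ V ∈ 𝒱, W ∈ 𝒲 V}, ?_, ?_⟩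
    · intro F _ _ _ α γ h z
      rw [h𝒱]
      constructor
      · rintro ⟨V, hV, hz⟩
        obtain ⟨W, hW, hz'⟩ := (h𝒲 V F (γ.comp ψ.const) γ rfl z).1 hz
        exact ⟨W, ⟨V, hV, hW⟩, hz'⟩
      · rintro ⟨W, ⟨V, hV, hW⟩, hz⟩
        exact ⟨V, hV, (h𝒲 V F (γ.comp ψ.const) γ rfl z).2 ⟨W, hW, hz⟩⟩
    · rintro W ⟨V, hV, hW⟩ a
      obtain ⟨b, hb⟩ := hval V hV a
      obtain ⟨c, hc⟩ := hval' V W hW b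
      refine ⟨c, fun F _ _ _ α γ h z hz hU => ?_⟩
      have hz' := (h𝒲 V F (γ.comp ψ.const) γ rfl z).2 ⟨W, hW, hz⟩
      rw [hb F α _ ((AlgHom.comp_assoc ..).trans h) _ hz' hU]
      exact hc F _ γ rfl z hz hz'

instance : Category.{u + 1} (VarTheory k) where
  Hom := Hom
  id := Hom.id
  comp := Hom.comp
  id_comp := by
    intro S T φ
    refine Hom.ext rfl (heq_of_eq ?_)
    funext F _ _ _ α β h y
    subst h
    rfl
  comp_id := by
    intro S T φ
    refine Hom.ext rfl (heq_of_eq ?_)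
    funext F _ _ _ α β h y
    rfl
  assoc := by
    intro Q R S T φ ψ χ
    rfl

/-- The morphism of theories `f^* : T^X → T^Y` attached to a morphism `f : Y ⟶ X` of schemes: the
family of all the maps `f^*_{β,α} : Y_β(F) → X_α(F)`. -/
def Hom.ofMorphism {X Y : QProj k} (f : Y ⟶ X) : Hom (⟨X⟩ : VarTheory k) ⟨Y⟩ where
  const := constMap f.hom
  map F _ _ _ α β h y := y.map f.hom h
  regular U := by
    refine ⟨{V | (V : Y.obj.left.Opens) ≤ f.hom.left ⁻¹ᵁ U}, ?_, ?_⟩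
    · intro F _ _ _ α β h y
      constructor
      · intro hy
        obtain ⟨V, hVU, hV⟩ := Point.exists_affine y.pt (f.hom.left ⁻¹ᵁ U) hy
        exact ⟨V, hVU, hV⟩
      · rintro ⟨V, hV, hy⟩
        exact le_trans hy ((TopologicalSpace.Opens.map y.pt.left.base).monotone hV)
    · intro V hV a
      exact ⟨(f.hom.left.appLE U V hV).hom a, fun F _ _ _ α β h y hy hU =>
        Point.value_map f.hom y.pt U V hV hy hU a⟩

end VarTheory

/-- The functor `X ↦ T^X`, `f ↦ f^*`. It is covariant on the opposite of the category of schemes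
(which for affine schemes is the category of their coordinate rings). -/
def theoryFunctor (k : Type u) [Field k] : (QProj k)ᵒᵖ ⥤ VarTheory k where
  obj X := ⟨X.unop⟩
  map f := VarTheory.Hom.ofMorphism f.unop
  map_id := by
    intro X
    refine VarTheory.Hom.ext' ?_ ?_
    · exact constMap_id X.unop.obj
    · intro F _ _ _ α β h h' y
      exact Category.comp_id _
  map_comp := by
    intro X Y Z f g
    refine VarTheory.Hom.ext' ?_ ?_
    · exact constMap_comp g.unop.hom f.unop.hom
    · intro F _ _ _ α β h h' y
      exact (Category.assoc _ _ _).symm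

/-! ### Varieties and regular maps over a subfield, in coordinates -/

section Atlas

variable {k F : Type u} [Field k] [Field F] [Algebra k F]

/-- `Z ⊆ F^ι` is the zero set of a system of polynomials with coefficients in `K`. -/
def IsZeroLocus (K : Subalgebra k F) {ι : Type} (Z : Set (ι → F)) : Prop :=
  ∃ S : Set (MvPolynomial ι K), Z = {t | ∀ p ∈ S, MvPolynomial.aeval t p = 0}

/-- A system of `F`-valued coordinate charts on a set `P`. -/
structure Atlas (F : Type u) (P : Type u) where
  /-- index set of the charts -/
  index : Type u
  /-- number of coordinates -/
  dim : index → ℕ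
  /-- domain of a chart -/
  dom : index → Set P
  /-- coordinates; only the values on the domain matter -/
  coord : ∀ i, P → Fin (dim i) → F

/-- A map `φ : P → Q` is regular over `K` with respect to given atlases: near every point it is
given in coordinates by quotients of polynomials with coefficients in `K`. -/
def IsRegularOver (K : Subalgebra k F) {P Q : Type u} (𝒜 : Atlas F P) (ℬ : Atlas F Q)
    (φ : P → Q) : Prop :=
  ∀ (i : 𝒜.index) (j : ℬ.index) (p : P), p ∈ 𝒜.dom i → φ p ∈ ℬ.dom j →
    ∃ (q : MvPolynomial (Fin (𝒜.dim i)) K) (r : Fin (ℬ.dim j) → MvPolynomial (Fin (𝒜.dim i)) K),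
      MvPolynomial.aeval (𝒜.coord i p) q ≠ 0 ∧
      ∀ p' ∈ 𝒜.dom i, MvPolynomial.aeval (𝒜.coord i p') q ≠ 0 →
        φ p' ∈ ℬ.dom j ∧ ∀ l, ℬ.coord j (φ p') l =
          MvPolynomial.aeval (𝒜.coord i p') (r l) / MvPolynomial.aeval (𝒜.coord i p') q

/-- The atlas makes `P` an (abstract, separated) algebraic variety defined over `K`: finitely many
charts cover `P`, every chart is a bijection onto an affine variety over `K`, the changes of
coordinates are regular over `K` with Zariski open domains, and their graphs are Zariski closed
over `K`. -/
structure IsVarietyOver (K : Subalgebra k F) {P : Type u} (𝒜 : Atlas F P) : Prop where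
  cover : ∃ s : Finset 𝒜.index, ∀ p, ∃ i ∈ s, p ∈ 𝒜.dom i
  injOn : ∀ i, Set.InjOn (𝒜.coord i) (𝒜.dom i)
  closed : ∀ i, IsZeroLocus K (𝒜.coord i '' 𝒜.dom i)
  transition : IsRegularOver K 𝒜 𝒜 id
  separated : ∀ i j, IsZeroLocus K
    ((fun p => Sum.elim (𝒜.coord i p) (𝒜.coord j p)) '' (𝒜.dom i ∩ 𝒜.dom j))

/-- A coordinate system on `X`: an affine open set with a finite tuple of generators of its
`k`-algebra of regular functions. -/
structure CoordSystem (X : KScheme k) : Type u where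
  /-- the affine open set -/
  U : X.left.affineOpens
  /-- the number of generators -/
  n : ℕ
  /-- the generators -/
  gen : Fin n → Γ(X.left, U)
  generates : Function.Surjective (MvPolynomial.eval₂Hom (kmap X U) gen)

open Classical in
/-- The atlas of `X_α(F)` given by all coordinate systems on `X`. -/
def atlas (X : KScheme k) (α : constField X →ₐ[k] F) : Atlas F (VPoint X α) where
  index := CoordSystem X
  dim c := c.n
  dom c := {x | x.pt.Mem c.U}
  coord c x l := if h : x.pt.Mem c.U then x.pt.value c.U h (c.gen l) else 0

end Atlas

/-! ### Interpretations -/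

section Interpretation

open FirstOrder FirstOrder.Language

/-- Data of an interpretation (without parameters) of `L`-structures in `L'`-structures, where `L`
is a relational language: formulas of `L'` for the domain `D`, for the equivalence relation `E` on
`D`, and for the basic relations on the sort `D/E`. -/
structure Interpretation (L L' : FirstOrder.Language.{u, u}) where
  /-- the domain `D` consists of tuples of this length -/
  dim : ℕ
  /-- the formula defining `D` -/
  dom : L'.Formula (Fin dim)
  /-- the formula defining `E` -/
  eqv : L'.Formula (Fin dim ⊕ Fin dim)
  /-- the formulas defining the basic relations -/
  rel : ∀ {m : ℕ}, L.Relations m → L'.Formula (Fin m × Fin dim)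

namespace Interpretation

variable {L L' : FirstOrder.Language.{u, u}} (I : Interpretation L L') {M N : Type u} [L'.Structure M]
  [L.Structure N]

/-- The definable set `D`. -/
abbrev Dom (M : Type u) [L'.Structure M] : Type u := {d : Fin I.dim → M // I.dom.Realize d}

/-- `π : D → N` induces a bijection `D/E → N` under which the basic relations of `N` correspond to
the relations on the sort `D/E` given by `I`. The inverse bijection `N → D/E` is then an
interpretation of `N` in `M`. -/
structure IsRealizedBy (π : I.Dom M → N) : Prop where
  surjective : Function.Surjective π
  eqv_iff : ∀ d e : I.Dom M, I.eqv.Realize (Sum.elim d.1 e.1) ↔ π d = π e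
  rel_iff : ∀ {m : ℕ} (R : L.Relations m) (d : Fin m → I.Dom M),
    (I.rel R).Realize (fun ij => (d ij.1).1 ij.2) ↔ Structure.RelMap R (fun i => π (d i))

variable {I}

/-- The relation on `D/E` corresponding to the relation `S` on `N`, as a set of tuples from `M`. -/
def pullback (π : I.Dom M → N) {m : ℕ} (S : Set (Fin m → N)) : Set (Fin m × Fin I.dim → M) :=
  {v | ∃ d : Fin m → I.Dom M, (∀ i j, v (i, j) = (d i).1 j) ∧ (fun i => π (d i)) ∈ S}

/-- Embedding-interpretation, for first-order definability without parameters: the interpreted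
copy of `N` has no proper expansion definable in `M`. -/
def IsEmbedding (π : I.Dom M → N) : Prop :=
  ∀ (m : ℕ) (S : Set (Fin m → N)),
    (∅ : Set M).Definable L' (pullback π S) → (∅ : Set N).Definable L S

/-- Embedding-interpretation, where a relation counts as definable when it is invariant under all
automorphisms of the structure. -/
def IsInvariantEmbedding (π : I.Dom M → N) : Prop :=
  ∀ (m : ℕ) (S : Set (Fin m → N)),
    (∀ σ : M ≃[L'] M, ∀ v ∈ pullback π S, (fun ij => σ (v ij)) ∈ pullback π S) →
      ∀ σ : N ≃[L] N, ∀ v ∈ S, (fun i => σ (v i)) ∈ S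

/-- The formula `γ` defines the graph of the map `M → D/E` corresponding to `h : M → N`. -/
def Tracks (π : I.Dom M → N) (γ : L'.Formula (Unit ⊕ Fin I.dim)) (h : M → N) : Prop :=
  ∀ (x : M) (d : I.Dom M), γ.Realize (Sum.elim (fun _ => x) d.1) ↔ π d = h x

end Interpretation

/-- `f^*` determines the interpretation `I` of `T^X` in `T^Y`: in all appropriate pairs of models,
by the same formulas, `I` interprets `(X_α(F), F_{/k})` in `(Y_β(F), F_{/k})` in such a way that
the map `f^*_{β,α} : Y_β(F) → X_α(F)` and the identity of `F` become definable, by `γ`. -/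
def Interprets {k : Type u} [Field k] {X Y : KScheme k} (f : Y ⟶ X)
    (I : Interpretation (lang X) (lang Y)) (γ : (lang Y).Formula (Unit ⊕ Fin I.dim)) : Prop :=
  ∀ (F : Type u) [Field F] [IsAlgClosed F] [Algebra k F] (α : constField X →ₐ[k] F)
    (β : constField Y →ₐ[k] F) (h : β.comp (constMap f) = α),
    ∃ π : I.Dom (Model Y β) → Model X α,
      I.IsRealizedBy π ∧ Interpretation.Tracks π γ (modelMap (VPoint.map f h))

end Interpretation

end VarietyTheory

end

/-! Over an affine open set `U`, an `F`-point of `X` is a `k`-homomorphism from the sections on `U`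
to `F`. Once finitely many generators are chosen, the points of `X_α(F)` in `U` become the tuples
that satisfy finitely many equations: the relations between the generators, and equations which give
each constant `c` the value `α c`. Finitely many of the latter suffice because `k^X` is finite over
`k` (`finite_constField`, `exists_finite_equations`). Since `X` is noetherian and separated,
finitely many charts cover it, and on an overlap, again affine, the coordinates of both charts
together generate the functions (`inf_generated`). This gives the atlas.

Equivalence of categories. On a reduced scheme sections and morphisms are determined by values at
geometric points (`section_ext_of_values`, `hom_ext_of_points`), whence faithfulness. For fullness,
the functions `b` that a regular family of maps attaches to the functions `a` are therefore unique,
so `a ↦ b` is a ring homomorphism; the resulting local morphisms agree on overlaps and glue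
(`exists_local_morphism`, `exists_morphism`).

Models. First-order properties of the standard structures pass to every model `M`. They make the
field sort an algebraically closed field over `k`, and the values at an element of `M` a ring
homomorphism, hence a point of `X`. The constants take the same values at all elements, which yields
`α`; the finite equations of the charts show that every point of `X_α(F)` occurs
(`Frame.exists_equiv`).

Interpretations. A model of `T^Y` has the field and defines the values of the constants of `Y`,
hence those of `X`, so that it defines the coordinate description of `X_α(F)`
(`exists_interpretation_model`). An element of `X_α(F)` is determined by a chart and its scalar
coordinates, and scalars are tracked by the identity of `F`; so two tracked interpretations can be
compared definably (`Traceable.udef_eq`). If moreover `f(k^X) = k^Y`, the constants of `Y` are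
definable over `X`, so `Y_β(F)` is conversely interpreted in `X_α(F)`. The composite
self-interpretation of `X_α(F)` is definably the identity. Hence nothing new becomes definable
(`isEmbedding`), and every automorphism of `X_α(F)` is induced by one of `Y_β(F)`
(`isInvariantEmbedding`). -/

noncomputable section

namespace VarietyTheory

section Schemes

variable {k : Type u} [Field k]

/-! ### Points in an affine open set as ring homomorphisms. -/

section PointGeometry
variable {X Y : KScheme k} {F : Type u} [Field F] [Algebra k F]

/-- The point of the scheme underlying an `F`-rational point. -/
def Point.center (p : Point X F) : X.left :=
  p.left (show (specField k F).left from IsLocalRing.closedPoint F)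

theorem Point.mem_iff (p : Point X F) (U : X.left.Opens) : p.Mem U ↔ p.center ∈ U := by
  constructor
  · intro h
    exact h (x := (show (specField k F).left from IsLocalRing.closedPoint F)) trivial
  · intro h x _
    have hx : x = (show (specField k F).left from IsLocalRing.closedPoint F) :=
      Subsingleton.elim (α := PrimeSpectrum F) _ _
    subst hx
    exact h

theorem Point.Mem.mono {p : Point X F} {U V : X.left.Opens} (h : p.Mem U) (hUV : U ≤ V) :
    p.Mem V := (p.mem_iff V).2 (hUV ((p.mem_iff U).1 h))

/-- Restriction of sections. -/
def res (X : KScheme k) {U V : X.left.Opens} (h : V ≤ U) : Γ(X.left, U) →+* Γ(X.left, V) :=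
  (X.left.presheaf.map (homOfLE h).op).hom

theorem Point.value_res (p : Point X F) {U V : X.left.Opens} (h : V ≤ U) (hV : p.Mem V)
    (hU : p.Mem U) (a : Γ(X.left, U)) : p.value V hV (res X h a) = p.value U hU a := by
  have := Scheme.Hom.map_appLE p.left hV (homOfLE h).op
  change (Scheme.ΓSpecIso (CommRingCat.of F)).hom.hom
    ((X.left.presheaf.map (homOfLE h).op ≫ p.left.appLE V ⊤ hV).hom a) = _
  rw [this]
  rfl

theorem res_kmap {U V : X.left.Opens} (h : V ≤ U) (c : k) :
    res X h (kmap X U c) = kmap X V c := by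
  have := Scheme.Hom.appLE_map X.hom
    (show U ≤ X.hom ⁻¹ᵁ ⊤ from fun _ _ => trivial) (homOfLE h).op
  exact congrArg (fun t => t.hom ((Scheme.ΓSpecIso (CommRingCat.of k)).inv.hom c)) this

theorem kmap_specField (c : k) :
    (Scheme.ΓSpecIso (CommRingCat.of F)).hom.hom (kmap (specField k F) ⊤ c) = algebraMap k F c := by
  have := Scheme.ΓSpecIso_naturality (CommRingCat.ofHom (algebraMap k F))
  have h2 := congrArg (fun t => t.hom ((Scheme.ΓSpecIso (CommRingCat.of k)).inv.hom c)) this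
  have h3 : (Scheme.ΓSpecIso (CommRingCat.of k)).hom.hom
     ((Scheme.ΓSpecIso (CommRingCat.of k)).inv.hom c) = c :=
    congrArg (fun t => t.hom c) (Scheme.ΓSpecIso (CommRingCat.of k)).inv_hom_id
  simp only [CommRingCat.hom_comp, RingHom.comp_apply, h3] at h2
  refine Eq.trans ?_ h2
  simp only [kmap, RingHom.comp_apply]
  congr 2

theorem Point.value_kmap (p : Point X F) (U : X.left.Opens) (h : p.Mem U) (c : k) :
    p.value U h (kmap X U c) = algebraMap k F c := by
  exact (congrArg (Scheme.ΓSpecIso (CommRingCat.of F)).hom.hom (appLE_kmap p U ⊤ h c)).trans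
    (kmap_specField c)

theorem basicOpen_Spec_field_eq_top (t : Γ(Spec (CommRingCat.of F), ⊤)) :
    (Spec (CommRingCat.of F)).basicOpen t = ⊤ ↔
      (Scheme.ΓSpecIso (CommRingCat.of F)).hom.hom t ≠ 0 := by
  have hinj : (Scheme.ΓSpecIso (CommRingCat.of F)).inv.hom
      ((Scheme.ΓSpecIso (CommRingCat.of F)).hom.hom t) = t :=
    congrArg (fun s => s.hom t) (Scheme.ΓSpecIso (CommRingCat.of F)).hom_inv_id
  constructor
  · intro h h0
    rw [h0, map_zero] at hinj
    rw [← hinj, Scheme.basicOpen_zero] at h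
    have : (IsLocalRing.closedPoint F : Spec (CommRingCat.of F)) ∈
      (⊥ : (Spec (CommRingCat.of F)).Opens) := by rw [h]; trivial
    exact this
  · intro h
    apply Scheme.basicOpen_of_isUnit
    rw [← hinj]
    exact (IsUnit.mk0 (G₀ := F) _ h).map _

/-- A section over the spectrum of a field is zero or a unit. This turns membership in open sets
into inequations between coordinates. -/
theorem Point.mem_basicOpen (p : Point X F) {U : X.left.Opens} (h : p.Mem U) (a : Γ(X.left, U)) :
    p.Mem (X.left.basicOpen a) ↔ p.value U h a ≠ 0 := by
  have h1 := Scheme.basicOpen_appLE p.left ⊤ U h a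
  rw [top_inf_eq] at h1
  have h2 := basicOpen_Spec_field_eq_top (F := F) ((p.left.appLE U ⊤ h).hom a)
  refine Iff.trans ?_ h2
  rw [← top_le_iff]
  exact iff_of_eq (congrArg (fun W => ⊤ ≤ W) h1.symm)

theorem fromSpec_hom {U : X.left.Opens} (hU : IsAffineOpen U) :
    hU.fromSpec ≫ X.hom = Spec.map (CommRingCat.ofHom (kmap X U)) := by
  have h := IsAffineOpen.SpecMap_appLE_fromSpec X.hom (isAffineOpen_top (Spec (CommRingCat.of k))) hU
    (show U ≤ X.hom ⁻¹ᵁ ⊤ from fun _ _ => trivial)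
  rw [← h, IsAffineOpen.fromSpec_top, Scheme.isoSpec_Spec_inv, ← Spec.map_comp]
  rfl

theorem Spec_hom_eq {S : Scheme.{u}} {R : CommRingCat.{u}} {U : S.Opens} (hU : IsAffineOpen U)
    (q : Spec R ⟶ S) (h : ⊤ ≤ q ⁻¹ᵁ U) :
    q = Spec.map (q.appLE U ⊤ h ≫ (Scheme.ΓSpecIso R).hom) ≫ hU.fromSpec := by
  have h := IsAffineOpen.SpecMap_appLE_fromSpec q hU (isAffineOpen_top (Spec R)) h
  rw [IsAffineOpen.fromSpec_top, Scheme.isoSpec_Spec_inv] at h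
  rw [Spec.map_comp, Category.assoc, h, ← Category.assoc, ← Spec.map_comp, Iso.inv_hom_id,
    Spec.map_id, Category.id_comp]

/-- Recovers a point from its values on one affine open set; together with `Point.ofHom` this is the
dictionary between points and homomorphisms. -/
theorem Point.left_eq (p : Point X F) {U : X.left.Opens} (hU : IsAffineOpen U) (h : p.Mem U) :
    p.left = Spec.map (CommRingCat.ofHom (p.value U h)) ≫ hU.fromSpec := by
  exact Spec_hom_eq hU p.left h

theorem Point.ext_value {p q : Point X F} {U : X.left.Opens} (hU : IsAffineOpen U) (hp : p.Mem U)
    (hq : q.Mem U) (h : p.value U hp = q.value U hq) : p = q := by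
  ext1
  rw [p.left_eq hU hp, q.left_eq hU hq, h]

/-- The point with given coordinates in an affine open set. -/
def Point.ofHom {U : X.left.Opens} (hU : IsAffineOpen U) (φ : Γ(X.left, U) →+* F)
    (h : φ.comp (kmap X U) = algebraMap k F) : Point X F :=
  Over.homMk (V := X) (show (specField k F).left ⟶ X.left from
    Spec.map (CommRingCat.ofHom φ) ≫ hU.fromSpec) (by
    have : (Spec.map (CommRingCat.ofHom φ) ≫ hU.fromSpec) ≫ X.hom =
        Spec.map (CommRingCat.ofHom (algebraMap k F)) := by
      rw [Category.assoc, fromSpec_hom, ← Spec.map_comp, ← CommRingCat.ofHom_comp, h]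
    exact this)

theorem Point.mem_ofHom {U : X.left.Opens} (hU : IsAffineOpen U) (φ : Γ(X.left, U) →+* F)
    (h : φ.comp (kmap X U) = algebraMap k F) : (Point.ofHom hU φ h).Mem U := by
  rw [Point.mem_iff]
  have : (hU.fromSpec ((Spec.map (CommRingCat.ofHom φ)) (IsLocalRing.closedPoint F)) : X.left) ∈ U := by
    have := Set.mem_range_self (f := hU.fromSpec) ((Spec.map (CommRingCat.ofHom φ)) (IsLocalRing.closedPoint F))
    rw [IsAffineOpen.range_fromSpec] at this
    exact this
  exact this

theorem Point.value_ofHom {U : X.left.Opens} (hU : IsAffineOpen U) (φ : Γ(X.left, U) →+* F)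
    (h : φ.comp (kmap X U) = algebraMap k F) :
    (Point.ofHom hU φ h).value U (Point.mem_ofHom hU φ h) = φ := by
  have h1 := Point.left_eq _ hU (Point.mem_ofHom hU φ h)
  have h2 : Spec.map (CommRingCat.ofHom φ) ≫ hU.fromSpec =
    Spec.map (CommRingCat.ofHom ((Point.ofHom hU φ h).value U (Point.mem_ofHom hU φ h))) ≫ hU.fromSpec := h1
  rw [cancel_mono] at h2
  have := Spec.map_injective h2
  exact (congrArg CommRingCat.Hom.hom this).symm

end PointGeometry

/-! ### Geometric points separate sections and morphisms on reduced schemes. -/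

section Points
variable {X Y : KScheme k}

/-- Take the algebraic closure of the residue field at `y`. -/
theorem exists_point_center_eq (y : Y.left) :
    ∃ (F : Type u) (_ : Field F) (_ : IsAlgClosed F) (_ : Algebra k F) (p : Point Y F),
      p.center = y := by
  let κ : Type u := Y.left.residueField y
  let F : Type u := AlgebraicClosure κ
  let q : Spec (CommRingCat.of F) ⟶ Y.left :=
    Spec.map (CommRingCat.ofHom (algebraMap κ F)) ≫ Y.left.fromSpecResidueField y
  -- The `k`-structure of `F` is read off from the composite morphism to the spectrum of `k`, so
  -- that `q` is a morphism over `k`.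
  let _ : Algebra k F := (Spec.preimage (q ≫ Y.hom)).hom.toAlgebra
  refine ⟨F, inferInstance, inferInstance, inferInstance,
    Over.homMk (V := Y) (U := specField k F) q ?_, ?_⟩
  · exact (Spec.map_preimage (q ≫ Y.hom)).symm
  · exact Scheme.fromSpecResidueField_apply y _

/-- By reducedness `a` vanishes as soon as its basic open set is empty, and any point of that set
would carry a geometric point with a nonzero value. -/
theorem section_eq_zero_of_values [IsReduced Y.left] {V : Y.left.Opens} (a : Γ(Y.left, V))
    (h : ∀ (F : Type u) [Field F] [IsAlgClosed F] [Algebra k F] (p : Point Y F) (hV : p.Mem V),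
      p.value V hV a = 0) : a = 0 := by
  apply eq_zero_of_basicOpen_eq_bot
  rw [eq_bot_iff]
  intro y hy
  obtain ⟨F, _, _, _, p, rfl⟩ := exists_point_center_eq y
  rw [← Point.mem_iff] at hy
  have hV := hy.mono (Y.left.basicOpen_le a)
  exact ((p.mem_basicOpen hV a).1 hy (h F p hV)).elim

theorem section_ext_of_values [IsReduced Y.left] {V : Y.left.Opens} {a b : Γ(Y.left, V)}
    (h : ∀ (F : Type u) [Field F] [IsAlgClosed F] [Algebra k F] (p : Point Y F) (hV : p.Mem V),
      p.value V hV a = p.value V hV b) : a = b := by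
  rw [← sub_eq_zero]
  apply section_eq_zero_of_values
  intro F _ _ _ p hV
  rw [map_sub, h F p hV, sub_self]

theorem Point.center_map {F : Type u} [Field F] [Algebra k F] (f : Y ⟶ X) (p : Point Y F) :
    (p.map f).center = f.left p.center := rfl

/-- Morphisms from a reduced scheme are determined by their values at geometric points. -/
theorem hom_ext_of_points [IsReduced Y.left] (f g : Y ⟶ X)
    (h : ∀ (F : Type u) [Field F] [IsAlgClosed F] [Algebra k F] (p : Point Y F),
      p.map f = p.map g) : f = g := by
  ext1
  -- Every scheme point is the center of a geometric point, so the underlying maps agree. This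
  -- allows a common affine target for `f` and `g` near each point.
  have hc : ∀ y : Y.left, f.left y = g.left y := by
    intro y
    obtain ⟨F, _, _, _, p, rfl⟩ := exists_point_center_eq y
    rw [← Point.center_map, h F p]
    rfl
  have hloc : ∀ y : Y.left, ∃ V : Y.left.Opens, y ∈ V ∧ V.ι ≫ f.left = V.ι ≫ g.left := by
    intro y
    obtain ⟨_, ⟨U, hU, rfl⟩, hyU, -⟩ := X.left.isBasis_affineOpens.exists_subset_of_mem_open
      (Set.mem_univ (f.left y)) isOpen_univ
    have hy' : y ∈ (f.left ⁻¹ᵁ U ⊓ g.left ⁻¹ᵁ U) :=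
      ⟨hyU, show g.left y ∈ U from hc y ▸ hyU⟩
    obtain ⟨_, ⟨V, hV, rfl⟩, hyV, hVU⟩ := Y.left.isBasis_affineOpens.exists_subset_of_mem_open
      (show y ∈ ((f.left ⁻¹ᵁ U ⊓ g.left ⁻¹ᵁ U : Y.left.Opens) : Set Y.left) from hy')
      (f.left ⁻¹ᵁ U ⊓ g.left ⁻¹ᵁ U).isOpen
    refine ⟨V, hyV, ?_⟩
    have e1 : V ≤ f.left ⁻¹ᵁ U := fun x hx => (hVU hx).1
    have e2 : V ≤ g.left ⁻¹ᵁ U := fun x hx => (hVU hx).2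
    have key : f.left.appLE U V e1 = g.left.appLE U V e2 := by
      ext a
      apply section_ext_of_values (Y := Y)
      intro F _ _ _ p hp
      have h1 := Point.value_map f p U V e1 hp (hp.mono e1) a
      have h2 := Point.value_map g p U V e2 hp (hp.mono e2) a
      refine h1.symm.trans (Eq.trans ?_ h2)
      congr 1
      simp only [h F p]
    have h1 := IsAffineOpen.SpecMap_appLE_fromSpec f.left hU hV e1
    have h2 := IsAffineOpen.SpecMap_appLE_fromSpec g.left hU hV e2
    rw [key, h2] at h1
    rw [← IsAffineOpen.isoSpec_hom_fromSpec hV, Category.assoc, Category.assoc, h1]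
  choose V hyV hV using hloc
  let 𝒰 : Y.left.OpenCover := Y.left.openCoverOfIsOpenCover V (by
    rw [TopologicalSpace.IsOpenCover, eq_top_iff]
    intro y _
    exact TopologicalSpace.Opens.mem_iSup.2 ⟨y, hyV y⟩)
  exact Scheme.Cover.hom_ext 𝒰 _ _ (fun y => hV y)

end Points

/-! ### Finiteness and separatedness of quasi-projective schemes. -/

section QuasiProjective

attribute [local instance] MvPolynomial.gradedAlgebra

/-- Generators over `k` remain generators over the degree zero part. The instance serves the
finiteness properties of `Proj.toSpecZero`. -/
instance finiteType_degree_zero (n : ℕ) : Algebra.FiniteType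
    (MvPolynomial.homogeneousSubmodule (Fin (n + 1)) k 0) (MvPolynomial (Fin (n + 1)) k) :=
  have h : ((algebraMap (MvPolynomial.homogeneousSubmodule (Fin (n + 1)) k 0)
      (MvPolynomial (Fin (n + 1)) k)).comp (algebraMap k
        (MvPolynomial.homogeneousSubmodule (Fin (n + 1)) k 0))).FiniteType := by
    have : Algebra.FiniteType k (MvPolynomial (Fin (n + 1)) k) := inferInstance
    exact RingHom.finiteType_algebraMap.2 this
  RingHom.finiteType_algebraMap.1 (RingHom.FiniteType.of_comp_finiteType h)

theorem algebraMap_degree_zero_surjective (n : ℕ) : Function.Surjective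
    (algebraMap k (MvPolynomial.homogeneousSubmodule (Fin (n + 1)) k 0)) := by
  rintro ⟨p, hp⟩
  have h0 : p.totalDegree = 0 := Nat.le_zero.1 (MvPolynomial.IsHomogeneous.totalDegree_le hp)
  exact ⟨p.coeff 0, Subtype.ext (MvPolynomial.totalDegree_eq_zero_iff_eq_C.1 h0).symm⟩

instance (n : ℕ) : LocallyOfFiniteType (projectiveSpace k n).hom := by
  have h : LocallyOfFiniteType (Spec.map (CommRingCat.ofHom
      (algebraMap k (MvPolynomial.homogeneousSubmodule (Fin (n + 1)) k 0)))) :=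
    (HasRingHomProperty.Spec_iff (P := @LocallyOfFiniteType)).2
      (RingHom.FiniteType.of_surjective _ (algebraMap_degree_zero_surjective n))
  exact inferInstanceAs (LocallyOfFiniteType
    (Proj.toSpecZero (MvPolynomial.homogeneousSubmodule (Fin (n + 1)) k) ≫ Spec.map _))

instance (n : ℕ) : IsSeparated (projectiveSpace k n).hom :=
  inferInstanceAs (IsSeparated
    (Proj.toSpecZero (MvPolynomial.homogeneousSubmodule (Fin (n + 1)) k) ≫ Spec.map _))

instance (n : ℕ) : QuasiCompact (projectiveSpace k n).hom :=
  inferInstanceAs (QuasiCompact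
    (Proj.toSpecZero (MvPolynomial.homogeneousSubmodule (Fin (n + 1)) k) ≫ Spec.map _))

instance (n : ℕ) : IsNoetherian (projectiveSpace k n).left := by
  have : IsLocallyNoetherian (projectiveSpace k n).left :=
    LocallyOfFiniteType.isLocallyNoetherian (projectiveSpace k n).hom
  have : CompactSpace (projectiveSpace k n).left := 
    QuasiCompact.compactSpace_of_compactSpace (projectiveSpace k n).hom
  constructor

variable (X : QProj k)

instance : IsReduced X.obj.left := X.property.1
instance : ConnectedSpace X.obj.left := X.property.2.1

instance : LocallyOfFiniteType X.obj.hom := by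
  obtain ⟨n, i, hi⟩ := X.property.2.2
  rw [← Over.w i]
  infer_instance

instance : IsSeparated X.obj.hom := by
  obtain ⟨n, i, hi⟩ := X.property.2.2
  rw [← Over.w i]
  infer_instance

instance : IsNoetherian X.obj.left := by
  obtain ⟨n, i, hi⟩ := X.property.2.2
  have : IsLocallyNoetherian X.obj.left :=
    LocallyOfFiniteType.isLocallyNoetherian X.obj.hom
  have : TopologicalSpace.NoetherianSpace X.obj.left :=
    i.left.isEmbedding.isInducing.noetherianSpace
  constructor

theorem finiteType_kmap (U : X.obj.left.affineOpens) : (kmap X.obj U).FiniteType := by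
  have h1 := X.obj.hom.finiteType_appLE (isAffineOpen_top (Spec (CommRingCat.of k))) U.2
    (show (U : X.obj.left.Opens) ≤ X.obj.hom ⁻¹ᵁ ⊤ from fun _ _ => trivial)
  exact h1.comp (RingHom.FiniteType.of_surjective _
    (Scheme.ΓSpecIso (CommRingCat.of k)).symm.commRingCatIsoToRingEquiv.surjective)

theorem exists_coordSystem (U : X.obj.left.affineOpens) : ∃ c : CoordSystem X.obj, c.U = U := by
  let _ : Algebra k Γ(X.obj.left, U) := (kmap X.obj U).toAlgebra
  have h : Algebra.FiniteType k Γ(X.obj.left, U) := finiteType_kmap X U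
  obtain ⟨n, f, hf⟩ := Algebra.FiniteType.iff_quotient_mvPolynomial''.1 h
  refine ⟨⟨U, n, fun i => f (MvPolynomial.X i), ?_⟩, rfl⟩
  have : (MvPolynomial.eval₂Hom (kmap X.obj U) fun i => f (MvPolynomial.X i)) = f := by
    refine MvPolynomial.ringHom_ext (fun c => ?_) fun i => ?_
    · rw [MvPolynomial.eval₂Hom_C]
      exact (f.commutes c).symm
    · rw [MvPolynomial.eval₂Hom_X']
      rfl
  rw [this]
  exact hf

theorem isCompact_opens (W : X.obj.left.Opens) : IsCompact (W : Set X.obj.left) :=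
  TopologicalSpace.NoetherianSpace.isCompact _

theorem exists_finite_affine_cover (W : X.obj.left.Opens) :
    ∃ s : Finset X.obj.left.affineOpens, (∀ U ∈ s, (U : X.obj.left.Opens) ≤ W) ∧
      ∀ x ∈ W, ∃ U ∈ s, x ∈ (U : X.obj.left.Opens) := by
  obtain ⟨s, hs, rfl⟩ := isCompact_iff_finite_and_eq_biUnion_affineOpens.1 (isCompact_opens X W)
  refine ⟨hs.toFinset, fun U hU => ?_, fun x hx => ?_⟩
  · exact le_iSup₂_of_le U (hs.mem_toFinset.1 hU) le_rfl
  · simpa [TopologicalSpace.Opens.mem_iSup] using hx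

/-- By noetherianity the part of `W` inside a chart is a finite union of basic open sets, so that
membership in `W` becomes a finite disjunction of inequations. -/
theorem exists_finite_basicOpen_cover (U : X.obj.left.affineOpens) (W : X.obj.left.Opens) :
    ∃ s : Finset Γ(X.obj.left, U), (∀ g ∈ s, X.obj.left.basicOpen g ≤ W) ∧
      ∀ x ∈ (U : X.obj.left.Opens), x ∈ W → ∃ g ∈ s, x ∈ X.obj.left.basicOpen g := by
  classical
  have hloc : ∀ x : ((U : X.obj.left.Opens) ⊓ W : X.obj.left.Opens), ∃ g : Γ(X.obj.left, U),
      X.obj.left.basicOpen g ≤ W ∧ x.1 ∈ X.obj.left.basicOpen g := fun x =>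
    U.2.exists_basicOpen_le (⟨x.1, x.2.2⟩ : W) x.2.1
  choose g hg hx using hloc
  obtain ⟨t, ht⟩ := (isCompact_opens X ((U : X.obj.left.Opens) ⊓ W)).elim_finite_subcover
    (fun x => (X.obj.left.basicOpen (g x) : Set X.obj.left)) (fun x => (X.obj.left.basicOpen _).isOpen)
    (fun x hxW => Set.mem_iUnion.2 ⟨⟨x, hxW⟩, hx ⟨x, hxW⟩⟩)
  refine ⟨t.image g, ?_, ?_⟩
  · intro a ha
    obtain ⟨x, -, rfl⟩ := Finset.mem_image.1 ha
    exact hg x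
  · intro x hxU hxW
    obtain ⟨y, hy, hxy⟩ := Set.mem_iUnion₂.1 (ht (show x ∈ _ from ⟨hxU, hxW⟩))
    exact ⟨g y, Finset.mem_image_of_mem g hy, hxy⟩

theorem exists_fraction {X : KScheme k} (U : X.left.affineOpens) (g : Γ(X.left, U))
    (a : Γ(X.left, X.left.basicOpen g)) : ∃ (n : ℕ) (r : Γ(X.left, U)),
      a * res X (X.left.basicOpen_le g) g ^ n = res X (X.left.basicOpen_le g) r := by
  have := U.2.isLocalization_basicOpen g
  obtain ⟨n, r, h⟩ := IsLocalization.Away.surj g a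
  refine ⟨n, r, ?_⟩
  exact h

theorem surjective_of_isClosedImmersion_SpecMap {A B : CommRingCat.{u}} (φ : A ⟶ B)
    [IsClosedImmersion (Spec.map φ)] : Function.Surjective φ.hom := by
  have h := (IsClosedImmersion.isAffine_surjective_of_isAffine (Spec.map φ)).2
  have h2 := Scheme.ΓSpecIso_naturality φ
  intro b
  obtain ⟨a, ha⟩ := h ((Scheme.ΓSpecIso B).inv.hom b)
  refine ⟨(Scheme.ΓSpecIso A).hom.hom a, ?_⟩
  have h3 := congrArg (fun t => t.hom a) h2
  have h4 : (Scheme.ΓSpecIso B).hom.hom ((Scheme.ΓSpecIso B).inv.hom b) = b :=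
    congrArg (fun t => t.hom b) (Scheme.ΓSpecIso B).inv_hom_id
  refine h3.symm.trans (Eq.trans ?_ h4)
  exact congrArg _ ha

theorem map_fromSpec_res {X : KScheme k} {U W : X.left.Opens} (hU : IsAffineOpen U)
    (hW : IsAffineOpen W) (h : W ≤ U) :
    Spec.map (CommRingCat.ofHom (res X h)) ≫ hU.fromSpec = hW.fromSpec :=
  hU.map_fromSpec hW (homOfLE h).op

/-- Separatedness makes the fibre product of `U` and `V` over `X` closed in their fibre product over
`k`, which is affine; the intersection is the image of the former. -/
theorem isAffineOpen_inf {U V : X.obj.left.Opens} (hU : IsAffineOpen U) (hV : IsAffineOpen V) :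
    IsAffineOpen (U ⊓ V) := by
  have := fromSpec_hom hU
  have := fromSpec_hom hV
  have : IsAffine (Limits.pullback (hU.fromSpec ≫ X.obj.hom) (hV.fromSpec ≫ X.obj.hom)) :=
    inferInstance
  have : IsAffine (Limits.pullback hU.fromSpec hV.fromSpec) :=
    (IsClosedImmersion.isAffine_surjective_of_isAffine
      (Limits.pullback.mapDesc hU.fromSpec hV.fromSpec X.obj.hom)).1
  have h := isAffineOpen_opensRange
    (Limits.pullback.fst hU.fromSpec hV.fromSpec ≫ hU.fromSpec)
  convert h
  ext1
  have := IsOpenImmersion.range_pullback_to_base_of_left hU.fromSpec hV.fromSpec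
  simp only [IsAffineOpen.range_fromSpec] at this
  exact this.symm

/-- On a separated scheme the functions on the intersection of two affine open sets are generated
by the restrictions of functions on these sets. -/
theorem inf_generated {U V : X.obj.left.Opens} (hU : IsAffineOpen U) (hV : IsAffineOpen V) (R : Subring Γ(X.obj.left, U ⊓ V))
    (hRU : ∀ a, res X.obj (inf_le_left : U ⊓ V ≤ U) a ∈ R)
    (hRV : ∀ a, res X.obj (inf_le_right : U ⊓ V ≤ V) a ∈ R) : R = ⊤ := by
  have hW : IsAffineOpen (U ⊓ V) := isAffineOpen_inf X hU hV
  let rU := (res X.obj (inf_le_left : U ⊓ V ≤ U)).codRestrict R hRU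
  let rV := (res X.obj (inf_le_right : U ⊓ V ≤ V)).codRestrict R hRV
  let t : Spec (CommRingCat.of Γ(X.obj.left, U ⊓ V)) ⟶ Spec (CommRingCat.of R) :=
    Spec.map (CommRingCat.ofHom R.subtype)
  let P := Limits.pullback hU.fromSpec hV.fromSpec
  let i := Limits.pullback.mapDesc hU.fromSpec hV.fromSpec X.obj.hom
  let w : P ⟶ X.obj.left := Limits.pullback.fst _ _ ≫ hU.fromSpec
  have hrange : Set.range hW.fromSpec = Set.range w := by
    rw [IsOpenImmersion.range_pullback_to_base_of_left hU.fromSpec hV.fromSpec]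
    simp only [IsAffineOpen.range_fromSpec]
    rfl
  let e := IsOpenImmersion.isoOfRangeEq hW.fromSpec w hrange
  have he : e.hom ≫ w = hW.fromSpec := IsOpenImmersion.isoOfRangeEq_hom_fac _ _ _
  have e1 : e.hom ≫ Limits.pullback.fst _ _ =
      Spec.map (CommRingCat.ofHom (res X.obj (inf_le_left : U ⊓ V ≤ U))) := by
    rw [← cancel_mono hU.fromSpec, map_fromSpec_res hU hW, Category.assoc]
    exact he
  have e2 : e.hom ≫ Limits.pullback.snd _ _ =
      Spec.map (CommRingCat.ofHom (res X.obj (inf_le_right : U ⊓ V ≤ V))) := by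
    rw [← cancel_mono hV.fromSpec, map_fromSpec_res hV hW, Category.assoc,
      ← Limits.pullback.condition]
    exact he
  let s : Spec (CommRingCat.of R) ⟶
      Limits.pullback (hU.fromSpec ≫ X.obj.hom) (hV.fromSpec ≫ X.obj.hom) :=
    Limits.pullback.lift (Spec.map (CommRingCat.ofHom rU)) (Spec.map (CommRingCat.ofHom rV)) (by
      rw [fromSpec_hom, fromSpec_hom, ← Spec.map_comp, ← Spec.map_comp]
      refine congrArg Spec.map (CommRingCat.hom_ext (RingHom.ext fun c => Subtype.ext ?_))
      exact (res_kmap (X := X.obj) inf_le_left c).trans (res_kmap (X := X.obj) inf_le_right c).symm)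
  have hts : t ≫ s = e.hom ≫ i := by
    apply Limits.pullback.hom_ext
    · rw [Category.assoc, Category.assoc, Limits.pullback.lift_fst,
        Limits.pullback.lift_fst, Category.comp_id, e1, ← Spec.map_comp]
      rfl
    · rw [Category.assoc, Category.assoc, Limits.pullback.lift_snd,
        Limits.pullback.lift_snd, Category.comp_id, e2, ← Spec.map_comp]
      rfl
  have hcl : IsClosedImmersion (t ≫ s) := by
    rw [hts]
    infer_instance
  have ht : IsClosedImmersion t := IsClosedImmersion.of_comp t s
  have := surjective_of_isClosedImmersion_SpecMap (CommRingCat.ofHom R.subtype)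
  rw [eq_top_iff]
  intro a _
  obtain ⟨b, rfl⟩ := this a
  exact b.2

end QuasiProjective

/-! ### The field of constants, and points with prescribed constants. -/

section Constants

/-- The basic open sets of `e` and `1 - e` are disjoint and cover `S`, so by connectedness one of
them is empty; by reducedness the corresponding section is zero. -/
theorem eq_zero_or_one_of_mul_self {S : Scheme.{u}} [IsReduced S] [ConnectedSpace S]
    (e : Γ(S, ⊤)) (he : e * e = e) : e = 0 ∨ e = 1 := by
  have hsup : S.basicOpen e ⊔ S.basicOpen (1 - e) = ⊤ := by
    rw [eq_top_iff]
    refine le_trans (le_of_eq (S.basicOpen_of_isUnit isUnit_one).symm) ?_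
    have := S.basicOpen_add_le e (1 - e)
    rwa [add_sub_cancel] at this
  have hinf : S.basicOpen e ⊓ S.basicOpen (1 - e) = ⊥ := by
    rw [← Scheme.basicOpen_mul, mul_sub, mul_one, he, sub_self, Scheme.basicOpen_zero]
  have hclopen : IsClopen (S.basicOpen e : Set S) := by
    refine ⟨⟨?_⟩, (S.basicOpen e).isOpen⟩
    have hc : (S.basicOpen e : Set S)ᶜ = S.basicOpen (1 - e) := by
      refine (isCompl_iff.2 ⟨disjoint_iff.2 ?_, codisjoint_iff.2 ?_⟩ : IsCompl _ _).compl_eq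
      · exact congrArg (fun W : S.Opens => (W : Set S)) hinf
      · exact congrArg (fun W : S.Opens => (W : Set S)) hsup
    rw [hc]
    exact (S.basicOpen (1 - e)).isOpen
  rcases isClopen_iff.1 hclopen with h | h
  · exact Or.inl (eq_zero_of_basicOpen_eq_bot _ (TopologicalSpace.Opens.ext h))
  · right
    have h1 : S.basicOpen e = ⊤ := TopologicalSpace.Opens.ext h
    rw [h1, top_inf_eq] at hinf
    exact (sub_eq_zero.1 (eq_zero_of_basicOpen_eq_bot _ hinf)).symm

instance (X : QProj k) : Nontrivial (Glob X.obj) := by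
  have : Nonempty (⊤ : X.obj.left.Opens) := ⟨⟨Classical.arbitrary X.obj.left, trivial⟩⟩
  exact Scheme.component_nontrivial X.obj.left ⊤

instance (X : QProj k) : _root_.IsReduced (Glob X.obj) :=
  IsReduced.component_reduced (X := X.obj.left) ⊤

/-- Such a ring is von Neumann regular: every `c` has a `u` with `c * c * u = c`. Then `c * u` is
idempotent, and it cannot be `0` when `c ≠ 0`. -/
theorem isField_of_isIntegral {A : Type*} [CommRing A] [Nontrivial A] [_root_.IsReduced A]
    [Algebra k A] [Algebra.IsIntegral k A] (h : ∀ e : A, e * e = e → e = 0 ∨ e = 1) :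
    IsField A := by
  refine ⟨⟨0, 1, zero_ne_one⟩, mul_comm, fun {c} hc => ?_⟩
  obtain ⟨p, hp, hpc⟩ := Algebra.IsIntegral.isIntegral (R := k) c
  -- Remove the powers of the variable from an equation `p` of `c`. The remaining factor `q` has
  -- nonzero constant term, and `c * q(c)` is nilpotent, hence zero.
  obtain ⟨q, hpq, hq⟩ := Polynomial.exists_eq_pow_rootMultiplicity_mul_and_not_dvd p hp.ne_zero 0
  rw [Polynomial.C_0, sub_zero] at hpq hq
  have hq0 : q.coeff 0 ≠ 0 := fun h0 => hq (Polynomial.X_dvd_iff.2 h0)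
  have hcq : c * Polynomial.aeval c q = 0 := by
    apply eq_zero_of_pow_eq_zero (n := p.rootMultiplicity 0 + 1)
    have : Polynomial.aeval c p = 0 := hpc
    rw [hpq, map_mul, map_pow, Polynomial.aeval_X] at this
    rw [mul_pow, pow_succ, pow_succ]
    linear_combination (c * Polynomial.aeval c q ^ p.rootMultiplicity 0 ) * this
  rw [← Polynomial.divX_mul_X_add q, map_add, map_mul, Polynomial.aeval_X, Polynomial.aeval_C] at hcq
  set r := Polynomial.aeval c q.divX
  have hinv : algebraMap k A (q.coeff 0) * algebraMap k A (q.coeff 0)⁻¹ = 1 := by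
    rw [← map_mul, mul_inv_cancel₀ hq0, map_one]
  -- Solves `c * (r * c + q.coeff 0) = 0` for `c`, by division by the constant term.
  set u := -(algebraMap k A (q.coeff 0)⁻¹ * r)
  have hcu : c * c * u = c := by
    simp only [u]
    linear_combination (-algebraMap k A (q.coeff 0)⁻¹) * hcq + c * hinv
  rcases h (c * u) (by linear_combination u * hcu) with h0 | h1
  · exact (hc (by rw [← hcu, mul_assoc, h0, mul_zero])).elim
  · exact ⟨u, h1⟩

theorem isField_constField (X : QProj k) : IsField (constField X.obj) := by
  have : Algebra.IsIntegral k (constField X.obj) :=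
    inferInstanceAs (Algebra.IsIntegral k (integralClosure k (Glob X.obj)))
  have : _root_.IsReduced (constField X.obj) :=
    isReduced_of_injective (constField X.obj).val Subtype.val_injective
  apply isField_of_isIntegral (k := k)
  intro e he
  rcases eq_zero_or_one_of_mul_self (S := X.obj.left) e.1 (congrArg Subtype.val he) with h | h
  · exact Or.inl (Subtype.ext h)
  · exact Or.inr (Subtype.ext h)

/-- The embedding of the field of constants given by a point. -/
def Point.alpha {X : KScheme k} {F : Type u} [Field F] [Algebra k F] (p : Point X F) :
    constField X →ₐ[k] F :=
  { p.globValue.comp (constField X).val.toRingHom with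
    commutes' := fun c => p.value_kmap ⊤ p.mem_top c }

/-- A point as a point of the variety to which it belongs. -/
def Point.toVPoint {X : KScheme k} {F : Type u} [Field F] [Algebra k F] (p : Point X F) :
    VPoint X p.alpha := ⟨p, fun _ => rfl⟩

theorem VPoint.alpha_eq {X : KScheme k} {F : Type u} [Field F] [Algebra k F]
    {α : constField X →ₐ[k] F} (x : VPoint X α) : x.pt.alpha = α :=
  AlgHom.ext x.const

/-- Restriction of constants to an open set. -/
def constRes (X : KScheme k) (U : X.left.Opens) : constField X →+* Γ(X.left, U) :=
  (res X (le_top : U ≤ ⊤)).comp (constField X).val.toRingHom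

theorem Point.value_constRes {X : KScheme k} {F : Type u} [Field F] [Algebra k F]
    (p : Point X F) (U : X.left.Opens) (h : p.Mem U) (c : constField X) :
    p.value U h (constRes X U c) = p.alpha c :=
  p.value_res le_top h p.mem_top _

theorem constRes_algebraMap (X : KScheme k) (U : X.left.Opens) (c : k) :
    constRes X U (algebraMap k _ c) = kmap X U c := res_kmap le_top c

/-- The point of `X_α(F)` with given coordinates in an affine open set. -/
def VPoint.ofHom {X : KScheme k} {F : Type u} [Field F] [Algebra k F]
    {α : constField X →ₐ[k] F} {U : X.left.Opens} (hU : IsAffineOpen U) (φ : Γ(X.left, U) →+* F)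
    (h : ∀ c, φ (constRes X U c) = α c) : VPoint X α where
  pt := Point.ofHom hU φ (RingHom.ext fun c => by
    rw [RingHom.comp_apply, ← constRes_algebraMap, h, AlgHom.commutes])
  const c := by
    refine (Point.value_constRes _ U (Point.mem_ofHom hU φ _) c).symm.trans ?_
    rw [Point.value_ofHom, h]

/-- By the Nullstellensatz the residue field `L` at a maximal ideal of an affine chart is finite
over `k`, hence algebraic over `k^X`, so `α` extends from `k^X` to `L`. -/
theorem nonempty_vpoint (X : QProj k) {F : Type u} [Field F] [IsAlgClosed F] [Algebra k F]
    (α : constField X.obj →ₐ[k] F) : Nonempty (VPoint X.obj α) := by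
  obtain ⟨_, ⟨U, hU, rfl⟩, hxU, -⟩ := X.obj.left.isBasis_affineOpens.exists_subset_of_mem_open
    (Set.mem_univ (Classical.arbitrary X.obj.left)) isOpen_univ
  have : Nonempty U := ⟨⟨_, hxU⟩⟩
  have : Nontrivial Γ(X.obj.left, U) := Scheme.component_nontrivial X.obj.left U
  obtain ⟨m, hm⟩ := Ideal.exists_maximal Γ(X.obj.left, U)
  let L := Γ(X.obj.left, U) ⧸ m
  let _ : Field L := Ideal.Quotient.field m
  let i : constField X.obj →+* L := (Ideal.Quotient.mk m).comp (constRes X.obj U)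
  let _ : Field (constField X.obj) := (isField_constField X).toField
  let _ : Algebra k L := (i.comp (algebraMap k _)).toAlgebra
  let _ : Algebra (constField X.obj) L := i.toAlgebra
  let _ : Algebra (constField X.obj) F := α.toRingHom.toAlgebra
  have hft : Algebra.FiniteType k L := by
    have h1 : ((Ideal.Quotient.mk m).comp (kmap X.obj U)).FiniteType :=
      (RingHom.FiniteType.of_surjective _ Ideal.Quotient.mk_surjective).comp
        (finiteType_kmap X ⟨U, hU⟩)
    have h2 : (Ideal.Quotient.mk m).comp (kmap X.obj U) = algebraMap k L :=
      RingHom.ext fun c => congrArg (Ideal.Quotient.mk m) (constRes_algebraMap X.obj U c).symm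
    rw [h2] at h1
    exact RingHom.finiteType_algebraMap.1 h1
  have hfin : Module.Finite k L := finite_of_finite_type_of_isJacobsonRing k L
  have : IsScalarTower k (constField X.obj) L := IsScalarTower.of_algebraMap_eq fun _ => rfl
  have halg : Algebra.IsAlgebraic (constField X.obj) L :=
    Algebra.IsAlgebraic.tower_top (K := k) (constField X.obj)
  have : IsDomain (constField X.obj) := (isField_constField X).isDomain
  have : Module.IsTorsionFree (constField X.obj) L :=
    (Module.isTorsionFree_iff_algebraMap_injective).2 i.injective
  have : Module.IsTorsionFree (constField X.obj) F :=
    (Module.isTorsionFree_iff_algebraMap_injective).2 α.toRingHom.injective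
  let ψ : L →ₐ[constField X.obj] F := IsAlgClosed.lift
  exact ⟨VPoint.ofHom hU (ψ.toRingHom.comp (Ideal.Quotient.mk m)) fun c => ψ.commutes c⟩

end Constants

/-! ### The equivalence of categories. -/

section Equivalence

theorem exists_lift_point {Y : KScheme k} {V : Y.left.Opens} (hV : IsAffineOpen V)
    {F : Type u} [Field F] [Algebra k F] (q : Point Y F) (h : q.Mem V) :
    ∃ p : Point (Over.mk (V.ι ≫ Y.hom)) F,
      p.map (Over.homMk V.ι : Over.mk (V.ι ≫ Y.hom) ⟶ Y) = q := by
  have hq := q.left_eq hV h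
  have hw : ((Spec.map (CommRingCat.ofHom (q.value V h)) ≫ hV.isoSpec.inv) ≫ V.ι) = q.left := by
    rw [hq, Category.assoc, IsAffineOpen.isoSpec_inv_ι]
  refine ⟨Over.homMk (U := specField k F) (V := Over.mk (V.ι ≫ Y.hom))
    (Spec.map (CommRingCat.ofHom (q.value V h)) ≫ hV.isoSpec.inv) ?_, ?_⟩
  · refine Eq.trans ?_ (Over.w q)
    rw [← hw]
    exact (Category.assoc _ _ _).symm
  · ext1
    exact hw

variable {X Y : KScheme k}

theorem comp_isoSpec_hom {S T : Scheme.{u}} {R : CommRingCat.{u}} {A : CommRingCat.{u}} {V : S.Opens}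
    (hV : IsAffineOpen V) (p : Spec R ⟶ V) (φ : Γ(S, V) ⟶ R) (hp : p ≫ V.ι = Spec.map φ ≫ hV.fromSpec)
    (θ : A ⟶ Γ(S, V)) (g : Spec A ⟶ T) :
    p ≫ hV.isoSpec.hom ≫ Spec.map θ ≫ g = Spec.map (θ ≫ φ) ≫ g := by
  have : p = Spec.map φ ≫ hV.isoSpec.inv := by
    rw [← cancel_mono V.ι, hp, Category.assoc, IsAffineOpen.isoSpec_inv_ι]
  rw [this, Category.assoc, Iso.inv_hom_id_assoc, Spec.map_comp, Category.assoc]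

/-- A map on geometric points which is regular in the sense of the language is locally given by a
morphism of schemes. -/
theorem exists_local_morphism [IsReduced Y.left]
    (Φ : ∀ (F : Type u) [Field F] [IsAlgClosed F] [Algebra k F], Point Y F → Point X F)
    (U : X.left.affineOpens) (V : Y.left.affineOpens)
    (hUV : ∀ (F : Type u) [Field F] [IsAlgClosed F] [Algebra k F] (p : Point Y F),
      p.Mem V → (Φ F p).Mem U)
    (hval : ∀ a : Γ(X.left, U), ∃ b : Γ(Y.left, V),
      ∀ (F : Type u) [Field F] [IsAlgClosed F] [Algebra k F] (p : Point Y F) (hV : p.Mem V)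
        (hU : (Φ F p).Mem U), (Φ F p).value U hU a = p.value V hV b) :
    ∃ g : Over.mk ((V : Y.left.Opens).ι ≫ Y.hom) ⟶ X,
      ∀ (F : Type u) [Field F] [IsAlgClosed F] [Algebra k F]
        (p : Point (Over.mk ((V : Y.left.Opens).ι ≫ Y.hom)) F),
        p.map g = Φ F (p.map (Over.homMk (V : Y.left.Opens).ι)) := by
  -- The chosen sections are determined by their values since `Y` is reduced. Compatibility with the
  -- ring operations and with `k` can therefore be checked at geometric points.
  choose θ hθ using hval
  let Θ : Γ(X.left, U) →+* Γ(Y.left, V) :=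
    { toFun := θ
      map_one' := section_ext_of_values (Y := Y) fun F _ _ _ p hV => by
        rw [← hθ 1 F p hV (hUV F p hV), map_one, map_one]
      map_mul' := fun a b => section_ext_of_values (Y := Y) fun F _ _ _ p hV => by
        rw [map_mul, ← hθ _ F p hV (hUV F p hV), ← hθ _ F p hV (hUV F p hV),
          ← hθ _ F p hV (hUV F p hV), map_mul]
      map_zero' := section_ext_of_values (Y := Y) fun F _ _ _ p hV => by
        rw [← hθ 0 F p hV (hUV F p hV), map_zero, map_zero]
      map_add' := fun a b => section_ext_of_values (Y := Y) fun F _ _ _ p hV => by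
        rw [map_add, ← hθ _ F p hV (hUV F p hV), ← hθ _ F p hV (hUV F p hV),
          ← hθ _ F p hV (hUV F p hV), map_add] }
  have hΘk : Θ.comp (kmap X U) = kmap Y V := RingHom.ext fun c =>
    section_ext_of_values (Y := Y) fun F _ _ _ p hV => by
      rw [Point.value_kmap]
      exact (hθ _ F p hV (hUV F p hV)).symm.trans (Point.value_kmap _ _ _ _)
  have hV : IsAffineOpen (V : Y.left.Opens) := V.2
  have hU : IsAffineOpen (U : X.left.Opens) := U.2
  have hover : (hV.isoSpec.hom ≫ Spec.map (CommRingCat.ofHom Θ) ≫ hU.fromSpec) ≫ X.hom =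
      (V : Y.left.Opens).ι ≫ Y.hom := by
    rw [Category.assoc, Category.assoc, fromSpec_hom, ← Spec.map_comp, ← CommRingCat.ofHom_comp,
      hΘk, ← fromSpec_hom hV, ← Category.assoc, IsAffineOpen.isoSpec_hom_fromSpec]
  refine ⟨Over.homMk (U := Over.mk ((V : Y.left.Opens).ι ≫ Y.hom)) (V := X)
    (hV.isoSpec.hom ≫ Spec.map (CommRingCat.ofHom Θ) ≫ hU.fromSpec) hover, ?_⟩
  intro F _ _ _ p
  let q : Point Y F := p.map (Over.homMk (V : Y.left.Opens).ι)
  have hqV : q.Mem V := by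
    rw [Point.mem_iff]
    have := Set.mem_range_self (f := (V : Y.left.Opens).ι) p.center
    rw [Scheme.Opens.range_ι] at this
    exact this
  have hq := q.left_eq hV hqV
  ext1
  have h1 := (Φ F q).left_eq hU (hUV F q hqV)
  refine Eq.trans ?_ h1.symm
  have h2 : (Φ F q).value U (hUV F q hqV) = (q.value V hqV).comp Θ :=
    RingHom.ext fun a => hθ a F q hqV (hUV F q hqV)
  rw [h2]
  exact comp_isoSpec_hom hV p.left _ hq (CommRingCat.ofHom Θ) hU.fromSpec

/-- A map on geometric points which is locally given by morphisms of schemes is given by a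
morphism of schemes. -/
theorem exists_morphism [IsReduced Y.left]
    (Φ : ∀ (F : Type u) [Field F] [IsAlgClosed F] [Algebra k F], Point Y F → Point X F)
    (hloc : ∀ y : Y.left, ∃ V : Y.left.affineOpens, y ∈ (V : Y.left.Opens) ∧
      ∃ g : Over.mk ((V : Y.left.Opens).ι ≫ Y.hom) ⟶ X,
        ∀ (F : Type u) [Field F] [IsAlgClosed F] [Algebra k F]
          (p : Point (Over.mk ((V : Y.left.Opens).ι ≫ Y.hom)) F),
          p.map g = Φ F (p.map (Over.homMk (V : Y.left.Opens).ι))) :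
    ∃ f : Y ⟶ X, ∀ (F : Type u) [Field F] [IsAlgClosed F] [Algebra k F] (p : Point Y F),
      p.map f = Φ F p := by
  choose V hyV g hg using hloc
  let 𝒰 : Y.left.OpenCover := Y.left.openCoverOfIsOpenCover (fun y => (V y : Y.left.Opens)) (by
    rw [TopologicalSpace.IsOpenCover, eq_top_iff]
    intro y _
    exact TopologicalSpace.Opens.mem_iSup.2 ⟨y, hyV y⟩)
  -- On an overlap, which is again reduced, both local morphisms act on geometric points by `Φ`, so
  -- `hom_ext_of_points` identifies them.
  have hagree : ∀ x y : Y.left, Limits.pullback.fst (V x : Y.left.Opens).ι (V y : Y.left.Opens).ι ≫ (g x).left =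
      Limits.pullback.snd (V x : Y.left.Opens).ι (V y : Y.left.Opens).ι ≫ (g y).left := by
    intro x y
    let π₁ := Limits.pullback.fst (V x : Y.left.Opens).ι (V y : Y.left.Opens).ι
    let π₂ := Limits.pullback.snd (V x : Y.left.Opens).ι (V y : Y.left.Opens).ι
    let Z : KScheme k := Over.mk (π₁ ≫ (V x : Y.left.Opens).ι ≫ Y.hom)
    have : IsReduced Z.left := isReduced_of_isOpenImmersion (π₁ ≫ (V x : Y.left.Opens).ι)
    let j₁ : Z ⟶ Over.mk ((V x : Y.left.Opens).ι ≫ Y.hom) := Over.homMk π₁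
    let j₂ : Z ⟶ Over.mk ((V y : Y.left.Opens).ι ≫ Y.hom) := Over.homMk π₂ (by
      change π₂ ≫ (V y : Y.left.Opens).ι ≫ Y.hom = π₁ ≫ (V x : Y.left.Opens).ι ≫ Y.hom
      rw [← Category.assoc, ← Category.assoc, Limits.pullback.condition])
    have h := hom_ext_of_points (j₁ ≫ g x) (j₂ ≫ g y) (by
      intro F _ _ _ p
      have h1 : p.map (j₁ ≫ g x) = (p.map j₁).map (g x) := (Category.assoc _ _ _).symm
      have h2 : p.map (j₂ ≫ g y) = (p.map j₂).map (g y) := (Category.assoc _ _ _).symm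
      rw [h1, h2, hg, hg]
      congr 1
      change (p ≫ j₁) ≫ _ = (p ≫ j₂) ≫ _
      rw [Category.assoc, Category.assoc]
      congr 1
      ext1
      exact Limits.pullback.condition)
    exact congrArg CommaMorphism.left h
  let f₀ : Y.left ⟶ X.left := 𝒰.glueMorphisms (fun y => (g y).left) hagree
  have hf₀ : ∀ y, (V y : Y.left.Opens).ι ≫ f₀ = (g y).left := fun y =>
    𝒰.ι_glueMorphisms (fun y => (g y).left) hagree y
  let f : Y ⟶ X := Over.homMk f₀ (by
    apply Scheme.Cover.hom_ext 𝒰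
    intro y
    refine (Category.assoc _ _ _).symm.trans ?_
    refine (congrArg (fun t => t ≫ X.hom) (hf₀ y)).trans ?_
    exact Over.w (g y))
  refine ⟨f, fun F _ _ _ p => ?_⟩
  obtain ⟨q, hq⟩ := exists_lift_point (V p.center).2 p
    ((p.mem_iff _).2 (hyV p.center))
  have h3 : (Over.homMk (V p.center : Y.left.Opens).ι : Over.mk ((V p.center : Y.left.Opens).ι ≫ Y.hom) ⟶ Y) ≫ f =
      g p.center := by
    ext1
    exact hf₀ p.center
  rw [← hq, ← hg, ← h3]
  exact Category.assoc _ _ _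

/-- A point determines the `β` to which it belongs, and `β` determines `α`; so comparing underlying
points avoids transport between the dependent types. -/
theorem VarTheory.Hom.pt_congr {S T : VarTheory k} {φ ψ : VarTheory.Hom S T} (e : φ = ψ)
    {F : Type u} [Field F] [IsAlgClosed F] [Algebra k F] {α α' : constField S.X →ₐ[k] F}
    {β β' : constField T.X →ₐ[k] F} (h : β.comp φ.const = α) (h' : β'.comp ψ.const = α')
    (y : VPoint T.X β) (y' : VPoint T.X β') (hy : y.pt = y'.pt) :
    (φ.map F α β h y).pt = (ψ.map F α' β' h' y').pt := by
  subst e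
  have hβ : β = β' := by rw [← y.alpha_eq, ← y'.alpha_eq, hy]
  subst hβ
  have hα : α = α' := by rw [← h, ← h']
  subst hα
  rw [VPoint.ext' hy]

theorem theoryFunctor_faithful : (theoryFunctor k).Faithful where
  map_injective {X Y f g} h := by
    apply Quiver.Hom.unop_inj
    apply ObjectProperty.hom_ext
    apply hom_ext_of_points
    intro F _ _ _ p
    exact VarTheory.Hom.pt_congr h rfl rfl p.toVPoint p.toVPoint rfl

/-- Each geometric point `p` of `Y` lies in exactly one variety over its field, the one for
`p.alpha`. A morphism of theories is thus a single map `Φ` on all geometric points, and its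
regularity is the local condition needed for gluing. -/
theorem theoryFunctor_full : (theoryFunctor k).Full where
  map_surjective {X Y} φ := by
    let Φ : ∀ (F : Type u) [Field F] [IsAlgClosed F] [Algebra k F],
        Point Y.unop.obj F → Point X.unop.obj F := fun F _ _ _ p =>
      (VarTheory.Hom.map φ F _ p.alpha rfl p.toVPoint).pt
    have hreg := VarTheory.Hom.regular φ
    obtain ⟨f, hf⟩ := exists_morphism (X := X.unop.obj) (Y := Y.unop.obj) Φ (by
      intro y
      obtain ⟨F, _, _, _, p, rfl⟩ := exists_point_center_eq y
      obtain ⟨U, -, hU⟩ := Point.exists_affine (Φ F p) ⊤ (Point.mem_top _)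
      obtain ⟨𝒱, h𝒱, hval⟩ := hreg U
      obtain ⟨V, hV, hpV⟩ := (h𝒱 F _ p.alpha rfl p.toVPoint).1 hU
      refine ⟨V, (p.mem_iff _).1 hpV, ?_⟩
      apply exists_local_morphism Φ U V
      · intro F _ _ _ p hp
        exact (h𝒱 F _ p.alpha rfl p.toVPoint).2 ⟨V, hV, hp⟩
      · intro a
        obtain ⟨b, hb⟩ := hval V hV a
        exact ⟨b, fun F _ _ _ p => hb F _ p.alpha rfl p.toVPoint⟩)
    refine ⟨Quiver.Hom.op (ObjectProperty.homMk f), ?_⟩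
    -- The action on constants is forced: at every geometric point `p`, the value of `c` at the
    -- image of `p` is prescribed by the variety which contains that image.
    have hconst : constMap f = VarTheory.Hom.const φ := by
      ext c
      apply section_ext_of_values (Y := Y.unop.obj) (V := ⊤)
      intro F _ _ _ p hp
      have h1 := (VarTheory.Hom.map φ F _ p.alpha rfl p.toVPoint).const c
      have h2 := p.globValue_map f c
      rw [hf] at h2
      exact h2.symm.trans h1
    refine VarTheory.Hom.ext' hconst ?_
    intro F _ _ _ α β h h' y
    refine Eq.trans (hf F y.pt) ?_
    exact VarTheory.Hom.pt_congr rfl _ _ _ _ rfl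

theorem theoryFunctor_essSurj : (theoryFunctor k).EssSurj where
  mem_essImage T := ⟨op T.scheme, ⟨Iso.refl _⟩⟩

theorem theoryFunctor_isEquivalence : (theoryFunctor k).IsEquivalence where
  faithful := theoryFunctor_faithful
  full := theoryFunctor_full
  essSurj := theoryFunctor_essSurj

end Equivalence

/-! ### Equations of charts, and the atlas of the variety. -/

section Coordinates

theorem Point.value_eval₂ {X : KScheme k} {F : Type u} [Field F] [Algebra k F] (p : Point X F)
    {U : X.left.Opens} (h : p.Mem U) {ι : Type*} (g : ι → Γ(X.left, U)) (P : MvPolynomial ι k) :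
    p.value U h (MvPolynomial.eval₂Hom (kmap X U) g P) =
      MvPolynomial.aeval (fun l => p.value U h (g l)) P := by
  have : (p.value U h).comp (MvPolynomial.eval₂Hom (kmap X U) g) =
      (MvPolynomial.aeval (R := k) (fun l => p.value U h (g l))).toRingHom := by
    refine MvPolynomial.ringHom_ext (fun c => ?_) fun i => ?_
    · rw [RingHom.comp_apply, MvPolynomial.eval₂Hom_C, Point.value_kmap]
      exact ((MvPolynomial.aeval (R := k) fun l => p.value U h (g l)).commutes c).symm
    · rw [RingHom.comp_apply, MvPolynomial.eval₂Hom_X']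
      exact (MvPolynomial.aeval_X (R := k) (fun l => p.value U h (g l)) i).symm
  exact congrArg (fun t => t P) this

theorem comp_kmap_eq {X : KScheme k} {F : Type u} [Field F] [Algebra k F]
    {α : constField X →ₐ[k] F} {U : X.left.Opens} (φ : Γ(X.left, U) →+* F)
    (h : ∀ c, φ (constRes X U c) = α c) : φ.comp (kmap X U) = algebraMap k F :=
  RingHom.ext fun c => by rw [RingHom.comp_apply, ← constRes_algebraMap, h, AlgHom.commutes]

theorem VPoint.mem_ofHom {X : KScheme k} {F : Type u} [Field F] [Algebra k F]
    {α : constField X →ₐ[k] F} {U : X.left.Opens} (hU : IsAffineOpen U) (φ : Γ(X.left, U) →+* F)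
    (h : ∀ c, φ (constRes X U c) = α c) : (VPoint.ofHom hU φ h).pt.Mem U :=
  Point.mem_ofHom hU φ (comp_kmap_eq φ h)

theorem VPoint.value_ofHom {X : KScheme k} {F : Type u} [Field F] [Algebra k F]
    {α : constField X →ₐ[k] F} {U : X.left.Opens} (hU : IsAffineOpen U) (φ : Γ(X.left, U) →+* F)
    (h : ∀ c, φ (constRes X U c) = α c) :
    (VPoint.ofHom hU φ h).pt.value U (VPoint.mem_ofHom hU φ h) = φ :=
  Point.value_ofHom hU φ (comp_kmap_eq φ h)

/-- Evaluation at `t` kills the relations `h0`, so it factors through the sections on `U` and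
defines a point; `hc` places this point in the variety of `α`. -/
theorem exists_vpoint_of_coords {X : KScheme k} {F : Type u} [Field F] [Algebra k F]
    {α : constField X →ₐ[k] F} {U : X.left.Opens} (hU : IsAffineOpen U) {ι : Type*}
    (g : ι → Γ(X.left, U)) (hg : Function.Surjective (MvPolynomial.eval₂Hom (kmap X U) g))
    (t : ι → F) (h0 : ∀ P, MvPolynomial.eval₂Hom (kmap X U) g P = 0 → MvPolynomial.aeval t P = 0)
    (hc : ∀ c, ∃ P, MvPolynomial.eval₂Hom (kmap X U) g P = constRes X U c ∧
      MvPolynomial.aeval t P = α c) :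
    ∃ (x : VPoint X α) (h : x.pt.Mem U), ∀ l, x.pt.value U h (g l) = t l := by
  let φ : Γ(X.left, U) →+* F := RingHom.liftOfSurjective _ hg
    ⟨(MvPolynomial.aeval (R := k) t).toRingHom, fun P hP => h0 P hP⟩
  have hφ : ∀ P, φ (MvPolynomial.eval₂Hom (kmap X U) g P) = MvPolynomial.aeval t P := fun P =>
    RingHom.liftOfRightInverse_comp_apply _ _ _ _ P
  let x : VPoint X α := VPoint.ofHom hU φ fun c => by
    obtain ⟨P, hP, hPt⟩ := hc c
    rw [← hP, hφ, hPt]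
  refine ⟨x, VPoint.mem_ofHom hU φ _, fun l => ?_⟩
  rw [VPoint.value_ofHom]
  have h2 := hφ (MvPolynomial.X l)
  rwa [MvPolynomial.eval₂Hom_X', MvPolynomial.aeval_X] at h2

/-- The field of constants embeds in the nonzero finitely generated `k`-algebra of functions on a
chart, and a field with this property is finite over `k`. Consequently finitely many conditions
control all constants. -/
theorem finite_constField (X : QProj k) : Module.Finite k (constField X.obj) := by
  obtain ⟨_, ⟨U, hU, rfl⟩, hxU, -⟩ := X.obj.left.isBasis_affineOpens.exists_subset_of_mem_open
    (Set.mem_univ (Classical.arbitrary X.obj.left)) isOpen_univ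
  have : Nonempty U := ⟨⟨_, hxU⟩⟩
  have : Nontrivial Γ(X.obj.left, U) := Scheme.component_nontrivial X.obj.left U
  let _ : Algebra k Γ(X.obj.left, U) := (kmap X.obj U).toAlgebra
  have : Algebra.FiniteType k Γ(X.obj.left, U) := finiteType_kmap X ⟨U, hU⟩
  let _ : Field (constField X.obj) := (isField_constField X).toField
  let f : constField X.obj →ₐ[k] Γ(X.obj.left, U) :=
    { constRes X.obj U with commutes' := constRes_algebraMap X.obj U }
  exact finite_of_algHom_finiteType_of_isJacobsonRing f

/-- In an affine chart, `X_α(F)` is the zero set of finitely many equations with coefficients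
among the constants, given uniformly in `α` and `F`. -/
theorem exists_finite_equations (X : QProj k) {U : X.obj.left.Opens} (hU : IsAffineOpen U)
    {ι : Type} [Finite ι] (g : ι → Γ(X.obj.left, U))
    (hg : Function.Surjective (MvPolynomial.eval₂Hom (kmap X.obj U) g)) :
    ∃ s : Finset (MvPolynomial ι k × constField X.obj),
      ∀ (F : Type u) [Field F] [Algebra k F] (α : constField X.obj →ₐ[k] F) (t : ι → F),
        (∃ (x : VPoint X.obj α) (h : x.pt.Mem U), ∀ l, x.pt.value U h (g l) = t l) ↔
          ∀ q ∈ s, MvPolynomial.aeval t q.1 = α q.2 := by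
  classical
  have := finite_constField X
  obtain ⟨s₀, hs₀⟩ : (RingHom.ker (MvPolynomial.eval₂Hom (kmap X.obj U) g)).FG :=
    IsNoetherian.noetherian _
  obtain ⟨b, hb⟩ : (⊤ : Submodule k (constField X.obj)).FG := Module.Finite.fg_top
  choose P hP using fun c => hg (constRes X.obj U c)
  -- Two kinds of equations: generators of the ideal of relations, with right-hand side `0`, and for
  -- each `c` in a finite spanning set of `k^X` a polynomial representing `c`, with right-hand side
  -- `α c`.
  refine ⟨s₀.image (fun p => (p, 0)) ∪ b.image (fun c => (P c, c)), ?_⟩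
  intro F _ _ α t
  constructor
  · rintro ⟨x, h, ht⟩ q hq
    obtain rfl : (fun l => x.pt.value U h (g l)) = t := funext ht
    rw [← Point.value_eval₂]
    rcases Finset.mem_union.1 hq with hq | hq
    · obtain ⟨p, hp, rfl⟩ := Finset.mem_image.1 hq
      have : p ∈ RingHom.ker (MvPolynomial.eval₂Hom (kmap X.obj U) g) :=
        hs₀ ▸ Ideal.subset_span hp
      rw [(RingHom.mem_ker).1 this, map_zero, map_zero]
    · obtain ⟨c, hc, rfl⟩ := Finset.mem_image.1 hq
      rw [hP, Point.value_constRes, VPoint.alpha_eq]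
  · intro h
    have h0 : ∀ Q, MvPolynomial.eval₂Hom (kmap X.obj U) g Q = 0 → MvPolynomial.aeval t Q = 0 := by
      intro Q hQ
      have hle : RingHom.ker (MvPolynomial.eval₂Hom (kmap X.obj U) g) ≤
          RingHom.ker (MvPolynomial.aeval (R := k) t).toRingHom := by
        rw [← hs₀]
        refine Ideal.span_le.2 fun p hp => ?_
        have := h (p, 0) (Finset.mem_union_left _ (Finset.mem_image_of_mem _ hp))
        rw [map_zero] at this
        exact this
      exact hle hQ
    refine exists_vpoint_of_coords hU g hg t h0 fun c => ?_
    -- The constants with the required polynomial form a `k`-subspace, so the spanning set suffices.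
    have hc : c ∈ Submodule.span k (b : Set (constField X.obj)) := hb ▸ Submodule.mem_top
    induction hc using Submodule.span_induction with
    | mem c hc =>
      exact ⟨P c, hP c, h (P c, c) (Finset.mem_union_right _ (Finset.mem_image.2 ⟨c, hc, rfl⟩))⟩
    | zero => exact ⟨0, by simp, by simp⟩
    | add c d _ _ hc hd =>
      obtain ⟨Q, hQ, hQ'⟩ := hc
      obtain ⟨R, hR, hR'⟩ := hd
      exact ⟨Q + R, by rw [map_add, hQ, hR, map_add], by rw [map_add, hQ', hR', map_add]⟩
    | smul a c _ hc =>
      obtain ⟨Q, hQ, hQ'⟩ := hc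
      refine ⟨MvPolynomial.C a * Q, ?_, ?_⟩
      · rw [map_mul, hQ, MvPolynomial.eval₂Hom_C, Algebra.smul_def, map_mul, constRes_algebraMap]
      · rw [map_mul, hQ', MvPolynomial.aeval_C, Algebra.smul_def, map_mul, AlgHom.commutes]

theorem isZeroLocus_coords (X : QProj k) {U : X.obj.left.Opens} (hU : IsAffineOpen U)
    {ι : Type} [Finite ι] (g : ι → Γ(X.obj.left, U))
    (hg : Function.Surjective (MvPolynomial.eval₂Hom (kmap X.obj U) g))
    {F : Type u} [Field F] [Algebra k F] (α : constField X.obj →ₐ[k] F) :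
    IsZeroLocus α.range
      {t | ∃ (x : VPoint X.obj α) (h : x.pt.Mem U), ∀ l, x.pt.value U h (g l) = t l} := by
  obtain ⟨s, hs⟩ := exists_finite_equations X hU g hg
  refine ⟨(fun q : MvPolynomial ι k × constField X.obj => MvPolynomial.map (algebraMap k α.range) q.1 -
    MvPolynomial.C ⟨α q.2, q.2, rfl⟩) '' s, Set.ext fun t => ?_⟩
  refine (hs F α t).trans ?_
  simp only [Set.mem_ofPred_eq, Set.forall_mem_image, Finset.mem_coe, map_sub,
    MvPolynomial.aeval_map_algebraMap, MvPolynomial.aeval_C, sub_eq_zero]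
  rfl

/-- On a basic open set of an affine chart, regular functions are fractions. -/
theorem exists_fraction_value {X : KScheme k} (U : X.left.affineOpens) (g : Γ(X.left, U))
    (a : Γ(X.left, X.left.basicOpen g)) : ∃ (n : ℕ) (r : Γ(X.left, U)),
      ∀ (F : Type u) [Field F] [Algebra k F] (p : Point X F) (h : p.Mem U)
        (hg : p.Mem (X.left.basicOpen g)),
        p.value _ hg a * p.value U h g ^ n = p.value U h r := by
  obtain ⟨n, r, hr⟩ := exists_fraction U g a
  refine ⟨n, r, fun F _ _ p h hg => ?_⟩
  rw [← p.value_res (X.left.basicOpen_le g) hg h g, ← p.value_res (X.left.basicOpen_le g) hg h r,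
    ← hr, map_mul, map_pow]

/-- Near a point, `f` maps a basic open set of the source chart into the target chart, and there the
pulled-back coordinates are fractions with powers of one function `g` as denominators. All
polynomials come from `k`, so any `K` serves. -/
theorem isRegularOver_map {X Y : KScheme k} (f : Y ⟶ X) {F : Type u} [Field F] [Algebra k F]
    {α : constField X →ₐ[k] F} {β : constField Y →ₐ[k] F} (h : β.comp (constMap f) = α)
    (K : Subalgebra k F) : IsRegularOver K (atlas Y β) (atlas X α) (VPoint.map f h) := by
  intro (c : CoordSystem Y) (d : CoordSystem X) y hyc hyd
  change y.pt.Mem c.U at hyc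
  change (y.pt.map f).Mem d.U at hyd
  obtain ⟨g, hgU, hyg⟩ := c.U.2.exists_basicOpen_le
    (⟨y.pt.center, (y.pt.mem_iff _).1 hyd⟩ : f.left ⁻¹ᵁ (d.U : X.left.Opens)) ((y.pt.mem_iff _).1 hyc)
  choose n r hr using fun l => exists_fraction_value c.U g (f.left.appLE d.U _ hgU (d.gen l))
  obtain ⟨G, hG⟩ := c.generates g
  choose R hR using fun l => c.generates (r l)
  have hle : ∀ l, n l ≤ ∑ i, n i := fun l => Finset.single_le_sum (fun _ _ => Nat.zero_le _)
    (Finset.mem_univ l)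
  have hval : ∀ (y' : VPoint Y β) (hy' : y'.pt.Mem c.U) (P : MvPolynomial (Fin c.n) k),
      MvPolynomial.aeval ((atlas Y β).coord c y') (MvPolynomial.map (algebraMap k K) P) =
        y'.pt.value c.U hy' (MvPolynomial.eval₂Hom (kmap Y c.U) c.gen P) := by
    intro y' hy' P
    rw [Point.value_eval₂]
    refine (MvPolynomial.aeval_map_algebraMap K _ P).trans ?_
    exact congrArg (fun t : Fin c.n → F => MvPolynomial.aeval t P) (funext fun l => dif_pos hy')
  -- The sum of the exponents dominates each `n l` and gives a common denominator. The extra `1`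
  -- makes the denominator vanish wherever `g` does, even if all `n l` are `0`, so its nonvanishing
  -- places the point in the basic open set.
  refine ⟨MvPolynomial.map (algebraMap k K) (G ^ (∑ i, n i + 1)),
    fun l => MvPolynomial.map (algebraMap k K) (R l * G ^ (∑ i, n i + 1 - n l)), ?_, ?_⟩
  · have := (y.pt.mem_basicOpen hyc g).1 ((y.pt.mem_iff _).2 hyg)
    refine (hval y hyc _).trans_ne ?_
    rw [map_pow, hG, map_pow]
    exact pow_ne_zero _ this
  · intro y' hy' hne
    change y'.pt.Mem c.U at hy'
    have hne' := (hval y' hy' _).symm.trans_ne hne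
    rw [map_pow, hG, map_pow] at hne'
    have hgy : y'.pt.value c.U hy' g ≠ 0 := fun h0 => hne' (by rw [h0, zero_pow (Nat.succ_ne_zero _)])
    have hmem := (y'.pt.mem_basicOpen hy' g).2 hgy
    have hmemU : (y'.pt.map f).Mem d.U := hmem.mono hgU
    refine ⟨hmemU, fun (l : Fin d.n) => ?_⟩
    rw [eq_div_iff hne]
    refine Eq.trans (congrArg₂ (· * ·) (dif_pos hmemU) (hval y' hy' _)) (Eq.trans ?_ (hval y' hy' _).symm)
    have h1 := Point.value_map f y'.pt d.U _ hgU hmem hmemU (d.gen l)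
    have h2 := hr l F y'.pt hy' hmem
    rw [← h1] at h2
    change (y'.pt.map f).value d.U hmemU (d.gen l) * _ = _
    simp only [map_pow, map_mul, hG, hR]
    rw [← h2, mul_assoc, ← pow_add]
    congr 2
    have := hle l
    omega

theorem VPoint.map_id {X : KScheme k} {F : Type u} [Field F] [Algebra k F]
    {α : constField X →ₐ[k] F} (h : α.comp (constMap (𝟙 X)) = α) : VPoint.map (𝟙 X) h = id :=
  funext fun _ => VPoint.ext' (Category.comp_id _)

/-- The joint coordinates of two charts form a coordinate system on the affine intersection, so the
graph of a change of coordinates is the zero set attached to this system. -/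
theorem sum_generates (X : QProj k) (c d : CoordSystem X.obj) :
    Function.Surjective (MvPolynomial.eval₂Hom
      (kmap X.obj ((c.U : X.obj.left.Opens) ⊓ d.U))
      (Sum.elim (fun l => res X.obj inf_le_left (c.gen l)) (fun l => res X.obj inf_le_right (d.gen l)))) := by
  have key := inf_generated X c.U.2 d.U.2 (MvPolynomial.eval₂Hom
      (kmap X.obj ((c.U : X.obj.left.Opens) ⊓ d.U))
      (Sum.elim (fun l => res X.obj inf_le_left (c.gen l))
        (fun l => res X.obj inf_le_right (d.gen l)))).range ?_ ?_
  · exact RingHom.range_eq_top.1 key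
  · intro a
    obtain ⟨P, rfl⟩ := c.generates a
    refine ⟨MvPolynomial.rename Sum.inl P, ?_⟩
    rw [← RingHom.comp_apply]
    change (MvPolynomial.eval₂Hom _ _) (MvPolynomial.rename Sum.inl P) = _
    rw [MvPolynomial.eval₂Hom_rename]
    refine congrArg (fun t : MvPolynomial _ k →+* _ => t P)
      (MvPolynomial.ringHom_ext (fun e => ?_) fun i => ?_)
    · rw [RingHom.comp_apply, MvPolynomial.eval₂Hom_C, MvPolynomial.eval₂Hom_C, res_kmap]
    · rw [RingHom.comp_apply, MvPolynomial.eval₂Hom_X', MvPolynomial.eval₂Hom_X']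
      rfl
  · intro a
    obtain ⟨P, rfl⟩ := d.generates a
    refine ⟨MvPolynomial.rename Sum.inr P, ?_⟩
    rw [← RingHom.comp_apply]
    change (MvPolynomial.eval₂Hom _ _) (MvPolynomial.rename Sum.inr P) = _
    rw [MvPolynomial.eval₂Hom_rename]
    refine congrArg (fun t : MvPolynomial _ k →+* _ => t P)
      (MvPolynomial.ringHom_ext (fun e => ?_) fun i => ?_)
    · rw [RingHom.comp_apply, MvPolynomial.eval₂Hom_C, MvPolynomial.eval₂Hom_C, res_kmap]
    · rw [RingHom.comp_apply, MvPolynomial.eval₂Hom_X', MvPolynomial.eval₂Hom_X']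
      rfl

theorem VPoint.ext_coords {X : KScheme k} {F : Type u} [Field F] [Algebra k F]
    {α : constField X →ₐ[k] F} (c : CoordSystem X) {x y : VPoint X α} (hx : x.pt.Mem c.U)
    (hy : y.pt.Mem c.U) (h : ∀ l, x.pt.value c.U hx (c.gen l) = y.pt.value c.U hy (c.gen l)) :
    x = y := by
  apply VPoint.ext'
  refine Point.ext_value c.U.2 hx hy (RingHom.ext fun a => ?_)
  obtain ⟨P, rfl⟩ := c.generates a
  rw [Point.value_eval₂, Point.value_eval₂]
  simp only [h]

theorem atlas_coord {X : KScheme k} {F : Type u} [Field F] [Algebra k F]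
    {α : constField X →ₐ[k] F} (c : CoordSystem X) {x : VPoint X α} (hx : x.pt.Mem c.U)
    (l : Fin c.n) : (atlas X α).coord c x l = x.pt.value c.U hx (c.gen l) := dif_pos hx

theorem isVarietyOver_atlas (X : QProj k) {F : Type u} [Field F] [Algebra k F]
    (α : constField X.obj →ₐ[k] F) : IsVarietyOver α.range (atlas X.obj α) where
  cover := by
    classical
    obtain ⟨s, -, hs⟩ := exists_finite_affine_cover X ⊤
    choose c hc using exists_coordSystem X
    refine ⟨s.image c, fun x => ?_⟩
    obtain ⟨U, hU, hxU⟩ := hs x.pt.center trivial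
    refine ⟨c U, Finset.mem_image_of_mem c hU, ?_⟩
    change x.pt.Mem (c U).U
    rw [hc]
    exact (x.pt.mem_iff _).2 hxU
  injOn c := by
    intro x hx y hy hxy
    refine VPoint.ext_coords c hx hy fun l => ?_
    have := congrFun hxy l
    exact (atlas_coord c hx l).symm.trans (this.trans (atlas_coord c hy l))
  closed c := by
    refine (congrArg (IsZeroLocus α.range) (Set.ext fun t => ?_)).mpr
      (isZeroLocus_coords X c.U.2 c.gen c.generates α)
    constructor
    · rintro ⟨x, hx, rfl⟩
      exact ⟨x, hx, fun l => (atlas_coord c hx l).symm⟩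
    · rintro ⟨x, hx, h⟩
      exact ⟨x, hx, funext fun l => (atlas_coord c hx l).trans (h l)⟩
  transition := by
    have h : α.comp (constMap (𝟙 X.obj)) = α := by rw [constMap_id]; rfl
    have := isRegularOver_map (𝟙 X.obj) h α.range
    rwa [VPoint.map_id] at this
  separated c d := by
    refine (congrArg (IsZeroLocus α.range) (Set.ext fun t => ?_)).mpr
      (isZeroLocus_coords X (isAffineOpen_inf X c.U.2 d.U.2) _ (sum_generates X c d) α)
    constructor
    · rintro ⟨x, ⟨hx, hx'⟩, rfl⟩
      have hm : x.pt.Mem ((c.U : X.obj.left.Opens) ⊓ d.U) :=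
        (x.pt.mem_iff _).2 ⟨(x.pt.mem_iff _).1 hx, (x.pt.mem_iff _).1 hx'⟩
      refine ⟨x, hm, ?_⟩
      rintro (l | l)
      · exact (x.pt.value_res _ hm hx _).trans (atlas_coord c hx l).symm
      · exact (x.pt.value_res _ hm hx' _).trans (atlas_coord d hx' l).symm
    · rintro ⟨x, hm, h⟩
      have hx : x.pt.Mem c.U := hm.mono inf_le_left
      have hx' : x.pt.Mem d.U := hm.mono inf_le_right
      refine ⟨x, ⟨hx, hx'⟩, funext ?_⟩
      rintro (l | l)
      · exact ((atlas_coord c hx l).trans (x.pt.value_res _ hm hx _).symm).trans (h (Sum.inl l))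
      · exact ((atlas_coord d hx' l).trans (x.pt.value_res _ hm hx' _).symm).trans (h (Sum.inr l))

theorem constMap_injective {X Y : QProj k} (f : Y.obj ⟶ X.obj) :
    Function.Injective (constMap f) := by
  let _ : Field (constField X.obj) := (isField_constField X).toField
  have : Nontrivial (constField Y.obj) := (isField_constField Y).nontrivial
  exact (constMap f).toRingHom.injective

theorem range_le_range {X Y : KScheme k} {F : Type u} [Field F] [Algebra k F]
    {e : constField X →ₐ[k] constField Y} {α : constField X →ₐ[k] F} {β : constField Y →ₐ[k] F}
    (h : β.comp e = α) : α.range ≤ β.range := by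
  rintro _ ⟨c, rfl⟩
  exact ⟨e c, congrArg (fun t => t c) h⟩

end Coordinates

end Schemes

open FirstOrder FirstOrder.Language

/-! ### Calculus of predicates defined by one formula in a family of structures. -/

section UniformDefinability

universe w
variable {L : FirstOrder.Language.{u, u}} {J : Type w} {𝔐 : J → Type u} [∀ j, L.Structure (𝔐 j)]
  {ι κ : Type}

/-- A predicate on tuples from the structures of a family is uniformly definable if it is defined
by one formula in all structures of the family. -/
def UDef (L : FirstOrder.Language.{u, u}) {J : Type w} (𝔐 : J → Type u) [∀ j, L.Structure (𝔐 j)]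
    {ι : Type} (P : ∀ j, (ι → 𝔐 j) → Prop) : Prop :=
  ∃ φ : L.Formula ι, ∀ j v, φ.Realize v ↔ P j v

namespace UDef

variable {P Q : ∀ j, (ι → 𝔐 j) → Prop}

theorem congr (hP : UDef L 𝔐 P) (h : ∀ j v, Q j v ↔ P j v) : UDef L 𝔐 Q := by
  obtain ⟨φ, hφ⟩ := hP
  exact ⟨φ, fun j v => (hφ j v).trans (h j v).symm⟩

theorem const (p : Prop) : UDef L 𝔐 (fun _ (_ : ι → _) => p) := by
  by_cases hp : p
  · exact ⟨⊤, fun j v => by simp [hp]⟩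
  · exact ⟨⊥, fun j v => by simp [hp]⟩

theorem and (hP : UDef L 𝔐 P) (hQ : UDef L 𝔐 Q) : UDef L 𝔐 (fun j v => P j v ∧ Q j v) := by
  obtain ⟨φ, hφ⟩ := hP
  obtain ⟨ψ, hψ⟩ := hQ
  exact ⟨φ ⊓ ψ, fun j v => by rw [Formula.realize_inf, hφ, hψ]⟩

theorem or (hP : UDef L 𝔐 P) (hQ : UDef L 𝔐 Q) : UDef L 𝔐 (fun j v => P j v ∨ Q j v) := by
  obtain ⟨φ, hφ⟩ := hP
  obtain ⟨ψ, hψ⟩ := hQ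
  exact ⟨φ ⊔ ψ, fun j v => by rw [Formula.realize_sup, hφ, hψ]⟩

theorem imp (hP : UDef L 𝔐 P) (hQ : UDef L 𝔐 Q) : UDef L 𝔐 (fun j v => P j v → Q j v) := by
  obtain ⟨φ, hφ⟩ := hP
  obtain ⟨ψ, hψ⟩ := hQ
  exact ⟨φ.imp ψ, fun j v => by rw [Formula.realize_imp, hφ, hψ]⟩

theorem not (hP : UDef L 𝔐 P) : UDef L 𝔐 (fun j v => ¬ P j v) := by
  obtain ⟨φ, hφ⟩ := hP
  exact ⟨φ.not, fun j v => by rw [Formula.realize_not, hφ]⟩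

theorem comp (hP : UDef L 𝔐 P) (g : ι → κ) :
    UDef L 𝔐 (fun j (v : κ → 𝔐 j) => P j (fun i => v (g i))) := by
  obtain ⟨φ, hφ⟩ := hP
  exact ⟨φ.relabel g, fun j _ => Formula.realize_relabel.trans (hφ j _)⟩

theorem exTuple [Finite κ] {Q : ∀ j, (ι → 𝔐 j) → (κ → 𝔐 j) → Prop}
    (hQ : UDef L 𝔐 (fun j (w : ι ⊕ κ → 𝔐 j) =>
      Q j (fun i => w (Sum.inl i)) (fun i => w (Sum.inr i)))) :
    UDef L 𝔐 (fun j v => ∃ t, Q j v t) := by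
  obtain ⟨φ, hφ⟩ := hQ
  refine ⟨φ.iExs κ, fun j v => ?_⟩
  rw [Formula.realize_iExs]
  exact exists_congr fun t => hφ j _

theorem allTuple [Finite κ] {Q : ∀ j, (ι → 𝔐 j) → (κ → 𝔐 j) → Prop}
    (hQ : UDef L 𝔐 (fun j (w : ι ⊕ κ → 𝔐 j) =>
      Q j (fun i => w (Sum.inl i)) (fun i => w (Sum.inr i)))) :
    UDef L 𝔐 (fun j v => ∀ t, Q j v t) :=
  (exTuple (Q := fun j v t => ¬ Q j v t) hQ.not).not.congr fun j v => by push Not; rfl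

theorem ex {Q : ∀ j, (ι → 𝔐 j) → 𝔐 j → Prop}
    (hQ : UDef L 𝔐 (fun j (w : ι ⊕ Unit → 𝔐 j) =>
      Q j (fun i => w (Sum.inl i)) (w (Sum.inr ())))) :
    UDef L 𝔐 (fun j v => ∃ x, Q j v x) :=
  (exTuple (κ := Unit) (Q := fun j v t => Q j v (t ())) hQ).congr fun _ _ =>
    ⟨fun ⟨x, hx⟩ => ⟨fun _ => x, hx⟩, fun ⟨t, ht⟩ => ⟨t (), ht⟩⟩

theorem finAll {τ : Type*} [Finite τ] {P : τ → ∀ j, (ι → 𝔐 j) → Prop} (h : ∀ a, UDef L 𝔐 (P a)) :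
    UDef L 𝔐 (fun j v => ∀ a, P a j v) := by
  choose φ hφ using h
  refine ⟨Formula.iInf φ, fun j v => ?_⟩
  rw [Formula.realize_iInf]
  exact forall_congr' fun a => hφ a j v

theorem finEx {τ : Type*} [Finite τ] {P : τ → ∀ j, (ι → 𝔐 j) → Prop} (h : ∀ a, UDef L 𝔐 (P a)) :
    UDef L 𝔐 (fun j v => ∃ a, P a j v) := by
  choose φ hφ using h
  refine ⟨Formula.iSup φ, fun j v => ?_⟩
  rw [Formula.realize_iSup]
  exact exists_congr fun a => hφ a j v

theorem finsetEx {τ : Type*} (s : Finset τ) {P : τ → ∀ j, (ι → 𝔐 j) → Prop}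
    (h : ∀ a ∈ s, UDef L 𝔐 (P a)) : UDef L 𝔐 (fun j v => ∃ a ∈ s, P a j v) :=
  (finEx (τ := s) (P := fun a => P a) fun a => h a a.2).congr fun _ _ =>
    ⟨fun ⟨a, ha, h⟩ => ⟨⟨a, ha⟩, h⟩, fun ⟨a, h⟩ => ⟨a, a.2, h⟩⟩

theorem eq (a b : ι) : UDef L 𝔐 (fun _ v => v a = v b) :=
  ⟨Term.equal (var a) (var b), fun j v => by simp⟩

theorem rel {n : ℕ} (R : L.Relations n) (g : Fin n → ι) :
    UDef L 𝔐 (fun _ v => Structure.RelMap R (fun a => v (g a))) :=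
  ⟨R.formula (fun a => var (g a)), fun j v => by rw [Formula.realize_rel]; rfl⟩

theorem rel1 (R : L.Relations 1) (a : ι) : UDef L 𝔐 (fun _ v => Structure.RelMap R ![v a]) :=
  (rel R ![a]).congr fun j v => iff_of_eq (congrArg _ (by ext i; fin_cases i; rfl))

theorem rel2 (R : L.Relations 2) (a b : ι) :
    UDef L 𝔐 (fun _ v => Structure.RelMap R ![v a, v b]) :=
  (rel R ![a, b]).congr fun j v => iff_of_eq (congrArg _ (by ext i; fin_cases i <;> rfl))

theorem rel3 (R : L.Relations 3) (a b c : ι) :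
    UDef L 𝔐 (fun _ v => Structure.RelMap R ![v a, v b, v c]) :=
  (rel R ![a, b, c]).congr fun j v => iff_of_eq (congrArg _ (by ext i; fin_cases i <;> rfl))

end UDef

/-- Restricting a family of structures. -/
theorem UDef.restrict {J' : Type*} (r : J' → J) {P : ∀ j, (ι → 𝔐 j) → Prop} (h : UDef L 𝔐 P) :
    UDef L (fun j => 𝔐 (r j)) (fun j v => P (r j) v) := by
  obtain ⟨φ, hφ⟩ := h
  exact ⟨φ, fun j => hφ (r j)⟩

/-- A family of fields over `k` definable in a family of structures. -/
structure DefField (k : Type u) [Field k] (L : FirstOrder.Language.{u, u}) {J : Type w}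
    (𝔐 : J → Type u) [∀ j, L.Structure (𝔐 j)] (F : J → Type u) [∀ j, Field (F j)]
    [∀ j, Algebra k (F j)] where
  /-- the inclusion of the field in the structure -/
  emb : ∀ j, F j → 𝔐 j
  inj : ∀ j, Function.Injective (emb j)
  range : UDef L 𝔐 (fun j (v : Unit → 𝔐 j) => ∃ t, v () = emb j t)
  add : UDef L 𝔐 (fun j (v : Fin 3 → 𝔐 j) =>
    ∃ s t, v 0 = emb j s ∧ v 1 = emb j t ∧ v 2 = emb j (s + t))
  mul : UDef L 𝔐 (fun j (v : Fin 3 → 𝔐 j) =>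
    ∃ s t, v 0 = emb j s ∧ v 1 = emb j t ∧ v 2 = emb j (s * t))
  const : ∀ c : k, UDef L 𝔐 (fun j (v : Unit → 𝔐 j) => v () = emb j (algebraMap k (F j) c))

variable {k : Type u} [Field k] {F : J → Type u} [∀ j, Field (F j)] [∀ j, Algebra k (F j)]
  (D : DefField k L 𝔐 F) {σ τ : Type}

/-- Uniform definability of a predicate on tuples from a definable family of fields. -/
def FDef (D : DefField k L 𝔐 F) {σ : Type} (S : ∀ j, (σ → F j) → Prop) : Prop :=
  UDef L 𝔐 (fun j v => ∃ t : σ → F j, (∀ i, v i = D.emb j (t i)) ∧ S j t)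

variable {D}

namespace FDef

variable {S T : ∀ j, (σ → F j) → Prop}

theorem congr (hS : FDef D S) (h : ∀ j t, T j t ↔ S j t) : FDef D T :=
  UDef.congr hS fun j _ => exists_congr fun t => and_congr_right fun _ => h j t

/-- Only the guard that all entries are scalars has to be added. With `emb_iff` this carries the
logical operations over from structures to fields. -/
theorem ofUDef [Finite σ] {P : ∀ j, (σ → 𝔐 j) → Prop} (h : UDef L 𝔐 P) :
    FDef D (fun j t => P j (fun i => D.emb j (t i))) := by
  have h1 : UDef L 𝔐 (fun j (v : σ → 𝔐 j) => ∀ i, ∃ t, v i = D.emb j t) :=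
    UDef.finAll fun i => D.range.comp (fun _ => i)
  refine (h1.and h).congr fun j v => ?_
  constructor
  · rintro ⟨t, ht, hP⟩
    obtain rfl : v = fun i => D.emb j (t i) := funext ht
    exact ⟨fun i => ⟨t i, rfl⟩, hP⟩
  · rintro ⟨ht, hP⟩
    choose t ht using ht
    obtain rfl : v = fun i => D.emb j (t i) := funext ht
    exact ⟨t, fun _ => rfl, hP⟩

theorem emb_iff (j : J) (t : σ → F j) :
    (∃ t' : σ → F j, (∀ i, D.emb j (t i) = D.emb j (t' i)) ∧ S j t') ↔ S j t := by
  constructor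
  · rintro ⟨t', h, hS⟩
    rwa [funext fun i => D.inj j (h i)]
  · exact fun h => ⟨t, fun _ => rfl, h⟩

theorem comp [Finite τ] (hS : FDef D S) (g : σ → τ) :
    FDef D (fun j (t : τ → F j) => S j (fun i => t (g i))) :=
  (ofUDef (UDef.comp hS g)).congr fun j _ => (emb_iff (S := S) j _).symm

theorem and [Finite σ] (hS : FDef D S) (hT : FDef D T) : FDef D (fun j t => S j t ∧ T j t) :=
  (ofUDef (UDef.and hS hT)).congr fun j t =>
    (and_congr (emb_iff (S := S) j t) (emb_iff (S := T) j t)).symm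

theorem or [Finite σ] (hS : FDef D S) (hT : FDef D T) : FDef D (fun j t => S j t ∨ T j t) :=
  (ofUDef (UDef.or hS hT)).congr fun j t =>
    (or_congr (emb_iff (S := S) j t) (emb_iff (S := T) j t)).symm

theorem not [Finite σ] (hS : FDef D S) : FDef D (fun j t => ¬ S j t) :=
  (ofUDef (UDef.not hS)).congr fun j t => (not_congr (emb_iff (S := S) j t)).symm

theorem const [Finite σ] (p : Prop) : FDef D (fun _ (_ : σ → _) => p) :=
  (ofUDef (UDef.const p)).congr fun _ _ => Iff.rfl

theorem exTuple [Finite σ] [Finite τ] {Q : ∀ j, (σ → F j) → (τ → F j) → Prop}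
    (hQ : FDef D (fun j (w : σ ⊕ τ → F j) =>
      Q j (fun i => w (Sum.inl i)) (fun i => w (Sum.inr i)))) :
    FDef D (fun j t => ∃ s, Q j t s) := by
  refine (ofUDef (P := fun j v => ∃ s : τ → 𝔐 j, ∃ t : σ ⊕ τ → F j,
    (∀ i, Sum.elim v s i = D.emb j (t i)) ∧
      Q j (fun i => t (Sum.inl i)) (fun i => t (Sum.inr i))) ?_).congr fun j t => ?_
  · refine UDef.exTuple (UDef.congr hQ fun j v => ?_)
    have : Sum.elim (fun i => v (Sum.inl i)) (fun i => v (Sum.inr i)) = v :=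
      Sum.elim_comp_inl_inr v
    rw [this]
  · constructor
    · rintro ⟨s, hs⟩
      exact ⟨fun i => D.emb j (s i), Sum.elim t s, by rintro (i | i) <;> rfl, hs⟩
    · rintro ⟨s, t', ht', hs⟩
      have : t = fun i => t' (Sum.inl i) := funext fun i => D.inj j (ht' (Sum.inl i))
      exact ⟨_, this ▸ hs⟩

theorem finAll [Finite σ] {τ : Type*} [Finite τ] {S : τ → ∀ j, (σ → F j) → Prop}
    (h : ∀ a, FDef D (S a)) : FDef D (fun j t => ∀ a, S a j t) :=
  (ofUDef (UDef.finAll h)).congr fun j t =>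
    forall_congr' fun a => (emb_iff (S := S a) j t).symm

theorem finEx [Finite σ] {τ : Type*} [Finite τ] {S : τ → ∀ j, (σ → F j) → Prop}
    (h : ∀ a, FDef D (S a)) : FDef D (fun j t => ∃ a, S a j t) :=
  (ofUDef (UDef.finEx h)).congr fun j t =>
    exists_congr fun a => (emb_iff (S := S a) j t).symm

theorem finsetAll [Finite σ] {τ : Type*} (s : Finset τ) {S : τ → ∀ j, (σ → F j) → Prop}
    (h : ∀ a ∈ s, FDef D (S a)) : FDef D (fun j t => ∀ a ∈ s, S a j t) :=
  (finAll (τ := s) (S := fun a => S a) fun a => h a a.2).congr fun _ _ =>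
    ⟨fun h a => h a a.2, fun h a ha => h ⟨a, ha⟩⟩

theorem eq [Finite σ] (a b : σ) : FDef D (fun _ t => t a = t b) :=
  (ofUDef (UDef.eq a b)).congr fun j _ => (D.inj j).eq_iff.symm

theorem eqConst [Finite σ] (a : σ) {c : ∀ j, F j}
    (hc : UDef L 𝔐 (fun j (v : Unit → 𝔐 j) => v () = D.emb j (c j))) :
    FDef D (fun j t => t a = c j) :=
  (ofUDef (hc.comp (fun _ => a))).congr fun j _ => (D.inj j).eq_iff.symm

theorem add [Finite σ] (a b c : σ) : FDef D (fun _ t => t c = t a + t b) :=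
  (ofUDef (D.add.comp ![a, b, c])).congr fun j t => by
    constructor
    · intro h
      exact ⟨t a, t b, rfl, rfl, congrArg (D.emb j) h⟩
    · rintro ⟨x, y, hx, hy, hxy⟩
      obtain rfl := D.inj j hx
      obtain rfl := D.inj j hy
      exact D.inj j hxy

theorem mul [Finite σ] (a b c : σ) : FDef D (fun _ t => t c = t a * t b) :=
  (ofUDef (D.mul.comp ![a, b, c])).congr fun j t => by
    constructor
    · intro h
      exact ⟨t a, t b, rfl, rfl, congrArg (D.emb j) h⟩
    · rintro ⟨x, y, hx, hy, hxy⟩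
      obtain rfl := D.inj j hx
      obtain rfl := D.inj j hy
      exact D.inj j hxy

/-- Addition and multiplication are given by their graphs only, so a polynomial is evaluated by
quantifying over intermediate results. -/
theorem polyGraph [Finite σ] (p : MvPolynomial σ k) :
    FDef D (fun j (t : σ ⊕ Unit → F j) =>
      t (Sum.inr ()) = MvPolynomial.aeval (fun i => t (Sum.inl i)) p) := by
  induction p using MvPolynomial.induction_on with
  | C c => 
    refine (eqConst (D := D) (Sum.inr ()) (D.const c)).congr fun j t => ?_
    rw [← MvPolynomial.algebraMap_eq, AlgHom.commutes]
  | add p q hp hq =>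
    have h := exTuple (σ := σ ⊕ Unit) (τ := Fin 2) (D := D)
      (Q := fun j t s => s 0 = MvPolynomial.aeval (fun i => t (Sum.inl i)) p ∧
        s 1 = MvPolynomial.aeval (fun i => t (Sum.inl i)) q ∧ t (Sum.inr ()) = s 0 + s 1)
      ((hp.comp (Sum.elim (fun i => Sum.inl (Sum.inl i)) (fun _ => Sum.inr 0))).and
        ((hq.comp (Sum.elim (fun i => Sum.inl (Sum.inl i)) (fun _ => Sum.inr 1))).and
          (add (Sum.inr 0) (Sum.inr 1) (Sum.inl (Sum.inr ())))))
    refine h.congr fun j t => ?_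
    rw [map_add]
    constructor
    · intro h
      exact ⟨![_, _], rfl, rfl, h⟩
    · rintro ⟨s, h0, h1, h2⟩
      rw [h2, h0, h1]
  | mul_X p i hp =>
    have h := exTuple (σ := σ ⊕ Unit) (τ := Unit) (D := D)
      (Q := fun j t s => s () = MvPolynomial.aeval (fun i => t (Sum.inl i)) p ∧
        t (Sum.inr ()) = s () * t (Sum.inl i))
      ((hp.comp (Sum.elim (fun i => Sum.inl (Sum.inl i)) (fun _ => Sum.inr ()))).and
          (mul (Sum.inr ()) (Sum.inl (Sum.inl i)) (Sum.inl (Sum.inr ()))))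
    refine h.congr fun j t => ?_
    rw [map_mul, MvPolynomial.aeval_X]
    constructor
    · intro h
      exact ⟨fun _ => _, rfl, h⟩
    · rintro ⟨s, h0, h1⟩
      rw [h1, h0]

theorem polyEqConst [Finite σ] (p : MvPolynomial σ k) {c : ∀ j, F j}
    (hc : UDef L 𝔐 (fun j (v : Unit → 𝔐 j) => v () = D.emb j (c j))) :
    FDef D (fun j t => MvPolynomial.aeval t p = c j) := by
  have h := exTuple (σ := σ) (τ := Unit) (D := D)
    (Q := fun j t s => s () = MvPolynomial.aeval t p ∧ s () = c j)
    ((polyGraph p).and (eqConst (Sum.inr ()) hc))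
  refine h.congr fun j t => ⟨fun h => ⟨fun _ => _, rfl, h⟩, ?_⟩
  rintro ⟨s, h0, h1⟩
  rw [← h0, h1]

theorem polyEqZero [Finite σ] (p : MvPolynomial σ k) :
    FDef D (fun _ t => MvPolynomial.aeval t p = 0) :=
  (polyEqConst p (D.const 0)).congr fun j t => by rw [map_zero]

end FDef

end UniformDefinability

/-! ### Transfer from standard structures to models; the field sort of a model. -/

section Models

variable {k : Type u} [Field k]

section Relations

variable (X : KScheme k) {M : Type u} [(lang X).Structure M]

/-- `x` belongs to the variety sort. -/
def IsPoint (x : M) : Prop := Structure.RelMap (L := lang X) VarRel.sortX ![x]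

/-- `x` belongs to the field sort. -/
def IsScalar (x : M) : Prop := Structure.RelMap (L := lang X) VarRel.sortF ![x]

/-- `z` is the sum of `x` and `y`. -/
def IsSum (x y z : M) : Prop := Structure.RelMap (L := lang X) VarRel.add ![x, y, z]

/-- `z` is the product of `x` and `y`. -/
def IsProd (x y z : M) : Prop := Structure.RelMap (L := lang X) VarRel.mul ![x, y, z]

/-- `x` is the element of the field sort named by `c`. -/
def IsConst (c : k) (x : M) : Prop := Structure.RelMap (L := lang X) (VarRel.const c) ![x]

/-- `x` is a point of `U`. -/
def IsMem {X : KScheme k} (U : X.left.affineOpens) {M : Type u} [(lang X).Structure M] (x : M) :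
    Prop := Structure.RelMap (L := lang X) (VarRel.mem U) ![x]

/-- `y` is the value of `a` at the point `x`. -/
def IsValue {X : KScheme k} (U : X.left.affineOpens) (a : Γ(X.left, U)) {M : Type u}
    [(lang X).Structure M] (x y : M) : Prop :=
  Structure.RelMap (L := lang X) (VarRel.fn U a) ![x, y]

universe w
variable {J : Type w} {𝔐 : J → Type u} [∀ j, (lang X).Structure (𝔐 j)] {ι : Type}

theorem UDef.isPoint (a : ι) : UDef (lang X) 𝔐 (fun _ v => IsPoint X (v a)) :=
  UDef.rel1 (L := lang X) VarRel.sortX a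

theorem UDef.isScalar (a : ι) : UDef (lang X) 𝔐 (fun _ v => IsScalar X (v a)) :=
  UDef.rel1 (L := lang X) VarRel.sortF a

theorem UDef.isSum (a b c : ι) : UDef (lang X) 𝔐 (fun _ v => IsSum X (v a) (v b) (v c)) :=
  UDef.rel3 (L := lang X) VarRel.add a b c

theorem UDef.isProd (a b c : ι) : UDef (lang X) 𝔐 (fun _ v => IsProd X (v a) (v b) (v c)) :=
  UDef.rel3 (L := lang X) VarRel.mul a b c

theorem UDef.isConst (c : k) (a : ι) : UDef (lang X) 𝔐 (fun _ v => IsConst X c (v a)) :=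
  UDef.rel1 (L := lang X) (VarRel.const c) a

variable {X}

theorem UDef.isMem (U : X.left.affineOpens) (a : ι) :
    UDef (lang X) 𝔐 (fun _ v => IsMem U (v a)) :=
  UDef.rel1 (L := lang X) (VarRel.mem U) a

theorem UDef.isValue (U : X.left.affineOpens) (s : Γ(X.left, U)) (a b : ι) :
    UDef (lang X) 𝔐 (fun _ v => IsValue U s (v a) (v b)) :=
  UDef.rel2 (L := lang X) (VarRel.fn U s) a b

end Relations

/-- The universal closure of `φ` is one of the sentences of the theory. -/
theorem realize_of_standard {X : KScheme k} {n : ℕ} (φ : (lang X).Formula (Fin n))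
    (h : ∀ (F : Type u) [Field F] [IsAlgClosed F] [Algebra k F] (α : constField X →ₐ[k] F)
      (v : Fin n → Model X α), φ.Realize v)
    (M : Type u) [(lang X).Structure M] [Theory.Model M (theory X)] (v : Fin n → M) :
    φ.Realize v := by
  let ψ : (lang X).Sentence := Formula.iAlls (Fin n) (φ.relabel Sum.inr : (lang X).Formula (Empty ⊕ Fin n))
  have hψ : ∀ (M : Type u) [(lang X).Structure M], M ⊨ ψ ↔ ∀ v : Fin n → M, φ.Realize v := by
    intro M _
    refine Formula.realize_iAlls.trans (forall_congr' fun v => ?_)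
    rw [Formula.realize_relabel]
    rfl
  have hmem : ψ ∈ theory X := fun F _ _ _ α => (hψ _).2 (h F α)
  exact (hψ M).1 (Theory.realize_sentence_of_mem (theory X) hmem) v

/-- The family of all structures for the language of `X`. -/
abbrev Struc (X : KScheme k) := Bundled.{u, u} (lang X).Structure

instance {X : KScheme k} (M : Struc X) : (lang X).Structure M.α := M.str

/-- A uniformly definable property which holds in the standard structures holds in all models. -/
theorem transfer (X : KScheme k) {n : ℕ}
    (P : ∀ (M : Type u) [(lang X).Structure M], (Fin n → M) → Prop)
    (hP : UDef (lang X) (fun M : Struc X => M.α) (fun M => P M.α))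
    (h : ∀ (F : Type u) [Field F] [IsAlgClosed F] [Algebra k F] (α : constField X →ₐ[k] F)
      (v : Fin n → Model X α), P (Model X α) v)
    {M : Type u} [(lang X).Structure M] [Theory.Model M (theory X)] (v : Fin n → M) :
    P M v := by
  obtain ⟨φ, hφ⟩ := hP
  exact (hφ (Bundled.of M) v).1
    (realize_of_standard φ (fun F _ _ _ α v => (hφ (Bundled.of (Model X α)) v).2 (h F α v)) M v)

section Standard

variable {X : KScheme k} {F : Type u} [Field F] [Algebra k F] {α : constField X →ₐ[k] F}

/-- The inclusion of the field sort. -/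
def Model.emb (t : F) : Model X α := Sum.inr t

/-- The inclusion of the variety sort. -/
def Model.ofPoint (x : VPoint X α) : Model X α := Sum.inl x

theorem Model.emb_inj {s t : F} : (Model.emb s : Model X α) = Model.emb t ↔ s = t :=
  Sum.inr_injective.eq_iff

theorem Model.ofPoint_inj {x y : VPoint X α} : Model.ofPoint x = Model.ofPoint y ↔ x = y :=
  Sum.inl_injective.eq_iff

theorem Model.ofPoint_ne_emb {x : VPoint X α} {t : F} : Model.ofPoint x ≠ Model.emb t :=
  Sum.inl_ne_inr

theorem Model.isPoint {x : Model X α} : IsPoint X x ↔ ∃ p, x = Model.ofPoint p := Iff.rfl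

theorem Model.isScalar {x : Model X α} : IsScalar X x ↔ ∃ t, x = Model.emb t := Iff.rfl

theorem Model.isSum {x y z : Model X α} : IsSum X x y z ↔
    ∃ s t, x = Model.emb s ∧ y = Model.emb t ∧ z = Model.emb (s + t) := Iff.rfl

theorem Model.isProd {x y z : Model X α} : IsProd X x y z ↔
    ∃ s t, x = Model.emb s ∧ y = Model.emb t ∧ z = Model.emb (s * t) := Iff.rfl

theorem Model.isConst {c : k} {x : Model X α} : IsConst X c x ↔
    x = Model.emb (algebraMap k F c) := Iff.rfl

theorem Model.isMem {U : X.left.affineOpens} {x : Model X α} : IsMem U x ↔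
    ∃ p, x = Model.ofPoint p ∧ p.pt.Mem U := Iff.rfl

theorem Model.isValue {U : X.left.affineOpens} {a : Γ(X.left, U)} {x y : Model X α} :
    IsValue U a x y ↔ ∃ p, ∃ h : p.pt.Mem U,
      x = Model.ofPoint p ∧ y = Model.emb (p.pt.value U h a) := Iff.rfl

end Standard

section Field

variable {X : KScheme k} {M : Type u} [(lang X).Structure M] [Theory.Model M (theory X)]

theorem IsConst.isScalar {c : k} {a : M} : IsConst X c a → IsScalar X a :=
  transfer X (fun M _ v => IsConst X c (v 0) → IsScalar X (v 0))
    ((UDef.isConst X c 0).imp (UDef.isScalar X 0))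
    (fun F _ _ _ α v => by
      simp only [Model.isConst, Model.isScalar]
      grind) ![a]

theorem IsConst.unique {c : k} {a b : M} : IsConst X c a → IsConst X c b → a = b :=
  transfer X (fun M _ v => IsConst X c (v 0) → IsConst X c (v 1) → v 0 = v 1)
    ((UDef.isConst X c 0).imp ((UDef.isConst X c 1).imp (UDef.eq 0 1)))
    (fun F _ _ _ α v => by
      simp only [Model.isConst]
      grind) ![a, b]

theorem IsConst.zero_ne_one {a : M} : IsConst X (0 : k) a → ¬ IsConst X (1 : k) a :=
  transfer X (fun M _ v => IsConst X (0 : k) (v 0) → ¬ IsConst X (1 : k) (v 0))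
    ((UDef.isConst X (0 : k) 0).imp (UDef.isConst X (1 : k) 0).not)
    (fun F _ _ _ α v => by
      simp only [Model.isConst, map_zero, map_one]
      rintro h h'
      exact _root_.zero_ne_one (Model.emb_inj.1 (h.symm.trans h'))) ![a]

theorem IsConst.isSum {c d : k} {a b e : M} :
    IsConst X c a → IsConst X d b → IsConst X (c + d) e → IsSum X a b e :=
  transfer X (fun M _ v => IsConst X c (v 0) → IsConst X d (v 1) → IsConst X (c + d) (v 2) →
      IsSum X (v 0) (v 1) (v 2))
    ((UDef.isConst X c 0).imp ((UDef.isConst X d 1).imp ((UDef.isConst X (c + d) 2).imp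
      (UDef.isSum X 0 1 2))))
    (fun F _ _ _ α v => by
      simp only [Model.isConst, Model.isSum, map_add]
      grind) ![a, b, e]

theorem IsConst.isProd {c d : k} {a b e : M} :
    IsConst X c a → IsConst X d b → IsConst X (c * d) e → IsProd X a b e :=
  transfer X (fun M _ v => IsConst X c (v 0) → IsConst X d (v 1) → IsConst X (c * d) (v 2) →
      IsProd X (v 0) (v 1) (v 2))
    ((UDef.isConst X c 0).imp ((UDef.isConst X d 1).imp ((UDef.isConst X (c * d) 2).imp
      (UDef.isProd X 0 1 2))))
    (fun F _ _ _ α v => by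
      simp only [Model.isConst, Model.isProd, map_mul]
      grind) ![a, b, e]

variable (X M) in
theorem exists_isConst (c : k) : ∃ a : M, IsConst X c a :=
  transfer X (n := 0) (fun M _ _ => ∃ a : M, IsConst X c a)
    (UDef.ex (UDef.isConst X c (Sum.inr ()))) (fun _ _ _ _ _ _ => ⟨_, rfl⟩) ![]

theorem IsSum.isScalar {a b c : M} :
    IsSum X a b c → IsScalar X a ∧ IsScalar X b ∧ IsScalar X c :=
  transfer X (fun M _ v => IsSum X (v 0) (v 1) (v 2) →
      IsScalar X (v 0) ∧ IsScalar X (v 1) ∧ IsScalar X (v 2))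
    ((UDef.isSum X 0 1 2).imp ((UDef.isScalar X 0).and ((UDef.isScalar X 1).and
      (UDef.isScalar X 2))))
    (fun F _ _ _ α v => by
      simp only [Model.isScalar, Model.isSum]
      grind) ![a, b, c]

theorem IsSum.unique {a b c d : M} : IsSum X a b c → IsSum X a b d → c = d :=
  transfer X (fun M _ v => IsSum X (v 0) (v 1) (v 2) → IsSum X (v 0) (v 1) (v 3) → v 2 = v 3)
    ((UDef.isSum X 0 1 2).imp ((UDef.isSum X 0 1 3).imp (UDef.eq 2 3)))
    (fun F _ _ _ α v => by
      simp only [Model.isSum]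
      grind [Model.emb_inj]) ![a, b, c, d]

theorem exists_isSum {a b : M} : IsScalar X a → IsScalar X b → ∃ c, IsSum X a b c :=
  transfer X (fun M _ v => IsScalar X (v 0) → IsScalar X (v 1) → ∃ c, IsSum X (v 0) (v 1) c)
    ((UDef.isScalar X 0).imp ((UDef.isScalar X 1).imp
      (UDef.ex (UDef.isSum X (Sum.inl 0) (Sum.inl 1) (Sum.inr ())))))
    (fun F _ _ _ α v => by
      simp only [Model.isScalar, Model.isSum]
      grind) ![a, b]

theorem IsSum.assoc {a b c p q r : M} : IsSum X a b p → IsSum X p c q → IsSum X b c r →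
    IsSum X a r q :=
  transfer X (fun M _ v => IsSum X (v 0) (v 1) (v 3) → IsSum X (v 3) (v 2) (v 4) →
    IsSum X (v 1) (v 2) (v 5) → IsSum X (v 0) (v 5) (v 4))
    ((UDef.isSum X 0 1 3).imp ((UDef.isSum X 3 2 4).imp
    ((UDef.isSum X 1 2 5).imp (UDef.isSum X 0 5 4))))
    (fun F _ _ _ α v => by
      simp only [Model.isSum]
      grind [Model.emb_inj]) ![a, b, c, p, q, r]

theorem isSum_zero {a z : M} : IsConst X (0 : k) z → IsScalar X a → IsSum X z a a :=
  transfer X (fun M _ v => IsConst X (0 : k) (v 1) → IsScalar X (v 0) → IsSum X (v 1) (v 0) (v 0))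
    ((UDef.isConst X 0 1).imp ((UDef.isScalar X 0).imp (UDef.isSum X 1 0 0)))
    (fun F _ _ _ α v => by
      simp only [Model.isConst, Model.isScalar, Model.isSum, map_zero]
      rintro h ⟨t, ht⟩
      exact ⟨0, t, h, ht, by rw [ht, zero_add]⟩) ![a, z]

theorem exists_isSum_zero {a z : M} : IsConst X (0 : k) z → IsScalar X a → ∃ b, IsSum X b a z :=
  transfer X (fun M _ v => IsConst X (0 : k) (v 1) → IsScalar X (v 0) → ∃ b, IsSum X b (v 0) (v 1))
    ((UDef.isConst X 0 1).imp ((UDef.isScalar X 0).imp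
      (UDef.ex (UDef.isSum X (Sum.inr ()) (Sum.inl 0) (Sum.inl 1)))))
    (fun F _ _ _ α v => by
      simp only [Model.isConst, Model.isScalar, Model.isSum, map_zero]
      rintro h ⟨t, ht⟩
      exact ⟨_, -t, t, rfl, ht, by rw [h, neg_add_cancel]⟩) ![a, z]

theorem IsProd.isScalar {a b c : M} :
    IsProd X a b c → IsScalar X a ∧ IsScalar X b ∧ IsScalar X c :=
  transfer X (fun M _ v => IsProd X (v 0) (v 1) (v 2) →
      IsScalar X (v 0) ∧ IsScalar X (v 1) ∧ IsScalar X (v 2))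
    ((UDef.isProd X 0 1 2).imp ((UDef.isScalar X 0).and ((UDef.isScalar X 1).and
      (UDef.isScalar X 2))))
    (fun F _ _ _ α v => by
      simp only [Model.isScalar, Model.isProd]
      grind) ![a, b, c]

theorem IsProd.unique {a b c d : M} : IsProd X a b c → IsProd X a b d → c = d :=
  transfer X (fun M _ v => IsProd X (v 0) (v 1) (v 2) → IsProd X (v 0) (v 1) (v 3) → v 2 = v 3)
    ((UDef.isProd X 0 1 2).imp ((UDef.isProd X 0 1 3).imp (UDef.eq 2 3)))
    (fun F _ _ _ α v => by
      simp only [Model.isProd]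
      grind [Model.emb_inj]) ![a, b, c, d]

theorem exists_isProd {a b : M} : IsScalar X a → IsScalar X b → ∃ c, IsProd X a b c :=
  transfer X (fun M _ v => IsScalar X (v 0) → IsScalar X (v 1) → ∃ c, IsProd X (v 0) (v 1) c)
    ((UDef.isScalar X 0).imp ((UDef.isScalar X 1).imp
      (UDef.ex (UDef.isProd X (Sum.inl 0) (Sum.inl 1) (Sum.inr ())))))
    (fun F _ _ _ α v => by
      simp only [Model.isScalar, Model.isProd]
      grind) ![a, b]

theorem IsProd.assoc {a b c p q r : M} : IsProd X a b p → IsProd X p c q → IsProd X b c r →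
    IsProd X a r q :=
  transfer X (fun M _ v => IsProd X (v 0) (v 1) (v 3) → IsProd X (v 3) (v 2) (v 4) →
    IsProd X (v 1) (v 2) (v 5) → IsProd X (v 0) (v 5) (v 4))
    ((UDef.isProd X 0 1 3).imp ((UDef.isProd X 3 2 4).imp
    ((UDef.isProd X 1 2 5).imp (UDef.isProd X 0 5 4))))
    (fun F _ _ _ α v => by
      simp only [Model.isProd]
      grind [Model.emb_inj]) ![a, b, c, p, q, r]

theorem IsProd.comm {a b c : M} : IsProd X a b c → IsProd X b a c :=
  transfer X (fun M _ v => IsProd X (v 0) (v 1) (v 2) → IsProd X (v 1) (v 0) (v 2))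
    ((UDef.isProd X 0 1 2).imp (UDef.isProd X 1 0 2))
    (fun F _ _ _ α v => by
      simp only [Model.isProd]
      rintro ⟨s, t, h0, h1, h2⟩
      exact ⟨t, s, h1, h0, by rw [h2, mul_comm]⟩) ![a, b, c]

theorem isProd_one {a e : M} : IsConst X (1 : k) e → IsScalar X a → IsProd X e a a :=
  transfer X (fun M _ v => IsConst X (1 : k) (v 1) → IsScalar X (v 0) → IsProd X (v 1) (v 0) (v 0))
    ((UDef.isConst X 1 1).imp ((UDef.isScalar X 0).imp (UDef.isProd X 1 0 0)))
    (fun F _ _ _ α v => by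
      simp only [Model.isConst, Model.isScalar, Model.isProd, map_one]
      rintro h ⟨t, ht⟩
      exact ⟨1, t, h, ht, by rw [ht, one_mul]⟩) ![a, e]

theorem exists_isProd_one {a e : M} : IsConst X (1 : k) e → IsScalar X a →
    IsConst X (0 : k) a ∨ ∃ b, IsProd X a b e :=
  transfer X (fun M _ v => IsConst X (1 : k) (v 1) → IsScalar X (v 0) →
      IsConst X (0 : k) (v 0) ∨ ∃ b, IsProd X (v 0) b (v 1))
    ((UDef.isConst X 1 1).imp ((UDef.isScalar X 0).imp ((UDef.isConst X 0 0).or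
      (UDef.ex (UDef.isProd X (Sum.inl 0) (Sum.inr ()) (Sum.inl 1))))))
    (fun F _ _ _ α v => by
      simp only [Model.isConst, Model.isScalar, Model.isProd, map_one, map_zero]
      rintro h ⟨t, ht⟩
      by_cases h0 : t = 0
      · exact Or.inl (by rw [ht, h0])
      · exact Or.inr ⟨_, t, t⁻¹, ht, rfl, by rw [h, mul_inv_cancel₀ h0]⟩) ![a, e]

theorem IsProd.distrib {a b c p q r s : M} : IsSum X b c p → IsProd X a p q → IsProd X a b r →
    IsProd X a c s → IsSum X r s q :=
  transfer X (fun M _ v => IsSum X (v 1) (v 2) (v 3) → IsProd X (v 0) (v 3) (v 4) →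
      IsProd X (v 0) (v 1) (v 5) → IsProd X (v 0) (v 2) (v 6) → IsSum X (v 5) (v 6) (v 4))
    ((UDef.isSum X 1 2 3).imp ((UDef.isProd X 0 3 4).imp ((UDef.isProd X 0 1 5).imp
      ((UDef.isProd X 0 2 6).imp (UDef.isSum X 5 6 4)))))
    (fun F _ _ _ α v => by
      simp only [Model.isProd, Model.isSum]
      grind [Model.emb_inj]) ![a, b, c, p, q, r, s]

/-- The elements of the field sort. -/
def FieldSort (X : KScheme k) (M : Type u) [(lang X).Structure M] : Type u :=
  {t : M // IsScalar X t}

namespace FieldSort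

theorem exists_add (s t : FieldSort X M) : ∃ r : FieldSort X M, IsSum X s.1 t.1 r.1 := by
  obtain ⟨r, hr⟩ := exists_isSum s.2 t.2
  exact ⟨⟨r, hr.isScalar.2.2⟩, hr⟩

theorem exists_mul (s t : FieldSort X M) : ∃ r : FieldSort X M, IsProd X s.1 t.1 r.1 := by
  obtain ⟨r, hr⟩ := exists_isProd s.2 t.2
  exact ⟨⟨r, hr.isScalar.2.2⟩, hr⟩

variable (X M) in
theorem exists_const (c : k) : ∃ r : FieldSort X M, IsConst X c r.1 := by
  obtain ⟨r, hr⟩ := exists_isConst X M c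
  exact ⟨⟨r, hr.isScalar⟩, hr⟩

/-- The element of the field sort named by a constant. -/
def const (c : k) : FieldSort X M := (exists_const X M c).choose

theorem isConst (c : k) : IsConst X c (const c : FieldSort X M).1 := (exists_const X M c).choose_spec

instance : Add (FieldSort X M) := ⟨fun s t => (exists_add s t).choose⟩

instance : Mul (FieldSort X M) := ⟨fun s t => (exists_mul s t).choose⟩

instance : Zero (FieldSort X M) := ⟨const (0 : k)⟩

instance : One (FieldSort X M) := ⟨const (1 : k)⟩

theorem isSum (s t : FieldSort X M) : IsSum X s.1 t.1 (s + t).1 := (exists_add s t).choose_spec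

theorem isProd (s t : FieldSort X M) : IsProd X s.1 t.1 (s * t).1 := (exists_mul s t).choose_spec

theorem exists_neg (s : FieldSort X M) : ∃ t : FieldSort X M, t + s = 0 := by
  obtain ⟨t, ht⟩ := exists_isSum_zero (isConst (X := X) (M := M) 0) s.2
  exact ⟨⟨t, ht.isScalar.1⟩, Subtype.ext ((isSum _ s).unique ht)⟩

/-- The second clause fixes the inverse of zero as zero, the convention for fields as total
structures. -/
theorem exists_inv (s : FieldSort X M) : ∃ t : FieldSort X M, (s ≠ 0 → s * t = 1) ∧ (s = 0 → t = 0) := by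
  rcases exists_isProd_one (isConst (X := X) (M := M) 1) s.2 with h | ⟨t, ht⟩
  · exact ⟨0, fun h' => (h' (Subtype.ext (h.unique (isConst 0)))).elim, fun _ => rfl⟩
  · by_cases h : s = 0
    · exact ⟨0, fun h' => (h' h).elim, fun _ => rfl⟩
    · exact ⟨⟨t, ht.isScalar.2.1⟩, fun _ => Subtype.ext ((isProd s _).unique ht), fun h' => (h h').elim⟩

instance : Field (FieldSort X M) :=
  let _ : Neg (FieldSort X M) := ⟨fun s => (exists_neg s).choose⟩
  let _ : Inv (FieldSort X M) := ⟨fun s => (exists_inv s).choose⟩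
  Field.ofMinimalAxioms _
    (fun a b c => Subtype.ext
      (((isSum a b).assoc (isSum _ c) (isSum b c)).unique (isSum a _)))
    (fun a => Subtype.ext ((isSum 0 a).unique (isSum_zero (isConst 0) a.2)))
    (fun a => (exists_neg a).choose_spec)
    (fun a b c => Subtype.ext
      (((isProd a b).assoc (isProd _ c) (isProd b c)).unique (isProd a _)))
    (fun a b => Subtype.ext ((isProd a b).unique (isProd b a).comm))
    (fun a => Subtype.ext ((isProd 1 a).unique (isProd_one (isConst 1) a.2)))
    (fun a => (exists_inv a).choose_spec.1)
    ((exists_inv 0).choose_spec.2 rfl)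
    (fun a b c => Subtype.ext
      ((IsProd.distrib (isSum b c) (isProd a _) (isProd a b) (isProd a c)).unique (isSum _ _)))
    ⟨0, 1, fun h => (isConst (0 : k)).zero_ne_one
      (h ▸ isConst (1 : k) : IsConst X (1 : k) (0 : FieldSort X M).1)⟩

end FieldSort

end Field

end Models

/-! ### Models as structures over an actual algebraically closed field. -/

section Frames

variable {k : Type u} [Field k]

/-- A structure for the language of `X` whose field sort is identified with an extension field
of `k`. -/
structure Frame (X : KScheme k) where
  /-- the universe -/
  M : Type u
  [str : (lang X).Structure M]
  /-- the field -/
  F : Type u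
  [field : Field F]
  [algebra : Algebra k F]
  /-- the inclusion of the field sort -/
  emb : F → M
  inj : Function.Injective emb
  isScalar {x : M} : IsScalar X x ↔ ∃ t, x = emb t
  isSum {x y z : M} : IsSum X x y z ↔ ∃ s t, x = emb s ∧ y = emb t ∧ z = emb (s + t)
  isProd {x y z : M} : IsProd X x y z ↔ ∃ s t, x = emb s ∧ y = emb t ∧ z = emb (s * t)
  isConst {c : k} {x : M} : IsConst X c x ↔ x = emb (algebraMap k F c)

namespace Frame

attribute [instance] Frame.str Frame.field Frame.algebra

variable {X : KScheme k}

/-- The standard structure `(X_α(F), F_{/k})`. -/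
def std {F : Type u} [Field F] [Algebra k F] (α : constField X →ₐ[k] F) : Frame X where
  M := Model X α
  F := F
  emb := Model.emb
  inj _ _ := Model.emb_inj.1
  isScalar := Model.isScalar
  isSum := Model.isSum
  isProd := Model.isProd
  isConst := Model.isConst

/-- The field sorts of a family of structures form a definable family of fields. -/
def defField (X : KScheme k) :
    DefField k (lang X) (fun j : Frame X => j.M) (fun j : Frame X => j.F) where
  emb j := j.emb
  inj j := j.inj
  range := (UDef.isScalar X ()).congr fun _ _ => Frame.isScalar _ |>.symm
  add := (UDef.isSum X 0 1 2).congr fun _ _ => (Frame.isSum _).symm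
  mul := (UDef.isProd X 0 1 2).congr fun _ _ => (Frame.isProd _).symm
  const c := (UDef.isConst X c ()).congr fun _ _ => (Frame.isConst _).symm

/-- Definability is uniform over all frames, so the same formula expresses `S` in the standard
frames and in `j`. The formula transferred is guarded by the condition that all variables are
scalars. -/
theorem transfer {n : ℕ} {S : ∀ j : Frame X, (Fin n → j.F) → Prop}
    (hS : FDef (defField X) S)
    (h : ∀ (F : Type u) [Field F] [IsAlgClosed F] [Algebra k F] (α : constField X →ₐ[k] F)
      (t : Fin n → F), S (std α) t) (j : Frame X) [Theory.Model j.M (theory X)]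
    (t : Fin n → j.F) : S j t := by
  have h1 : UDef (lang X) (fun j : Frame X => j.M) (fun j (v : Fin n → j.M) =>
      ∀ i, ∃ t, v i = j.emb t) := UDef.finAll fun i => (defField X).range.comp (fun _ => i)
  obtain ⟨φ, hφ⟩ := h1.imp hS
  have h2 := (hφ j (fun i => j.emb (t i))).1 (realize_of_standard φ (fun F _ _ _ α v =>
    (hφ (std α) v).2 (fun hv => by
      choose t ht using hv
      exact ⟨t, ht, h F α t⟩)) j.M _) (fun i => ⟨t i, rfl⟩)
  exact (FDef.emb_iff (D := defField X) j t).1 h2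

/-- For a fixed degree, the existence of roots of all monic polynomials is a first-order condition
on their coefficients. -/
theorem isAlgClosed (j : Frame X) [Theory.Model j.M (theory X)] : IsAlgClosed j.F := by
  refine IsAlgClosed.of_exists_root _ fun p hp hirr => ?_
  -- The generic monic polynomial of this degree: the left variables are its lower coefficients, the
  -- right one is the unknown.
  let P : MvPolynomial (Fin p.natDegree ⊕ Unit) k :=
    MvPolynomial.X (Sum.inr ()) ^ p.natDegree +
      ∑ i : Fin p.natDegree, MvPolynomial.X (Sum.inl i) * MvPolynomial.X (Sum.inr ()) ^ (i : ℕ)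
  have hP : ∀ (F : Type u) [Field F] [Algebra k F] (t : Fin p.natDegree → F) (s : Unit → F),
      MvPolynomial.aeval (Sum.elim t s) P = s () ^ p.natDegree + ∑ i, t i * s () ^ (i : ℕ) := by
    intro F _ _ t s
    simp [P]
  have key := transfer (n := p.natDegree)
    (S := fun (j : Frame X) t => ∃ s : Unit → j.F, MvPolynomial.aeval (Sum.elim t s) P = 0)
    (FDef.exTuple ((FDef.polyEqZero P).congr fun j w => by
      rw [show Sum.elim (fun i => w (Sum.inl i)) (fun i => w (Sum.inr i)) = w from
        Sum.elim_comp_inl_inr w])) (fun F _ _ _ α t => by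
      let q : Polynomial F := Polynomial.X ^ p.natDegree +
        ∑ i : Fin p.natDegree, Polynomial.C (t i) * Polynomial.X ^ (i : ℕ)
      have hq : q.degree ≠ 0 := by
        have : q.degree = p.natDegree := by
          rw [Polynomial.degree_add_eq_left_of_degree_lt, Polynomial.degree_X_pow]
          rw [Polynomial.degree_X_pow]
          exact Polynomial.degree_sum_fin_lt _
        rw [this]
        exact_mod_cast hirr.natDegree_pos.ne'
      obtain ⟨s, hs⟩ := IsAlgClosed.exists_root q hq
      refine ⟨fun _ => s, ?_⟩
      refine (hP F t _).trans ?_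
      have hs' : s ^ p.natDegree + ∑ i : Fin p.natDegree, t i * s ^ (i : ℕ) = 0 := by
        simpa [q, Polynomial.IsRoot, Polynomial.eval_finsetSum] using hs
      exact hs') j
      (fun i => p.coeff i)
  obtain ⟨s, hs⟩ := key
  refine ⟨s (), ?_⟩
  rw [hP] at hs
  rw [Polynomial.eval_eq_sum_range, Finset.sum_range_succ, add_comm,
    Polynomial.Monic.coeff_natDegree hp, one_mul, ← hs, Finset.sum_range]

/-- The frame of a model of the theory of `X`. -/
def ofModel (X : KScheme k) (M : Type u) [(lang X).Structure M] [Theory.Model M (theory X)] :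
    Frame X :=
  let _ : Algebra k (FieldSort X M) := RingHom.toAlgebra
    { toFun := FieldSort.const
      map_one' := rfl
      map_zero' := rfl
      map_add' := fun c d => Subtype.ext ((((FieldSort.isConst c).isSum (FieldSort.isConst d)
        (FieldSort.isConst (c + d)))).unique (FieldSort.isSum _ _))
      map_mul' := fun c d => Subtype.ext ((((FieldSort.isConst c).isProd (FieldSort.isConst d)
        (FieldSort.isConst (c * d)))).unique (FieldSort.isProd _ _)) }
  { M := M
    F := FieldSort X M
    emb := Subtype.val
    inj := Subtype.val_injective
    isScalar := ⟨fun h => ⟨⟨_, h⟩, rfl⟩, by rintro ⟨t, rfl⟩; exact t.2⟩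
    isSum := ⟨fun h => ⟨⟨_, h.isScalar.1⟩, ⟨_, h.isScalar.2.1⟩, rfl, rfl,
        h.unique (FieldSort.isSum ⟨_, h.isScalar.1⟩ ⟨_, h.isScalar.2.1⟩)⟩, by
      rintro ⟨s, t, rfl, rfl, rfl⟩
      exact FieldSort.isSum s t⟩
    isProd := ⟨fun h => ⟨⟨_, h.isScalar.1⟩, ⟨_, h.isScalar.2.1⟩, rfl, rfl,
        h.unique (FieldSort.isProd ⟨_, h.isScalar.1⟩ ⟨_, h.isScalar.2.1⟩)⟩, by
      rintro ⟨s, t, rfl, rfl, rfl⟩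
      exact FieldSort.isProd s t⟩
    isConst := ⟨fun h => h.unique (FieldSort.isConst _), by
      rintro rfl
      exact FieldSort.isConst _⟩ }

end Frame

end Frames

/-! ### Geometric facts about points, charts and values that hold in all models. -/

section Geometry

variable {k : Type u} [Field k] {X : KScheme k} {M : Type u} [(lang X).Structure M]
  [Theory.Model M (theory X)]

theorem IsMem.isPoint {U : X.left.affineOpens} {x : M} : IsMem U x → IsPoint X x :=
  transfer X (fun M _ v => IsMem U (v 0) → IsPoint X (v 0))
    ((UDef.isMem U 0).imp (UDef.isPoint X 0))
    (fun F _ _ _ α v => by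
      simp only [Model.isMem, Model.isPoint]
      grind) ![x]

theorem not_isPoint_of_isScalar {x : M} : IsScalar X x → ¬ IsPoint X x :=
  transfer X (fun M _ v => IsScalar X (v 0) → ¬ IsPoint X (v 0))
    ((UDef.isScalar X 0).imp (UDef.isPoint X 0).not)
    (fun F _ _ _ α v => by
      simp only [Model.isScalar, Model.isPoint]
      rintro ⟨t, ht⟩ ⟨p, hp⟩
      exact Model.ofPoint_ne_emb (hp.symm.trans ht)) ![x]

theorem isScalar_or_isPoint (x : M) : IsScalar X x ∨ IsPoint X x :=
  transfer X (fun M _ v => IsScalar X (v 0) ∨ IsPoint X (v 0))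
    ((UDef.isScalar X 0).or (UDef.isPoint X 0))
    (fun F _ _ _ α v => by
      simp only [Model.isScalar, Model.isPoint]
      rcases v 0 with p | t
      · exact Or.inr ⟨p, rfl⟩
      · exact Or.inl ⟨t, rfl⟩) ![x]

theorem IsValue.isMem {U : X.left.affineOpens} {a : Γ(X.left, U)} {x t : M} :
    IsValue U a x t → IsMem U x ∧ IsScalar X t :=
  transfer X (fun M _ v => IsValue U a (v 0) (v 1) → IsMem U (v 0) ∧ IsScalar X (v 1))
    ((UDef.isValue U a 0 1).imp ((UDef.isMem U 0).and (UDef.isScalar X 1)))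
    (fun F _ _ _ α v => by
      simp only [Model.isMem, Model.isValue, Model.isScalar]
      rintro ⟨p, h, h0, h1⟩
      exact ⟨⟨p, h0, h⟩, _, h1⟩) ![x, t]

theorem IsMem.exists_isValue {U : X.left.affineOpens} (a : Γ(X.left, U)) {x : M} :
    IsMem U x → ∃ t, IsValue U a x t :=
  transfer X (fun M _ v => IsMem U (v 0) → ∃ t, IsValue U a (v 0) t)
    ((UDef.isMem U 0).imp (UDef.ex (UDef.isValue U a (Sum.inl 0) (Sum.inr ()))))
    (fun F _ _ _ α v => by
      simp only [Model.isMem, Model.isValue]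
      rintro ⟨p, h0, h⟩
      exact ⟨_, p, h, h0, rfl⟩) ![x]

theorem IsValue.unique {U : X.left.affineOpens} {a : Γ(X.left, U)} {x s t : M} :
    IsValue U a x s → IsValue U a x t → s = t :=
  transfer X (fun M _ v => IsValue U a (v 0) (v 1) → IsValue U a (v 0) (v 2) → v 1 = v 2)
    ((UDef.isValue U a 0 1).imp ((UDef.isValue U a 0 2).imp (UDef.eq 1 2)))
    (fun F _ _ _ α v => by
      simp only [Model.isValue]
      rintro ⟨p, h, h0, h1⟩ ⟨p', h', h0', h1'⟩
      obtain rfl := Model.ofPoint_inj.1 (h0.symm.trans h0')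
      rw [h1, h1']) ![x, s, t]

theorem IsValue.add {U : X.left.affineOpens} {a b : Γ(X.left, U)} {x s t r : M} :
    IsValue U a x s → IsValue U b x t → IsValue U (a + b) x r → IsSum X s t r :=
  transfer X (fun M _ v => IsValue U a (v 0) (v 1) → IsValue U b (v 0) (v 2) →
      IsValue U (a + b) (v 0) (v 3) → IsSum X (v 1) (v 2) (v 3))
    ((UDef.isValue U a 0 1).imp ((UDef.isValue U b 0 2).imp ((UDef.isValue U (a + b) 0 3).imp
      (UDef.isSum X 1 2 3))))
    (fun F _ _ _ α v => by
      simp only [Model.isValue, Model.isSum]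
      rintro ⟨p, h, h0, h1⟩ ⟨p', h', h0', h1'⟩ ⟨p'', h'', h0'', h1''⟩
      obtain rfl := Model.ofPoint_inj.1 (h0.symm.trans h0')
      obtain rfl := Model.ofPoint_inj.1 (h0.symm.trans h0'')
      exact ⟨_, _, h1, h1', by rw [h1'', map_add]⟩) ![x, s, t, r]

theorem IsValue.mul {U : X.left.affineOpens} {a b : Γ(X.left, U)} {x s t r : M} :
    IsValue U a x s → IsValue U b x t → IsValue U (a * b) x r → IsProd X s t r :=
  transfer X (fun M _ v => IsValue U a (v 0) (v 1) → IsValue U b (v 0) (v 2) →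
      IsValue U (a * b) (v 0) (v 3) → IsProd X (v 1) (v 2) (v 3))
    ((UDef.isValue U a 0 1).imp ((UDef.isValue U b 0 2).imp ((UDef.isValue U (a * b) 0 3).imp
      (UDef.isProd X 1 2 3))))
    (fun F _ _ _ α v => by
      simp only [Model.isValue, Model.isProd]
      rintro ⟨p, h, h0, h1⟩ ⟨p', h', h0', h1'⟩ ⟨p'', h'', h0'', h1''⟩
      obtain rfl := Model.ofPoint_inj.1 (h0.symm.trans h0')
      obtain rfl := Model.ofPoint_inj.1 (h0.symm.trans h0'')
      exact ⟨_, _, h1, h1', by rw [h1'', map_mul]⟩) ![x, s, t, r]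

theorem IsValue.isConst {U : X.left.affineOpens} {c : k} {x s : M} :
    IsValue U (kmap X U c) x s → IsConst X c s :=
  transfer X (fun M _ v => IsValue U (kmap X U c) (v 0) (v 1) → IsConst X c (v 1))
    ((UDef.isValue U _ 0 1).imp (UDef.isConst X c 1))
    (fun F _ _ _ α v => by
      simp only [Model.isValue, Model.isConst]
      rintro ⟨p, h, h0, h1⟩
      rw [h1, Point.value_kmap]) ![x, s]

theorem IsMem.mono {U V : X.left.affineOpens} (h : (V : X.left.Opens) ≤ U) {x : M} :
    IsMem V x → IsMem U x :=
  transfer X (fun M _ v => IsMem V (v 0) → IsMem U (v 0))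
    ((UDef.isMem V 0).imp (UDef.isMem U 0))
    (fun F _ _ _ α v => by
      simp only [Model.isMem]
      rintro ⟨p, h0, hp⟩
      exact ⟨p, h0, hp.mono h⟩) ![x]

theorem IsMem.isValue_res {U V : X.left.affineOpens} (h : (V : X.left.Opens) ≤ U)
    {a : Γ(X.left, U)} {x t : M} : IsMem V x → IsValue U a x t → IsValue V (res X h a) x t :=
  transfer X (fun M _ v => IsMem V (v 0) → IsValue U a (v 0) (v 1) →
      IsValue V (res X h a) (v 0) (v 1))
    ((UDef.isMem V 0).imp ((UDef.isValue U a 0 1).imp (UDef.isValue V _ 0 1)))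
    (fun F _ _ _ α v => by
      simp only [Model.isMem, Model.isValue]
      rintro ⟨p, h0, hp⟩ ⟨p', h', h0', h1'⟩
      obtain rfl := Model.ofPoint_inj.1 (h0.symm.trans h0')
      exact ⟨p, hp, h0, by rw [h1', p.pt.value_res]⟩) ![x, t]

theorem IsValue.isMem_basicOpen {U V : X.left.affineOpens} {g : Γ(X.left, U)}
    (h : (V : X.left.Opens) = X.left.basicOpen g) {x t : M} :
    IsValue U g x t → IsConst X (0 : k) t ∨ IsMem V x :=
  transfer X (fun M _ v => IsValue U g (v 0) (v 1) → IsConst X (0 : k) (v 1) ∨ IsMem V (v 0))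
    ((UDef.isValue U g 0 1).imp ((UDef.isConst X 0 1).or (UDef.isMem V 0)))
    (fun F _ _ _ α v => by
      simp only [Model.isMem, Model.isValue, Model.isConst, map_zero]
      rintro ⟨p, hp, h0, h1⟩
      by_cases hz : p.pt.value U hp g = 0
      · exact Or.inl (by rw [h1, hz])
      · exact Or.inr ⟨p, h0, by rw [h]; exact (p.pt.mem_basicOpen hp g).2 hz⟩) ![x, t]

theorem IsMem.inf {U V W : X.left.affineOpens} (h : (W : X.left.Opens) = (U : X.left.Opens) ⊓ V) {x : M} :
    IsMem U x → IsMem V x → IsMem W x :=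
  transfer X (fun M _ v => IsMem U (v 0) → IsMem V (v 0) → IsMem W (v 0))
    ((UDef.isMem U 0).imp ((UDef.isMem V 0).imp (UDef.isMem W 0)))
    (fun F _ _ _ α v => by
      simp only [Model.isMem]
      rintro ⟨p, h0, hp⟩ ⟨p', h0', hp'⟩
      obtain rfl := Model.ofPoint_inj.1 (h0.symm.trans h0')
      refine ⟨p, h0, ?_⟩
      rw [Point.mem_iff, h]
      exact ⟨(p.pt.mem_iff _).1 hp, (p.pt.mem_iff _).1 hp'⟩) ![x]

/-- In a standard structure `c` takes the value `α c` everywhere. In a model this lets one embedding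
of `k^X` serve for all elements. -/
theorem IsValue.constRes_unique {U V : X.left.affineOpens} {c : constField X} {x y s t : M} :
    IsValue U (constRes X U c) x s → IsValue V (constRes X V c) y t → s = t :=
  transfer X (fun M _ v => IsValue U (constRes X U c) (v 0) (v 2) →
      IsValue V (constRes X V c) (v 1) (v 3) → v 2 = v 3)
    ((UDef.isValue U _ 0 2).imp ((UDef.isValue V _ 1 3).imp (UDef.eq 2 3)))
    (fun F _ _ _ α v => by
      simp only [Model.isValue]
      rintro ⟨p, h, h0, h1⟩ ⟨p', h', h0', h1'⟩
      rw [h1, h1', Point.value_constRes, Point.value_constRes, p.alpha_eq, p'.alpha_eq])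
    ![x, y, s, t]

theorem IsMem.eq_of_isValue (c : CoordSystem X) {x y : M} : IsMem c.U x → IsMem c.U y →
    (∀ l, ∃ t, IsValue c.U (c.gen l) x t ∧ IsValue c.U (c.gen l) y t) → x = y :=
  transfer X (fun M _ v => IsMem c.U (v 0) → IsMem c.U (v 1) →
      (∀ l, ∃ t, IsValue c.U (c.gen l) (v 0) t ∧ IsValue c.U (c.gen l) (v 1) t) → v 0 = v 1)
    ((UDef.isMem c.U 0).imp ((UDef.isMem c.U 1).imp (UDef.imp (UDef.finAll fun l =>
      UDef.ex (UDef.and (UDef.isValue c.U (c.gen l) (Sum.inl 0) (Sum.inr ()))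
        (UDef.isValue c.U (c.gen l) (Sum.inl 1) (Sum.inr ())))) (UDef.eq 0 1))))
    (fun F _ _ _ α v => by
      simp only [Model.isValue, Model.isMem]
      rintro ⟨p, h0, hp⟩ ⟨q, h1, hq⟩ h
      rw [h0, h1, VPoint.ext_coords c hp hq fun l => ?_]
      obtain ⟨t, ⟨p', hp', h0', h2⟩, q', hq', h1', h3⟩ := h l
      obtain rfl := Model.ofPoint_inj.1 (h0.symm.trans h0')
      obtain rfl := Model.ofPoint_inj.1 (h1.symm.trans h1')
      exact Model.emb_inj.1 (h2.symm.trans h3)) ![x, y]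

variable (X : QProj k) {M : Type u} [(lang X.obj).Structure M] [Theory.Model M (theory X.obj)]

variable (M) in
theorem exists_isPoint : ∃ x : M, IsPoint X.obj x :=
  transfer X.obj (n := 0) (fun M _ _ => ∃ x : M, IsPoint X.obj x)
    (UDef.ex (UDef.isPoint X.obj (Sum.inr ())))
    (fun F _ _ _ α v => by
      obtain ⟨p⟩ := nonempty_vpoint X α
      exact ⟨_, p, rfl⟩) ![]

theorem exists_affine_cover : ∃ s : Finset X.obj.left.affineOpens,
    ∀ x, ∃ U ∈ s, x ∈ (U : X.obj.left.Opens) := by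
  obtain ⟨s, -, hs⟩ := exists_finite_affine_cover X ⊤
  exact ⟨s, fun x => hs x trivial⟩

variable {X}

/-- The finiteness of the cover is what makes this expressible by a first-order formula. -/
theorem IsPoint.exists_isMem {s : Finset X.obj.left.affineOpens}
    (hs : ∀ x, ∃ U ∈ s, x ∈ (U : X.obj.left.Opens)) {x : M} : IsPoint X.obj x → ∃ U ∈ s, IsMem U x :=
  transfer X.obj (fun M _ v => IsPoint X.obj (v 0) → ∃ U ∈ s, IsMem U (v 0))
    ((UDef.isPoint X.obj 0).imp (UDef.finsetEx s fun U _ => UDef.isMem U 0))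
    (fun F _ _ _ α v => by
      simp only [Model.isPoint, Model.isMem]
      rintro ⟨p, hp⟩
      obtain ⟨U, hU, h⟩ := hs p.pt.center
      exact ⟨U, hU, p, hp, (p.pt.mem_iff _).2 h⟩) ![x]

end Geometry

/-! ### Every model is isomorphic to a standard structure. -/

section Recognition

variable {k : Type u} [Field k]

/-- A bijection of structures for the language of `X` which respects all basic relations. -/
def langEquiv {X : KScheme k} {M N : Type u} [(lang X).Structure M] [(lang X).Structure N]
    (e : M → N) (he : Function.Bijective e) (h1 : ∀ x, IsPoint X (e x) ↔ IsPoint X x)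
    (h2 : ∀ x, IsScalar X (e x) ↔ IsScalar X x)
    (h3 : ∀ x y z, IsSum X (e x) (e y) (e z) ↔ IsSum X x y z)
    (h4 : ∀ x y z, IsProd X (e x) (e y) (e z) ↔ IsProd X x y z)
    (h5 : ∀ c x, IsConst X c (e x) ↔ IsConst X c x)
    (h6 : ∀ (U : X.left.affineOpens) x, IsMem U (e x) ↔ IsMem U x)
    (h7 : ∀ (U : X.left.affineOpens) a x y, IsValue U a (e x) (e y) ↔ IsValue U a x y) :
    FirstOrder.Language.Equiv (lang X) M N where
  toEquiv := _root_.Equiv.ofBijective e he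
  map_fun' f := f.elim
  map_rel' {n} R v := by
    have key1 : ∀ w : Fin 1 → M, e ∘ w = ![e (w 0)] ∧ w = ![w 0] := fun w =>
      ⟨by ext i; fin_cases i; rfl, by ext i; fin_cases i; rfl⟩
    have key2 : ∀ w : Fin 2 → M, e ∘ w = ![e (w 0), e (w 1)] ∧ w = ![w 0, w 1] := fun w =>
      ⟨by ext i; fin_cases i <;> rfl, by ext i; fin_cases i <;> rfl⟩
    have key3 : ∀ w : Fin 3 → M, e ∘ w = ![e (w 0), e (w 1), e (w 2)] ∧ w = ![w 0, w 1, w 2] :=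
      fun w => ⟨by ext i; fin_cases i <;> rfl, by ext i; fin_cases i <;> rfl⟩
    change Structure.RelMap R (e ∘ v) ↔ _
    cases R with
    | sortX => rw [(key1 v).1, (key1 v).2]; exact h1 _
    | sortF => rw [(key1 v).1, (key1 v).2]; exact h2 _
    | add => rw [(key3 v).1, (key3 v).2]; exact h3 _ _ _
    | mul => rw [(key3 v).1, (key3 v).2]; exact h4 _ _ _
    | const c => rw [(key1 v).1, (key1 v).2]; exact h5 _ _
    | mem U => rw [(key1 v).1, (key1 v).2]; exact h6 _ _
    | fn U a => rw [(key2 v).1, (key2 v).2]; exact h7 _ _ _ _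

namespace Frame

section

variable {X : KScheme k} (j : Frame X) [Theory.Model j.M (theory X)]

theorem exists_value {U : X.left.affineOpens} {x : j.M} (h : IsMem U x) (a : Γ(X.left, U)) :
    ∃ t : j.F, IsValue U a x (j.emb t) := by
  obtain ⟨t, ht⟩ := h.exists_isValue a
  obtain ⟨t, rfl⟩ := j.isScalar.1 ht.isMem.2
  exact ⟨t, ht⟩

/-- Values of regular functions at an element of a model of the theory of `X`. -/
def value {U : X.left.affineOpens} {x : j.M} (h : IsMem U x) : Γ(X.left, U) →+* j.F where
  toFun a := (j.exists_value h a).choose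
  map_one' := by
    have h1 := (j.exists_value h 1).choose_spec
    rw [← map_one (kmap X U)] at h1
    have := j.inj (j.isConst.1 h1.isConst)
    rw [map_one, map_one] at this
    exact this
  map_zero' := by
    have h1 := (j.exists_value h 0).choose_spec
    rw [← map_zero (kmap X U)] at h1
    have := j.inj (j.isConst.1 h1.isConst)
    rw [map_zero, map_zero] at this
    exact this
  map_add' a b := by
    obtain ⟨s, t, h0, h1, h2⟩ := j.isSum.1 ((j.exists_value h a).choose_spec.add
      (j.exists_value h b).choose_spec (j.exists_value h (a + b)).choose_spec)
    rw [j.inj h0, j.inj h1, j.inj h2]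
  map_mul' a b := by
    obtain ⟨s, t, h0, h1, h2⟩ := j.isProd.1 ((j.exists_value h a).choose_spec.mul
      (j.exists_value h b).choose_spec (j.exists_value h (a * b)).choose_spec)
    rw [j.inj h0, j.inj h1, j.inj h2]

theorem isValue_iff {U : X.left.affineOpens} {x : j.M} (h : IsMem U x) (a : Γ(X.left, U)) {t : j.F} :
    IsValue U a x (j.emb t) ↔ j.value h a = t :=
  ⟨fun ht => j.inj ((j.exists_value h a).choose_spec.unique ht), by
    rintro rfl
    exact (j.exists_value h a).choose_spec⟩

theorem isValue_value {U : X.left.affineOpens} {x : j.M} (h : IsMem U x) (a : Γ(X.left, U)) :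
    IsValue U a x (j.emb (j.value h a)) := (j.isValue_iff h a).2 rfl

theorem value_comp_kmap {U : X.left.affineOpens} {x : j.M} (h : IsMem U x) :
    (j.value h).comp (kmap X U) = algebraMap k j.F :=
  RingHom.ext fun c => j.inj (j.isConst.1 (j.isValue_value h (kmap X U c)).isConst)

theorem value_res {U V : X.left.affineOpens} (hUV : (V : X.left.Opens) ≤ U) {x : j.M}
    (hV : IsMem V x) (hU : IsMem U x) (a : Γ(X.left, U)) :
    j.value hV (res X hUV a) = j.value hU a :=
  (j.isValue_iff hV _).1 (hV.isValue_res hUV (j.isValue_value hU a))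

/-- The point of `X` determined by an element of a model and an affine open neighbourhood. -/
def point {U : X.left.affineOpens} {x : j.M} (h : IsMem U x) : Point X j.F :=
  Point.ofHom U.2 (j.value h) (j.value_comp_kmap h)

theorem mem_point {U : X.left.affineOpens} {x : j.M} (h : IsMem U x) : (j.point h).Mem U :=
  Point.mem_ofHom _ _ _

theorem value_point {U : X.left.affineOpens} {x : j.M} (h : IsMem U x) :
    (j.point h).value U (j.mem_point h) = j.value h :=
  Point.value_ofHom _ _ _

theorem point_eq_of_le {U V : X.left.affineOpens} (hUV : (V : X.left.Opens) ≤ U) {x : j.M}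
    (hV : IsMem V x) (hU : IsMem U x) : j.point hV = j.point hU := by
  have hVU : (j.point hV).Mem U := (j.mem_point hV).mono hUV
  refine Point.ext_value U.2 hVU (j.mem_point hU) (RingHom.ext fun a => ?_)
  rw [j.value_point, ← (j.point hV).value_res hUV (j.mem_point hV) hVU a, j.value_point, j.value_res]

end

variable {X : QProj k} (j : Frame X.obj) [Theory.Model j.M (theory X.obj)]

/-- Both points agree with the one read off on the intersection, which is itself a named affine open
set by separatedness. -/
theorem point_eq {U V : X.obj.left.affineOpens} {x : j.M} (hU : IsMem U x) (hV : IsMem V x) :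
    j.point hU = j.point hV := by
  let W : X.obj.left.affineOpens := ⟨U ⊓ V, isAffineOpen_inf X U.2 V.2⟩
  have hW : IsMem W x := hU.inf rfl hV
  rw [← j.point_eq_of_le (V := W) inf_le_left hW hU,
    ← j.point_eq_of_le (V := W) inf_le_right hW hV]

/-- If the point lies in `V`, it lies in a basic open set of some `g` on `U` inside `V`. Then the
value of `g` at `x` is nonzero, so the model puts `x` in this basic open set and hence in `V`. -/
theorem mem_point_iff {U V : X.obj.left.affineOpens} {x : j.M} (hU : IsMem U x) :
    (j.point hU).Mem V ↔ IsMem V x := by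
  constructor
  · intro h
    obtain ⟨s, hs, hcov⟩ := exists_finite_basicOpen_cover X U V
    obtain ⟨g, hg, hx⟩ := hcov _ (((j.point hU).mem_iff _).1 (j.mem_point hU))
      (((j.point hU).mem_iff _).1 h)
    have hne := ((j.point hU).mem_basicOpen (j.mem_point hU) g).1 (((j.point hU).mem_iff _).2 hx)
    rw [j.value_point] at hne
    let W : X.obj.left.affineOpens := X.obj.left.affineBasicOpen g
    rcases (j.isValue_value hU g).isMem_basicOpen (V := W) rfl with h0 | hW
    · have := j.inj (j.isConst.1 h0)
      rw [map_zero] at this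
      exact (hne this).elim
    · exact hW.mono (hs g hg)
  · intro h
    rw [j.point_eq hU h]
    exact j.mem_point h

/-- The constant `c ∈ k^X` takes the value `t`. -/
def ConstValue (s : Finset X.obj.left.affineOpens) {M : Type u} [(lang X.obj).Structure M]
    (c : constField X.obj) (t : M) : Prop :=
  ∃ y : M, ∃ V ∈ s, IsValue V (constRes X.obj V c) y t

/-- A constant can be evaluated at any point, and by `nonempty_vpoint` there is one. So `α c` is
definable without parameters although only elements of `k` have names. -/
theorem constValue_std {s : Finset X.obj.left.affineOpens}
    (hs : ∀ x, ∃ U ∈ s, x ∈ (U : X.obj.left.Opens)) {F : Type u} [Field F] [IsAlgClosed F]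
    [Algebra k F] {α : constField X.obj →ₐ[k] F} {c : constField X.obj} {t : Model X.obj α} :
    ConstValue s c t ↔ t = Model.emb (α c) := by
  simp only [ConstValue, Model.isValue]
  constructor
  · rintro ⟨y, V, hV, p, h, -, h1⟩
    rw [h1, Point.value_constRes, p.alpha_eq]
  · rintro rfl
    obtain ⟨p⟩ := nonempty_vpoint X α
    obtain ⟨V, hV, hp⟩ := hs p.pt.center
    have hp' : p.pt.Mem V := (p.pt.mem_iff _).2 hp
    exact ⟨_, V, hV, p, hp', rfl, by rw [Point.value_constRes, p.alpha_eq]⟩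

/-- Solutions of the equations of a chart are coordinates of elements. As a general frame comes
without an embedding `α`, the equations are phrased through `ConstValue`, which makes the statement
transferable. -/
theorem exists_element {s : Finset X.obj.left.affineOpens}
    (hs : ∀ x, ∃ U ∈ s, x ∈ (U : X.obj.left.Opens)) (c : CoordSystem X.obj)
    (E : Finset (MvPolynomial (Fin c.n) k × constField X.obj))
    (hE : ∀ (F : Type u) [Field F] [Algebra k F] (α : constField X.obj →ₐ[k] F) (t : Fin c.n → F),
        (∃ (x : VPoint X.obj α) (h : x.pt.Mem c.U), ∀ l, x.pt.value c.U h (c.gen l) = t l) ↔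
          ∀ q ∈ E, MvPolynomial.aeval t q.1 = α q.2) (t : Fin c.n → j.F)
    (ht : ∀ q ∈ E, ConstValue s q.2 (j.emb (MvPolynomial.aeval t q.1))) :
    ∃ x : j.M, IsMem c.U x ∧ ∀ l, IsValue c.U (c.gen l) x (j.emb (t l)) := by
  have h1 : FDef (defField X.obj) (fun (j : Frame X.obj) (t : Fin c.n → j.F) =>
      ∀ q ∈ E, ConstValue s q.2 (j.emb (MvPolynomial.aeval t q.1))) := by
    refine FDef.finsetAll E fun q _ => ?_
    refine (FDef.exTuple (D := defField X.obj) (τ := Unit) (Q := fun (j : Frame X.obj) t r =>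
      r () = MvPolynomial.aeval t q.1 ∧ ConstValue s q.2 (j.emb (r ())))
      ((FDef.polyGraph q.1).and (FDef.ofUDef (P := fun (j : Frame X.obj) v => ConstValue s q.2 (v (Sum.inr ())))
        (UDef.ex (Q := fun (j : Frame X.obj) v y => ∃ V ∈ s, IsValue V (constRes X.obj V q.2) y (v (Sum.inr ())))
          (UDef.finsetEx s fun V _ => UDef.isValue V _ (Sum.inr ()) (Sum.inl (Sum.inr ())))))
        )).congr fun j t => ?_
    exact ⟨fun h => ⟨fun _ => _, rfl, h⟩, fun ⟨r, h, h'⟩ => h ▸ h'⟩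
  have h2 : FDef (defField X.obj) (fun (j : Frame X.obj) (t : Fin c.n → j.F) =>
      ∃ x : j.M, IsMem c.U x ∧ ∀ l, IsValue c.U (c.gen l) x (j.emb (t l))) :=
    FDef.ofUDef (P := fun (j : Frame X.obj) v => ∃ x : j.M, IsMem c.U x ∧ ∀ l, IsValue c.U (c.gen l) x (v l))
      (UDef.ex (UDef.and (UDef.isMem _ (Sum.inr ()))
        (UDef.finAll fun l => UDef.isValue _ _ (Sum.inr ()) (Sum.inl l))))
  rcases transfer (h1.not.or h2) (fun F _ _ _ α t => by
    rw [or_iff_not_imp_left, not_not]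
    intro h
    obtain ⟨x, hx, hxt⟩ := (hE F α t).2 fun q hq => Model.emb_inj.1 ((constValue_std hs).1 (h q hq))
    exact ⟨Model.ofPoint x, ⟨x, rfl, hx⟩, fun l => ⟨x, hx, rfl, congrArg Model.emb (hxt l).symm⟩⟩) j t with h | h
  · exact (h ht).elim
  · exact h

/-- Send a scalar to itself and an element of the variety sort to the point given by its values.
Coordinates make this injective, and the finite equations of the charts make it surjective. -/
theorem exists_equiv : ∃ α : constField X.obj →ₐ[k] j.F,
    Nonempty (FirstOrder.Language.Equiv (lang X.obj) j.M (Model X.obj α)) := by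
  have := j.isAlgClosed
  obtain ⟨s, hs⟩ := exists_affine_cover X
  obtain ⟨x₀, hx₀⟩ := exists_isPoint X j.M
  obtain ⟨U₀, -, hU₀⟩ := hx₀.exists_isMem hs
  have hα : ∀ {U : X.obj.left.affineOpens} {x : j.M} (h : IsMem U x),
      (j.point h).alpha = (j.point hU₀).alpha := by
    intro U x h
    ext c
    rw [← Point.value_constRes _ _ (j.mem_point h), ← Point.value_constRes _ _ (j.mem_point hU₀),
      j.value_point, j.value_point]
    exact j.inj ((j.isValue_value h _).constRes_unique (j.isValue_value hU₀ _))
  set α := (j.point hU₀).alpha with hα_def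
  refine ⟨α, ?_⟩
  let vp : ∀ {U : X.obj.left.affineOpens} {x : j.M} (h : IsMem U x), VPoint X.obj α := fun h =>
    ⟨j.point h, fun c => DFunLike.congr_fun (hα h) c⟩
  -- The image of `z` is specified simultaneously for all charts around `z`, so that later
  -- computations may use whichever chart is at hand.
  have hsrt : ∀ z : j.M, ∃ m : Model X.obj α,
      (∀ t, z = j.emb t → m = Model.emb t) ∧
      (∀ (U : X.obj.left.affineOpens) (h : IsMem U z), m = Model.ofPoint (vp h)) := by
    intro z
    rcases isScalar_or_isPoint (X := X.obj) z with h | h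
    · obtain ⟨t, rfl⟩ := j.isScalar.1 h
      refine ⟨Model.emb t, fun s hs => by rw [j.inj hs], fun U hU => ?_⟩
      exact (not_isPoint_of_isScalar h hU.isPoint).elim
    · obtain ⟨U, -, hU⟩ := h.exists_isMem hs
      refine ⟨Model.ofPoint (vp hU), ?_, fun V hV => ?_⟩
      · rintro t rfl
        exact (not_isPoint_of_isScalar (j.isScalar.2 ⟨t, rfl⟩) h).elim
      · exact congrArg Model.ofPoint (VPoint.ext' (j.point_eq hU hV))
  choose e he_emb he_pt using hsrt
  have he : ∀ t, e (j.emb t) = Model.emb t := fun t => he_emb _ t rfl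
  have hcases : ∀ z : j.M, (∃ t, z = j.emb t) ∨ ∃ U ∈ s, IsMem U z := by
    intro z
    rcases isScalar_or_isPoint (X := X.obj) z with h | h
    · exact Or.inl (j.isScalar.1 h)
    · exact Or.inr (h.exists_isMem hs)
  have hinj : Function.Injective e := by
    intro z w hzw
    rcases hcases z with ⟨t, rfl⟩ | ⟨U, hUs, hU⟩ <;> rcases hcases w with ⟨r, rfl⟩ | ⟨V, hVs, hV⟩
    · rw [he, he] at hzw
      rw [Model.emb_inj.1 hzw]
    · rw [he, he_pt _ V hV] at hzw
      exact (Model.ofPoint_ne_emb hzw.symm).elim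
    · rw [he, he_pt _ U hU] at hzw
      exact (Model.ofPoint_ne_emb hzw).elim
    · rw [he_pt _ U hU, he_pt _ V hV] at hzw
      have hp : j.point hU = j.point hV := congrArg VPoint.pt (Model.ofPoint_inj.1 hzw)
      have hUw : IsMem U w := by
        rw [← j.mem_point_iff hV, ← hp]
        exact j.mem_point hU
      rw [j.point_eq hV hUw] at hp
      obtain ⟨c, rfl⟩ := exists_coordSystem X U
      refine IsMem.eq_of_isValue c hU hUw fun l => ⟨_, j.isValue_value hU _, ?_⟩
      rw [j.isValue_iff hUw, ← j.value_point, ← j.value_point]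
      congr 1
      simp only [hp]
  have hsurj : Function.Surjective e := by
    rintro (p | t)
    · obtain ⟨U, hUs, hpc⟩ := hs p.pt.center
      have hp : p.pt.Mem U := (p.pt.mem_iff _).2 hpc
      obtain ⟨c, rfl⟩ := exists_coordSystem X U
      obtain ⟨E, hE⟩ := exists_finite_equations X c.U.2 c.gen c.generates
      -- The constants really take the values `α a` in the model, as can be seen at the element
      -- `x₀`.
      have hcv : ∀ a, ConstValue s a (j.emb (α a)) := by
        intro a
        obtain ⟨V, hV, hx⟩ := hx₀.exists_isMem hs
        refine ⟨x₀, V, hV, ?_⟩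
        rw [j.isValue_iff hx, ← j.value_point, Point.value_constRes, hα]
      obtain ⟨x, hxU, hx⟩ := j.exists_element hs c E hE
        (fun l => p.pt.value c.U hp (c.gen l)) (by
          intro q hq
          rw [(hE j.F α _).1 ⟨p, hp, fun l => rfl⟩ q hq]
          exact hcv _)
      refine ⟨x, (he_pt x c.U hxU).trans (congrArg Model.ofPoint ?_)⟩
      refine VPoint.ext_coords c (j.mem_point hxU) hp fun l => ?_
      change (j.point hxU).value c.U (j.mem_point hxU) (c.gen l) = _
      rw [j.value_point]
      exact (j.isValue_iff hxU _).1 (hx l)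
    · exact ⟨_, he t⟩
  have hemb : ∀ z t, e z = Model.emb t ↔ z = j.emb t := fun z t => by
    rw [← he, hinj.eq_iff]
  have hmem : ∀ (U : X.obj.left.affineOpens) z, IsMem U (e z) ↔ IsMem U z := by
    intro U z
    rw [Model.isMem]
    constructor
    · rintro ⟨p, h0, hp⟩
      rcases hcases z with ⟨t, rfl⟩ | ⟨V, hVs, hV⟩
      · exact (Model.ofPoint_ne_emb (h0.symm.trans (he t))).elim
      · rw [he_pt z V hV] at h0
        obtain rfl := Model.ofPoint_inj.1 h0
        exact (j.mem_point_iff hV).1 hp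
    · exact fun h => ⟨_, he_pt z U h, j.mem_point h⟩
  refine ⟨langEquiv e ⟨hinj, hsurj⟩ (fun z => ?_) (fun z => ?_)
    (fun x y z => ?_) (fun x y z => ?_) (fun c z => ?_) (fun U z => ?_) (fun U a x y => ?_)⟩
  · rw [Model.isPoint]
    constructor
    · rintro ⟨p, hp⟩
      rcases isScalar_or_isPoint (X := X.obj) z with h | h
      · obtain ⟨t, rfl⟩ := j.isScalar.1 h
        exact (Model.ofPoint_ne_emb (hp.symm.trans (he t))).elim
      · exact h
    · intro h
      obtain ⟨U, -, hU⟩ := h.exists_isMem hs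
      exact ⟨_, he_pt z U hU⟩
  · simp only [Model.isScalar, hemb, j.isScalar]
  · simp only [Model.isSum, hemb, j.isSum]
  · simp only [Model.isProd, hemb, j.isProd]
  · simp only [Model.isConst, hemb, j.isConst]
  · rw [hmem]
  · rw [Model.isValue]
    constructor
    · rintro ⟨p, hp, h0, h1⟩
      have hU : IsMem U x := (hmem U x).1 ⟨p, h0, hp⟩
      rw [he_pt x U hU] at h0
      obtain rfl := Model.ofPoint_inj.1 h0
      rw [hemb] at h1
      rw [h1, j.isValue_iff hU, ← j.value_point]
    · intro h
      obtain ⟨t, rfl⟩ := j.isScalar.1 h.isMem.2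
      refine ⟨vp h.isMem.1, j.mem_point h.isMem.1, he_pt x U _, ?_⟩
      rw [hemb]
      congr 1
      change _ = (j.point h.isMem.1).value U (j.mem_point h.isMem.1) a
      rw [j.value_point]
      exact ((j.isValue_iff _ a).1 h).symm

end Frame

theorem model_theory_iff (X : QProj k) (M : Type u) [(lang X.obj).Structure M] :
    Theory.Model M (theory X.obj) ↔
      ∃ (F : Type u) (_ : Field F) (_ : IsAlgClosed F) (_ : Algebra k F)
        (α : constField X.obj →ₐ[k] F),
        Nonempty (FirstOrder.Language.Equiv (lang X.obj) M (Model X.obj α)) := by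
  constructor
  · intro h
    have : Theory.Model (Frame.ofModel X.obj M).M (theory X.obj) := h
    obtain ⟨α, hα⟩ := (Frame.ofModel X.obj M).exists_equiv
    exact ⟨_, _, (Frame.ofModel X.obj M).isAlgClosed, _, α, hα⟩
  · rintro ⟨F, _, _, _, α, ⟨e⟩⟩
    have : Theory.Model (Model X.obj α) (theory X.obj) := ⟨fun φ hφ => hφ F α⟩
    exact StrongHomClass.theory_model e.symm

end Recognition

/-! ### Interpretations obtained from charts with coordinates in a definable field. -/

section Coordinates

universe w
variable {k : Type u} [Field k] {L L' : FirstOrder.Language.{u, u}} {J : Type w} {𝔐 : J → Type u}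
  [∀ j, L'.Structure (𝔐 j)] {F : J → Type u} [∀ j, Field (F j)] [∀ j, Algebra k (F j)]
  (D : DefField k L' 𝔐 F) {N : J → Type u} {O Λ : Type}
  (Crd : ∀ j, O → (Λ → F j) → N j → Prop)

/-- The tuple `d`, consisting of the name of a chart and of coordinates, represents `z`. -/
def Represents (j : J) (d : O ⊕ Λ → 𝔐 j) (z : N j) : Prop :=
  open Classical in
  ∃ (o : O) (t : Λ → F j), (∀ o', d (Sum.inl o') = D.emb j (if o' = o then 1 else 0)) ∧
    (∀ l, d (Sum.inr l) = D.emb j (t l)) ∧ Crd j o t z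

variable {D Crd}

/-- The name of a chart is coded by its indicator vector; distinct names have distinct codes because
`0 ≠ 1` in the field. -/
theorem Represents.unique (hfun : ∀ j o t z z', Crd j o t z → Crd j o t z' → z = z') {j : J}
    {d : O ⊕ Λ → 𝔐 j} {z z' : N j} (h : Represents D Crd j d z) (h' : Represents D Crd j d z') :
    z = z' := by
  obtain ⟨o, t, ho, ht, hc⟩ := h
  obtain ⟨o', t', ho', ht', hc'⟩ := h'
  have h1 : o = o' := by
    by_contra hne
    have := D.inj j ((ho o).symm.trans (ho' o))
    simp [hne] at this
  subst h1
  obtain rfl : t = t' := funext fun l => D.inj j ((ht l).symm.trans (ht' l))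
  exact hfun j _ _ _ _ hc hc'

theorem exists_represents (hsurj : ∀ j z, ∃ o t, Crd j o t z) (j : J) (z : N j) :
    ∃ d : O ⊕ Λ → 𝔐 j, Represents D Crd j d z := by
  classical
  obtain ⟨o, t, h⟩ := hsurj j z
  exact ⟨Sum.elim (fun o' => D.emb j (if o' = o then 1 else 0)) (fun l => D.emb j (t l)),
    o, t, fun _ => rfl, fun _ => rfl, h⟩

theorem udef_name [Finite O] (o : O) : UDef L' 𝔐 (fun j (d : O → 𝔐 j) => open Classical in
    ∀ o', d o' = D.emb j (if o' = o then 1 else 0)) := by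
  refine UDef.finAll fun o' => ?_
  by_cases h : o' = o
  · simp only [h, if_true]
    exact ((D.const 1).comp fun _ => o).congr fun j v => by rw [map_one]
  · simp only [h, if_false]
    exact ((D.const 0).comp fun _ => o').congr fun j v => by rw [map_zero]

/-- There are finitely many choices of chart names. For each of them only a condition on coordinates
remains, and this is definable by `hP`. -/
theorem udef_represents [Finite O] [Finite Λ] {ν : Type} [Finite ν]
    {P : ∀ j, (ν → N j) → Prop}
    (hP : ∀ o : ν → O, FDef D (fun j (T : ν × Λ → F j) =>
      ∃ z : ν → N j, (∀ i, Crd j (o i) (fun l => T (i, l)) (z i)) ∧ P j z)) :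
    UDef L' 𝔐 (fun j (d : ν × (O ⊕ Λ) → 𝔐 j) =>
      ∃ z : ν → N j, (∀ i, Represents D Crd j (fun l => d (i, l)) (z i)) ∧ P j z) := by
  classical
  have h : UDef L' 𝔐 (fun j (d : ν × (O ⊕ Λ) → 𝔐 j) => ∃ o : ν → O,
      (∀ i o', d (i, Sum.inl o') = D.emb j (if o' = o i then 1 else 0)) ∧
      ∃ T : ν × Λ → F j, (∀ il : ν × Λ, d (il.1, Sum.inr il.2) = D.emb j (T il)) ∧
        ∃ z : ν → N j, (∀ i, Crd j (o i) (fun l => T (i, l)) (z i)) ∧ P j z) := by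
    refine UDef.finEx fun o => UDef.and (UDef.finAll fun i =>
      (udef_name (D := D) (o i)).comp fun o' => (i, Sum.inl o')) ?_
    exact UDef.comp (hP o) fun il => (il.1, Sum.inr il.2)
  refine h.congr fun j d => ?_
  constructor
  · rintro ⟨z, hz, hPz⟩
    choose o t ho ht hc using hz
    exact ⟨o, ho, fun il => t il.1 il.2, fun il => ht il.1 il.2, z, hc, hPz⟩
  · rintro ⟨o, ho, T, hT, z, hz, hPz⟩
    exact ⟨z, fun i => ⟨o i, fun l => T (i, l), ho i, fun l => hT (i, l), hz i⟩, hPz⟩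

/-- A system of charts whose coordinates live in a definable family of fields, and in which the
basic relations are definable, gives an interpretation. -/
theorem exists_interpretation [Finite O] [Finite Λ] [∀ j, L.Structure (N j)]
    (hfun : ∀ j o t z z', Crd j o t z → Crd j o t z' → z = z')
    (hsurj : ∀ j z, ∃ o t, Crd j o t z)
    (heq : ∀ o o', FDef D (fun j (T : Λ ⊕ Λ → F j) =>
      ∃ z, Crd j o (fun l => T (Sum.inl l)) z ∧ Crd j o' (fun l => T (Sum.inr l)) z))
    (hrel : ∀ {n : ℕ} (R : L.Relations n) (o : Fin n → O), FDef D (fun j (T : Fin n × Λ → F j) =>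
      ∃ z : Fin n → N j, (∀ i, Crd j (o i) (fun l => T (i, l)) (z i)) ∧ Structure.RelMap R z)) :
    ∃ (I : Interpretation L L') (π : ∀ j, I.Dom (𝔐 j) → N j), (∀ j, I.IsRealizedBy (π j)) ∧
      ∀ h : ∀ j, 𝔐 j → N j, (∀ o, UDef L' 𝔐 (fun j (v : Unit ⊕ Λ → 𝔐 j) =>
        ∃ t : Λ → F j, (∀ l, v (Sum.inr l) = D.emb j (t l)) ∧ Crd j o t (h j (v (Sum.inl ()))))) →
        ∃ γ : L'.Formula (Unit ⊕ Fin I.dim), ∀ j, Interpretation.Tracks (π j) γ (h j) := by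
  obtain ⟨n, ⟨e⟩⟩ := Finite.exists_equiv_fin (O ⊕ Λ)
  have hdom : UDef L' 𝔐 (fun j (d : Fin n → 𝔐 j) => ∃ z, Represents D Crd j (d ∘ e) z) := by
    -- The diagonal case of `heq`, with equal names and equal coordinates, says that the tuple
    -- represents something.
    have h := udef_represents (D := D) (Crd := Crd) (ν := Unit) (P := fun _ _ => True) (fun o =>
      ((heq (o ()) (o ())).comp (Sum.elim (fun l => ((), l)) (fun l => ((), l)))).congr
        fun j T => by
          constructor
          · rintro ⟨z, hz, -⟩
            exact ⟨z (), hz (), hz ()⟩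
          · rintro ⟨z, hz, -⟩
            exact ⟨fun _ => z, fun _ => hz, trivial⟩)
    refine (h.comp fun x => e x.2).congr fun j d => ?_
    exact ⟨fun ⟨z, hz⟩ => ⟨fun _ => z, fun _ => hz, trivial⟩, fun ⟨z, hz, _⟩ => ⟨z (), hz ()⟩⟩
  have heqv : UDef L' 𝔐 (fun j (d : Fin n ⊕ Fin n → 𝔐 j) => ∃ z,
      Represents D Crd j (fun i => d (Sum.inl (e i))) z ∧
      Represents D Crd j (fun i => d (Sum.inr (e i))) z) := by
    have h := udef_represents (D := D) (Crd := Crd) (ν := Fin 2) (P := fun j z => z 0 = z 1)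
      (fun o => ((heq (o 0) (o 1)).comp (Sum.elim (fun l => (0, l)) (fun l => (1, l)))).congr
        fun j T => by
          constructor
          · rintro ⟨z, hz, h⟩
            exact ⟨z 0, hz 0, h ▸ hz 1⟩
          · rintro ⟨z, hz, hz'⟩
            refine ⟨fun _ => z, fun i => ?_, rfl⟩
            fin_cases i
            · exact hz
            · exact hz')
    refine (h.comp fun x => (![Sum.inl (e x.2), Sum.inr (e x.2)] : Fin 2 → Fin n ⊕ Fin n) x.1).congr
      fun j d => ?_
    constructor
    · rintro ⟨z, hz, hz'⟩
      refine ⟨fun _ => z, fun i => ?_, rfl⟩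
      fin_cases i
      · exact hz
      · exact hz'
    · rintro ⟨z, hz, h⟩
      exact ⟨z 0, hz 0, h ▸ hz 1⟩
  have hR : ∀ {m : ℕ} (R : L.Relations m), UDef L' 𝔐 (fun j (d : Fin m × Fin n → 𝔐 j) =>
      ∃ z : Fin m → N j, (∀ i, Represents D Crd j (fun l => d (i, e l)) (z i)) ∧
        Structure.RelMap R z) := fun R =>
    (udef_represents (D := D) (Crd := Crd) (hrel R)).comp fun x => (x.1, e x.2)
  let I : Interpretation L L' :=
    { dim := n
      dom := hdom.choose
      eqv := heqv.choose
      rel := fun R => (hR R).choose }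
  have hI : ∀ j (d : I.Dom (𝔐 j)), ∃ z, Represents D Crd j (d.1 ∘ e) z := fun j d =>
    (hdom.choose_spec j d.1).1 d.2
  choose π hπ using hI
  have hπ_iff : ∀ j (d : I.Dom (𝔐 j)) z, Represents D Crd j (d.1 ∘ e) z ↔ π j d = z :=
    fun j d z => ⟨fun h => (hπ j d).unique hfun h, fun h => h ▸ hπ j d⟩
  refine ⟨I, π, fun j => ⟨fun z => ?_, fun d d' => ?_, fun R d => ?_⟩, fun h hh => ?_⟩
  · obtain ⟨d, hd⟩ := exists_represents (D := D) hsurj j z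
    have hd' : Represents D Crd j ((d ∘ e.symm) ∘ e) z := by
      rwa [Function.comp_assoc, e.symm_comp_self]
    exact ⟨⟨d ∘ e.symm, (hdom.choose_spec j _).2 ⟨z, hd'⟩⟩, (hπ_iff j _ _).1 hd'⟩
  · refine (heqv.choose_spec j _).trans ⟨?_, fun h => ⟨π j d, hπ j d, h ▸ hπ j d'⟩⟩
    rintro ⟨z, hz, hz'⟩
    exact ((hπ_iff j d z).1 hz).trans ((hπ_iff j d' z).1 hz').symm
  · refine ((hR R).choose_spec j _).trans ⟨?_, fun h => ⟨_, fun i => hπ j (d i), h⟩⟩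
    rintro ⟨z, hz, h⟩
    rwa [funext fun i => (hπ_iff j (d i) (z i)).1 (hz i)]
  · have hγ : UDef L' 𝔐 (fun j (v : Unit ⊕ Fin n → 𝔐 j) =>
        Represents D Crd j (fun i => v (Sum.inr (e i))) (h j (v (Sum.inl ())))) :=
      (UDef.finEx fun o => UDef.and
        ((udef_name (D := D) o).comp fun o' => (Sum.inr (e (Sum.inl o')) : Unit ⊕ Fin n))
        ((hh o).comp (Sum.map id fun l => e (Sum.inr l)))).congr fun j v => by
          constructor
          · rintro ⟨o, t, h1, h2, h3⟩
            exact ⟨o, h1, t, h2, h3⟩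
          · rintro ⟨o, h1, t, h2, h3⟩
            exact ⟨o, t, h1, h2, h3⟩
    exact ⟨hγ.choose, fun j x d => (hγ.choose_spec j _).trans (hπ_iff j d _)⟩

end Coordinates

/-! ### Coordinates of points of the variety and their definability. -/

section Charts

universe w
variable {k : Type u} [Field k]

/-- The point `x` has coordinates `t` in the chart `c`. -/
def HasCoords {X : KScheme k} {F : Type u} [Field F] [Algebra k F] {α : constField X →ₐ[k] F}
    (c : CoordSystem X) (t : Fin c.n → F) (x : VPoint X α) : Prop :=
  ∃ h : x.pt.Mem c.U, ∀ l, x.pt.value c.U h (c.gen l) = t l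

theorem HasCoords.unique {X : KScheme k} {F : Type u} [Field F] [Algebra k F]
    {α : constField X →ₐ[k] F} {c : CoordSystem X} {t : Fin c.n → F} {x y : VPoint X α}
    (hx : HasCoords c t x) (hy : HasCoords c t y) : x = y :=
  VPoint.ext_coords c hx.1 hy.1 fun l => (hx.2 l).trans (hy.2 l).symm

theorem HasCoords.value_eq {X : KScheme k} {F : Type u} [Field F] [Algebra k F]
    {α : constField X →ₐ[k] F} {c : CoordSystem X} {t : Fin c.n → F} {x : VPoint X α}
    (hx : HasCoords c t x) (P : MvPolynomial (Fin c.n) k) :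
    x.pt.value c.U hx.1 (MvPolynomial.eval₂Hom (kmap X c.U) c.gen P) = MvPolynomial.aeval t P := by
  rw [Point.value_eval₂, funext hx.2]

variable {L' : FirstOrder.Language.{u, u}} {J : Type w} {𝔐 : J → Type u}
  [∀ j, L'.Structure (𝔐 j)] {F : J → Type u} [∀ j, Field (F j)] [∀ j, Algebra k (F j)]
  {D : DefField k L' 𝔐 F} {X : QProj k} {α : ∀ j, constField X.obj →ₐ[k] F j}

theorem fdef_hasCoords
    (hα : ∀ c, UDef L' 𝔐 (fun j (v : Unit → 𝔐 j) => v () = D.emb j (α j c)))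
    (c : CoordSystem X.obj) :
    FDef D (fun j (t : Fin c.n → F j) => ∃ x : VPoint X.obj (α j), HasCoords c t x) := by
  obtain ⟨E, hE⟩ := exists_finite_equations X c.U.2 c.gen c.generates
  exact (FDef.finsetAll E fun q _ => FDef.polyEqConst q.1 (hα q.2)).congr fun j t => hE (F j) (α j) t

/-- The part of `U` in the chart is covered by finitely many basic open sets, on each of which `a`
is a fraction `r / g ^ n`. The value is the scalar `s` with `s * g ^ n = r` at a point where `g ≠
0`. -/
theorem fdef_value
    (hα : ∀ c, UDef L' 𝔐 (fun j (v : Unit → 𝔐 j) => v () = D.emb j (α j c)))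
    (c : CoordSystem X.obj) (U : X.obj.left.affineOpens) (a : Γ(X.obj.left, U)) :
    FDef D (fun j (T : Fin c.n ⊕ Unit → F j) => ∃ x : VPoint X.obj (α j),
      HasCoords c (fun l => T (Sum.inl l)) x ∧
        ∃ h : x.pt.Mem U, x.pt.value U h a = T (Sum.inr ())) := by
  obtain ⟨s, hs, hcov⟩ := exists_finite_basicOpen_cover X c.U U
  have hfrac : ∀ g : s, ∃ (n : ℕ) (r : Γ(X.obj.left, c.U)), ∀ (F : Type u) [Field F] [Algebra k F]
      (p : Point X.obj F) (h : p.Mem c.U) (hg : p.Mem (X.obj.left.basicOpen g.1)) (hU : p.Mem U),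
      p.value U hU a * p.value c.U h g ^ n = p.value c.U h r := by
    intro g
    obtain ⟨n, r, h⟩ := exists_fraction_value c.U g.1 (res X.obj (hs g g.2) a)
    refine ⟨n, r, fun F _ _ p hp hg hU => ?_⟩
    rw [← h F p hp hg, Point.value_res]
  choose n r hr using hfrac
  choose G hG using fun g : s => c.generates g
  choose R hR using fun g : s => c.generates (r g)
  have h1 : FDef D (fun j (T : Fin c.n ⊕ Unit → F j) =>
      (∃ x : VPoint X.obj (α j), HasCoords c (fun l => T (Sum.inl l)) x) ∧
      ∃ g : s, MvPolynomial.aeval (fun l => T (Sum.inl l)) (G g) ≠ 0 ∧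
        MvPolynomial.aeval T (MvPolynomial.X (Sum.inr ()) *
          MvPolynomial.rename Sum.inl (G g) ^ n g - MvPolynomial.rename Sum.inl (R g)) = 0) :=
    ((fdef_hasCoords hα c).comp Sum.inl).and (FDef.finEx fun g =>
      ((FDef.polyEqZero (G g)).comp Sum.inl).not.and (FDef.polyEqZero _))
  refine h1.congr fun j T => ?_
  have hpoly : ∀ g : s, MvPolynomial.aeval T (MvPolynomial.X (Sum.inr ()) *
          MvPolynomial.rename Sum.inl (G g) ^ n g - MvPolynomial.rename Sum.inl (R g)) = 0 ↔
      T (Sum.inr ()) * MvPolynomial.aeval (fun l => T (Sum.inl l)) (G g) ^ n g =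
        MvPolynomial.aeval (fun l => T (Sum.inl l)) (R g) := by
    intro g
    rw [map_sub, sub_eq_zero, map_mul, map_pow, MvPolynomial.aeval_rename, MvPolynomial.aeval_rename,
      MvPolynomial.aeval_X]
    rfl
  simp only [hpoly]
  constructor
  · rintro ⟨x, hx, hU, hv⟩
    refine ⟨⟨x, hx⟩, ?_⟩
    obtain ⟨g, hg, hxg⟩ := hcov _ ((x.pt.mem_iff _).1 hx.1) ((x.pt.mem_iff _).1 hU)
    have hpg : x.pt.Mem (X.obj.left.basicOpen g) := (x.pt.mem_iff _).2 hxg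
    refine ⟨⟨g, hg⟩, ?_, ?_⟩
    · rw [← hx.value_eq, hG]
      exact (x.pt.mem_basicOpen hx.1 g).1 hpg
    · rw [← hx.value_eq, ← hx.value_eq, hG, hR, ← hv]
      exact hr ⟨g, hg⟩ (F j) x.pt hx.1 hpg hU
  · rintro ⟨⟨x, hx⟩, g, hg0, hg⟩
    rw [← hx.value_eq, hG] at hg0
    rw [← hx.value_eq, ← hx.value_eq, hG, hR] at hg
    have hpg : x.pt.Mem (X.obj.left.basicOpen g.1) := (x.pt.mem_basicOpen hx.1 g.1).2 hg0
    have hU : x.pt.Mem U := hpg.mono (hs g g.2)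
    refine ⟨x, hx, hU, mul_right_cancel₀ (pow_ne_zero (n g) hg0) ?_⟩
    rw [hg]
    exact hr g (F j) x.pt hx.1 hpg hU

theorem fdef_mem
    (hα : ∀ c, UDef L' 𝔐 (fun j (v : Unit → 𝔐 j) => v () = D.emb j (α j c)))
    (c : CoordSystem X.obj) (U : X.obj.left.affineOpens) :
    FDef D (fun j (t : Fin c.n → F j) => ∃ x : VPoint X.obj (α j),
      HasCoords c t x ∧ x.pt.Mem U) := by
  -- A point lies in `U` exactly if the zero function on `U` has a value there.
  refine (FDef.exTuple (τ := Unit) (Q := fun j t s => ∃ x : VPoint X.obj (α j),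
    HasCoords c t x ∧ ∃ h : x.pt.Mem U, x.pt.value U h 0 = s ()) (fdef_value hα c U 0)).congr
      fun j t => ?_
  exact ⟨fun ⟨x, hx, h⟩ => ⟨fun _ => _, x, hx, h, rfl⟩, fun ⟨_, x, hx, h, _⟩ => ⟨x, hx, h⟩⟩

/-- Finitely many coordinate systems covering `X`. -/
structure Charts (X : QProj k) where
  /-- the number of charts -/
  num : ℕ
  /-- the charts -/
  chart : Fin num → CoordSystem X.obj
  cover : ∀ x : X.obj.left, ∃ i, x ∈ ((chart i).U : X.obj.left.Opens)

theorem nonempty_charts (X : QProj k) : Nonempty (Charts X) := by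
  obtain ⟨s, hs⟩ := exists_affine_cover X
  choose c hc using fun U : X.obj.left.affineOpens => exists_coordSystem X U
  refine ⟨⟨s.card, fun i => c (s.equivFin.symm i), fun x => ?_⟩⟩
  obtain ⟨U, hU, hx⟩ := hs x
  refine ⟨s.equivFin ⟨U, hU⟩, ?_⟩
  rw [hc, Equiv.symm_apply_apply]
  exact hx

namespace Charts

variable (C : Charts X)

/-- The names of the sorts and charts: the field sort, and the charts. -/
abbrev Name := Option (Fin C.num)

/-- The index set for all coordinates. -/
abbrev Coord := (Σ i : Fin C.num, Fin (C.chart i).n) ⊕ Unit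

/-- `z` has coordinates `t` in the field sort or in a chart. -/
def Crd {F : Type u} [Field F] [Algebra k F] (α : constField X.obj →ₐ[k] F) :
    C.Name → (C.Coord → F) → Model X.obj α → Prop
  | none, t, z => z = Model.emb (t (Sum.inr ()))
  | some i, t, z => ∃ x, z = Model.ofPoint x ∧ HasCoords (C.chart i) (fun l => t (Sum.inl ⟨i, l⟩)) x

theorem crd_unique {F : Type u} [Field F] [Algebra k F] {α : constField X.obj →ₐ[k] F} (o : C.Name)
    (t : C.Coord → F) (z z' : Model X.obj α) (h : C.Crd α o t z) (h' : C.Crd α o t z') : z = z' := by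
  cases o with
  | none => exact Eq.trans h (Eq.symm h')
  | some i =>
    obtain ⟨x, rfl, hx⟩ := h
    obtain ⟨y, rfl, hy⟩ := h'
    rw [hx.unique hy]

theorem exists_crd {F : Type u} [Field F] [Algebra k F] {α : constField X.obj →ₐ[k] F}
    (z : Model X.obj α) : ∃ o t, C.Crd α o t z := by
  rcases z with x | t
  · obtain ⟨i, hi⟩ := C.cover x.pt.center
    have hx := (x.pt.mem_iff _).2 hi
    classical
    exact ⟨some i, Sum.elim (fun il => if h : x.pt.Mem (C.chart il.1).U then
      x.pt.value _ h ((C.chart il.1).gen il.2) else 0) (fun _ => 0), x, rfl, hx, fun l => by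
        simp only [Sum.elim_inl, hx, dite_true]⟩
  · exact ⟨none, fun _ => t, rfl⟩

theorem fdef_eq (hα : ∀ c, UDef L' 𝔐 (fun j (v : Unit → 𝔐 j) => v () = D.emb j (α j c))) (o o' : C.Name) : FDef D (fun j (T : C.Coord ⊕ C.Coord → F j) =>
    ∃ z, C.Crd (α j) o (fun l => T (Sum.inl l)) z ∧ C.Crd (α j) o' (fun l => T (Sum.inr l)) z) := by
  rcases o with _ | i <;> rcases o' with _ | i'
  · refine (FDef.eq (D := D) (Sum.inl (Sum.inr ()) : C.Coord ⊕ C.Coord)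
      (Sum.inr (Sum.inr ()))).congr fun j T => ?_
    exact ⟨fun ⟨z, h, h'⟩ => Model.emb_inj.1 (Eq.trans (Eq.symm h) h'), fun h => ⟨_, rfl, congrArg _ h⟩⟩
  · refine (FDef.const (D := D) False).congr fun j T => ?_
    refine ⟨?_, False.elim⟩
    rintro ⟨z, h, x, h', -⟩
    exact Model.ofPoint_ne_emb (h'.symm.trans h)
  · refine (FDef.const (D := D) False).congr fun j T => ?_
    refine ⟨?_, False.elim⟩
    rintro ⟨z, ⟨x, h', -⟩, h⟩
    exact Model.ofPoint_ne_emb (h'.symm.trans h)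
  -- Two coordinate tuples give the same point if the point of the first lies in the second chart
  -- and has the second tuple as its coordinates there.
  · refine ((fdef_mem hα (C.chart i) (C.chart i').U).comp
      (fun l => (Sum.inl (Sum.inl ⟨i, l⟩) : C.Coord ⊕ C.Coord)) |>.and
      (FDef.finAll fun l => (fdef_value hα (C.chart i) (C.chart i').U ((C.chart i').gen l)).comp
        (Sum.elim (fun l => (Sum.inl (Sum.inl ⟨i, l⟩) : C.Coord ⊕ C.Coord))
          (fun _ => Sum.inr (Sum.inl ⟨i', l⟩))))).congr fun j T => ?_
    constructor
    · rintro ⟨z, ⟨x, rfl, hx⟩, y, hxy, hy⟩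
      obtain rfl := Model.ofPoint_inj.1 hxy
      exact ⟨⟨x, hx, hy.1⟩, fun l => ⟨x, hx, hy.1, hy.2 l⟩⟩
    · rintro ⟨⟨x, hx, hU⟩, h⟩
      refine ⟨_, ⟨x, rfl, hx⟩, x, rfl, hU, fun l => ?_⟩
      obtain ⟨x', hx', _, hv⟩ := h l
      obtain rfl := hx.unique hx'
      exact hv

theorem exists_fin_one {N : Type*} {A : Fin 1 → N → Prop} {B : (Fin 1 → N) → Prop} :
    (∃ z : Fin 1 → N, (∀ i, A i (z i)) ∧ B z) ↔ ∃ x, A 0 x ∧ B ![x] := by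
  constructor
  · rintro ⟨z, hA, hB⟩
    exact ⟨z 0, hA 0, by rwa [show ![z 0] = z by ext i; fin_cases i; rfl]⟩
  · rintro ⟨x, hA, hB⟩
    exact ⟨![x], fun i => by fin_cases i; exact hA, hB⟩

theorem exists_fin_two {N : Type*} {A : Fin 2 → N → Prop} {B : (Fin 2 → N) → Prop} :
    (∃ z : Fin 2 → N, (∀ i, A i (z i)) ∧ B z) ↔ ∃ x y, A 0 x ∧ A 1 y ∧ B ![x, y] := by
  constructor
  · rintro ⟨z, hA, hB⟩
    exact ⟨z 0, z 1, hA 0, hA 1, by rwa [show ![z 0, z 1] = z by ext i; fin_cases i <;> rfl]⟩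
  · rintro ⟨x, y, hA, hA', hB⟩
    exact ⟨![x, y], fun i => by fin_cases i <;> assumption, hB⟩

theorem exists_fin_three {N : Type*} {A : Fin 3 → N → Prop} {B : (Fin 3 → N) → Prop} :
    (∃ z : Fin 3 → N, (∀ i, A i (z i)) ∧ B z) ↔
      ∃ x y w, A 0 x ∧ A 1 y ∧ A 2 w ∧ B ![x, y, w] := by
  constructor
  · rintro ⟨z, hA, hB⟩
    exact ⟨z 0, z 1, z 2, hA 0, hA 1, hA 2,
      by rwa [show ![z 0, z 1, z 2] = z by ext i; fin_cases i <;> rfl]⟩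
  · rintro ⟨x, y, w, hA, hA', hA'', hB⟩
    exact ⟨![x, y, w], fun i => by fin_cases i <;> assumption, hB⟩

theorem fdef_isPoint (hα : ∀ c, UDef L' 𝔐 (fun j (v : Unit → 𝔐 j) => v () = D.emb j (α j c)))
    (o : C.Name) : FDef D (fun j (t : C.Coord → F j) =>
      ∃ z : Model X.obj (α j), C.Crd (α j) o t z ∧ IsPoint X.obj z) := by
  rcases o with _ | i
  · refine (FDef.const (D := D) False).congr fun j T => ⟨?_, False.elim⟩
    rintro ⟨z, h, x, h'⟩
    exact Model.ofPoint_ne_emb (Eq.trans (Eq.symm h') h)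
  · refine ((fdef_hasCoords hα (C.chart i)).comp fun l => Sum.inl ⟨i, l⟩).congr fun j T => ?_
    exact ⟨fun ⟨z, ⟨x, hz, hx⟩, _⟩ => ⟨x, hx⟩, fun ⟨x, hx⟩ => ⟨_, ⟨x, rfl, hx⟩, x, rfl⟩⟩

theorem fdef_isScalar (o : C.Name) : FDef D (fun j (t : C.Coord → F j) =>
      ∃ z : Model X.obj (α j), C.Crd (α j) o t z ∧ IsScalar X.obj z) := by
  rcases o with _ | i
  · exact (FDef.const (D := D) True).congr fun j T => ⟨fun _ => trivial, fun _ => ⟨_, rfl, _, rfl⟩⟩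
  · refine (FDef.const (D := D) False).congr fun j T => ⟨?_, False.elim⟩
    rintro ⟨z, ⟨x, hz, -⟩, t, h'⟩
    exact Model.ofPoint_ne_emb (hz.symm.trans h')

theorem crd_isScalar {F : Type u} [Field F] [Algebra k F] {α : constField X.obj →ₐ[k] F}
    {o : C.Name} {t : C.Coord → F} {s : F} :
    C.Crd α o t (Model.emb s) ↔ o = none ∧ t (Sum.inr ()) = s := by
  rcases o with _ | i
  · exact ⟨fun h => ⟨rfl, (Model.emb_inj.1 h).symm⟩, fun h => congrArg Model.emb h.2.symm⟩
  · exact ⟨fun ⟨x, h, _⟩ => (Model.ofPoint_ne_emb h.symm).elim, fun h => nomatch h.1⟩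

theorem crd_isPoint {F : Type u} [Field F] [Algebra k F] {α : constField X.obj →ₐ[k] F}
    {o : C.Name} {t : C.Coord → F} {x : VPoint X.obj α} :
    C.Crd α o t (Model.ofPoint x) ↔
      ∃ i, o = some i ∧ HasCoords (C.chart i) (fun l => t (Sum.inl ⟨i, l⟩)) x := by
  rcases o with _ | i
  · exact ⟨fun h => (Model.ofPoint_ne_emb h).elim, fun ⟨i, h, _⟩ => nomatch h⟩
  · constructor
    · rintro ⟨y, h, hy⟩
      obtain rfl := Model.ofPoint_inj.1 h
      exact ⟨i, rfl, hy⟩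
    · rintro ⟨i', hi, hx⟩
      obtain rfl := Option.some.inj hi
      exact ⟨x, rfl, hx⟩

/-- The names `o` fix the sorts of the arguments. If they do not fit `R` the relation is empty;
otherwise it is a condition on coordinates covered by the preceding lemmas. -/
theorem fdef_relMap (hα : ∀ c, UDef L' 𝔐 (fun j (v : Unit → 𝔐 j) => v () = D.emb j (α j c)))
    {n : ℕ} (R : (lang X.obj).Relations n) (o : Fin n → C.Name) :
    FDef D (fun j (T : Fin n × C.Coord → F j) => ∃ z : Fin n → Model X.obj (α j),
      (∀ i, C.Crd (α j) (o i) (fun l => T (i, l)) (z i)) ∧ Structure.RelMap R z) := by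
  cases R with
  | sortX =>
    exact ((fdef_isPoint C hα (o 0)).comp fun l => (0, l)).congr fun j T => exists_fin_one
  | sortF =>
    exact ((fdef_isScalar (α := α) C (o 0)).comp fun l => (0, l)).congr fun j T => exists_fin_one
  | add =>
    by_cases h : o 0 = none ∧ o 1 = none ∧ o 2 = none
    · obtain ⟨h0, h1, h2⟩ := h
      refine (FDef.add (0, Sum.inr ()) (1, Sum.inr ()) (2, Sum.inr ())).congr fun j T => ?_
      refine exists_fin_three.trans ?_
      constructor
      · rintro ⟨_, _, _, hx, hy, hw, s, t, rfl, rfl, rfl⟩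
        rw [((crd_isScalar C).1 hx).2, ((crd_isScalar C).1 hy).2, ((crd_isScalar C).1 hw).2]
      · intro h
        exact ⟨_, _, _, (crd_isScalar C).2 ⟨h0, rfl⟩, (crd_isScalar C).2 ⟨h1, rfl⟩,
          (crd_isScalar C).2 ⟨h2, rfl⟩, _, _, rfl, rfl, congrArg Model.emb h⟩
    · refine (FDef.const (D := D) False).congr fun j T => ⟨?_, False.elim⟩
      rw [exists_fin_three]
      rintro ⟨_, _, _, hx, hy, hw, s, t, rfl, rfl, rfl⟩
      exact h ⟨((crd_isScalar C).1 hx).1, ((crd_isScalar C).1 hy).1, ((crd_isScalar C).1 hw).1⟩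
  | mul =>
    by_cases h : o 0 = none ∧ o 1 = none ∧ o 2 = none
    · obtain ⟨h0, h1, h2⟩ := h
      refine (FDef.mul (0, Sum.inr ()) (1, Sum.inr ()) (2, Sum.inr ())).congr fun j T => ?_
      refine exists_fin_three.trans ?_
      constructor
      · rintro ⟨_, _, _, hx, hy, hw, s, t, rfl, rfl, rfl⟩
        rw [((crd_isScalar C).1 hx).2, ((crd_isScalar C).1 hy).2, ((crd_isScalar C).1 hw).2]
      · intro h
        exact ⟨_, _, _, (crd_isScalar C).2 ⟨h0, rfl⟩, (crd_isScalar C).2 ⟨h1, rfl⟩,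
          (crd_isScalar C).2 ⟨h2, rfl⟩, _, _, rfl, rfl, congrArg Model.emb h⟩
    · refine (FDef.const (D := D) False).congr fun j T => ⟨?_, False.elim⟩
      rw [exists_fin_three]
      rintro ⟨_, _, _, hx, hy, hw, s, t, rfl, rfl, rfl⟩
      exact h ⟨((crd_isScalar C).1 hx).1, ((crd_isScalar C).1 hy).1, ((crd_isScalar C).1 hw).1⟩
  | const c =>
    by_cases h : o 0 = none
    · refine (FDef.eqConst (0, Sum.inr ()) (D.const c)).congr fun j T => ?_
      refine exists_fin_one.trans ?_
      constructor
      · rintro ⟨_, hx, rfl⟩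
        exact ((crd_isScalar C).1 hx).2
      · intro h'
        exact ⟨_, (crd_isScalar C).2 ⟨h, h'⟩, rfl⟩
    · refine (FDef.const (D := D) False).congr fun j T => ⟨?_, False.elim⟩
      rw [exists_fin_one]
      rintro ⟨_, hx, rfl⟩
      exact h ((crd_isScalar C).1 hx).1
  | mem U =>
    rcases h : o 0 with _ | i
    · refine (FDef.const (D := D) False).congr fun j T => ⟨?_, False.elim⟩
      rw [exists_fin_one]
      rintro ⟨_, hx, x, rfl, hU⟩
      obtain ⟨i, hi, -⟩ := (crd_isPoint C).1 hx
      rw [h] at hi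
      exact nomatch hi
    · refine ((fdef_mem hα (C.chart i) U).comp fun l => (0, Sum.inl ⟨i, l⟩)).congr fun j T => ?_
      refine exists_fin_one.trans ?_
      constructor
      · rintro ⟨_, hx, x, rfl, hU⟩
        obtain ⟨i', hi, hx⟩ := (crd_isPoint C).1 hx
        obtain rfl := Option.some.inj (h.symm.trans hi)
        exact ⟨x, hx, hU⟩
      · rintro ⟨x, hx, hU⟩
        exact ⟨_, (crd_isPoint C).2 ⟨i, h, hx⟩, x, rfl, hU⟩
  | fn U a =>
    rcases h : o 0 with _ | i
    · refine (FDef.const (D := D) False).congr fun j T => ⟨?_, False.elim⟩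
      rw [exists_fin_two]
      rintro ⟨_, _, hx, -, x, hU, rfl, -⟩
      obtain ⟨i, hi, -⟩ := (crd_isPoint C).1 hx
      rw [h] at hi
      exact nomatch hi
    · by_cases h1 : o 1 = none
      · refine ((fdef_value hα (C.chart i) U a).comp
          (Sum.elim (fun l => (0, Sum.inl ⟨i, l⟩)) (fun _ => (1, Sum.inr ())))).congr fun j T => ?_
        refine exists_fin_two.trans ?_
        constructor
        · rintro ⟨_, _, hx, hy, x, hU, rfl, rfl⟩
          obtain ⟨i', hi, hx⟩ := (crd_isPoint C).1 hx
          obtain rfl := Option.some.inj (h.symm.trans hi)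
          exact ⟨x, hx, hU, ((crd_isScalar C).1 hy).2.symm⟩
        · rintro ⟨x, hx, hU, hv⟩
          exact ⟨_, _, (crd_isPoint C).2 ⟨i, h, hx⟩, (crd_isScalar C).2 ⟨h1, hv.symm⟩,
            x, hU, rfl, rfl⟩
      · refine (FDef.const (D := D) False).congr fun j T => ⟨?_, False.elim⟩
        rw [exists_fin_two]
        rintro ⟨_, _, -, hy, x, hU, rfl, rfl⟩
        exact h1 ((crd_isScalar C).1 hy).1

end Charts

/-- The two-sorted structures of `X` are uniformly interpreted in every family of structures in
which the fields and the constants of `X` are definable. -/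
theorem exists_interpretation_model (C : Charts X)
    (hα : ∀ c, UDef L' 𝔐 (fun j (v : Unit → 𝔐 j) => v () = D.emb j (α j c))) :
    ∃ (I : Interpretation (lang X.obj) L') (π : ∀ j, I.Dom (𝔐 j) → Model X.obj (α j)),
      (∀ j, I.IsRealizedBy (π j)) ∧
      ∀ h : ∀ j, 𝔐 j → Model X.obj (α j), (∀ o, UDef L' 𝔐 (fun j (v : Unit ⊕ C.Coord → 𝔐 j) =>
        ∃ t : C.Coord → F j, (∀ l, v (Sum.inr l) = D.emb j (t l)) ∧
          C.Crd (α j) o t (h j (v (Sum.inl ()))))) →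
        ∃ γ : L'.Formula (Unit ⊕ Fin I.dim), ∀ j, Interpretation.Tracks (π j) γ (h j) :=
  exists_interpretation (D := D) (Crd := fun j => C.Crd (α j)) (fun _ => C.crd_unique)
    (fun _ => C.exists_crd) (C.fdef_eq hα) (C.fdef_relMap hα)

end Charts

/-! ### The interpretation determined by a morphism, and its quotient form. -/

section Pullback

variable {k : Type u} [Field k]

/-- An algebraically closed extension field of `k` with an embedding of the constants of `X`. -/
structure ConstEmb (X : KScheme k) where
  /-- the field -/
  F : Type u
  [field : Field F]
  [isAlgClosed : IsAlgClosed F]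
  [algebra : Algebra k F]
  /-- the embedding -/
  emb : constField X →ₐ[k] F

namespace ConstEmb

attribute [instance] ConstEmb.field ConstEmb.isAlgClosed ConstEmb.algebra

/-- The standard structure. -/
abbrev model {X : KScheme k} (j : ConstEmb X) : Type u := Model X j.emb

end ConstEmb

/-- The field sorts of the standard structures. -/
def modelDefField (X : KScheme k) :
    DefField k (lang X) (fun j : ConstEmb X => j.model) (fun j : ConstEmb X => j.F) where
  emb _ := Model.emb
  inj _ _ _ := Model.emb_inj.1
  range := (UDef.isScalar X ()).congr fun _ _ => Model.isScalar.symm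
  add := (UDef.isSum X 0 1 2).congr fun _ _ => Model.isSum.symm
  mul := (UDef.isProd X 0 1 2).congr fun _ _ => Model.isProd.symm
  const c := (UDef.isConst X c ()).congr fun _ _ => Model.isConst.symm

theorem udef_constant (X : QProj k) (c : constField X.obj) :
    UDef (lang X.obj) (fun j : ConstEmb X.obj => j.model)
      (fun j (v : Unit → j.model) => v () = Model.emb (j.emb c)) := by
  obtain ⟨s, hs⟩ := exists_affine_cover X
  exact (UDef.ex (Q := fun (j : ConstEmb X.obj) v y =>
    ∃ V ∈ s, IsValue V (constRes X.obj V c) y (v ()))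
    (UDef.finsetEx s fun V _ => UDef.isValue V _ (Sum.inr ()) (Sum.inl ()))).congr fun j v =>
      (Frame.constValue_std hs).symm

variable {X Y : QProj k} (f : Y ⟶ X)

/-- The map of structures induced by a morphism. -/
abbrev ConstEmb.pull (j : ConstEmb Y.obj) : j.model → Model X.obj (j.emb.comp (constMap f.hom)) :=
  modelMap (VPoint.map f.hom rfl)

theorem modelMap_eq_emb {F : Type u} [Field F] [Algebra k F] {α : constField X.obj →ₐ[k] F}
    {β : constField Y.obj →ₐ[k] F} {φ : VPoint Y.obj β → VPoint X.obj α} {x : Model Y.obj β} {t : F} :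
    modelMap φ x = Model.emb t ↔ x = Model.emb t := by
  rcases x with x | s
  · exact ⟨fun h => (Model.ofPoint_ne_emb h).elim, fun h => (Model.ofPoint_ne_emb h).elim⟩
  · exact Model.emb_inj.trans Model.emb_inj.symm

theorem modelMap_eq_ofPoint {F : Type u} [Field F] [Algebra k F] {α : constField X.obj →ₐ[k] F}
    {β : constField Y.obj →ₐ[k] F} {φ : VPoint Y.obj β → VPoint X.obj α} {x : Model Y.obj β}
    {y : VPoint X.obj α} :
    modelMap φ x = Model.ofPoint y ↔ ∃ p, x = Model.ofPoint p ∧ φ p = y := by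
  rcases x with x | s
  · exact ⟨fun h => ⟨x, rfl, Model.ofPoint_inj.1 h⟩, fun ⟨p, h, h'⟩ => by
      obtain rfl := Model.ofPoint_inj.1 h
      exact congrArg Model.ofPoint h'⟩
  · exact ⟨fun h => (Model.ofPoint_ne_emb h.symm).elim,
      fun ⟨p, h, _⟩ => (Model.ofPoint_ne_emb h.symm).elim⟩

/-- The preimage of `U` is a finite union of affine open sets of `Y`, all of them named in the
language of `Y`. -/
theorem udef_pull_isMem (U : X.obj.left.affineOpens) :
    UDef (lang Y.obj) (fun j : ConstEmb Y.obj => j.model)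
      (fun j (v : Unit → j.model) => IsMem U (j.pull f (v ()))) := by
  obtain ⟨s, hs, hcov⟩ := exists_finite_affine_cover Y (f.hom.left ⁻¹ᵁ U)
  refine (UDef.finsetEx s fun V _ => UDef.isMem V ()).congr fun j v => ?_
  simp only [Model.isMem, modelMap_eq_ofPoint]
  constructor
  · rintro ⟨_, ⟨p, hp, rfl⟩, hU⟩
    obtain ⟨V, hV, hpV⟩ := hcov p.pt.center ((p.pt.mem_iff _).1 hU)
    exact ⟨V, hV, p, hp, (p.pt.mem_iff _).2 hpV⟩
  · rintro ⟨V, hV, p, hp, hpV⟩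
    exact ⟨_, ⟨p, hp, rfl⟩, hpV.mono (hs V hV)⟩

theorem udef_pull_isValue (U : X.obj.left.affineOpens) (a : Γ(X.obj.left, U)) :
    UDef (lang Y.obj) (fun j : ConstEmb Y.obj => j.model)
      (fun j (v : Fin 2 → j.model) => IsValue U a (j.pull f (v 0)) (j.pull f (v 1))) := by
  obtain ⟨s, hs, hcov⟩ := exists_finite_affine_cover Y (f.hom.left ⁻¹ᵁ U)
  refine (UDef.finEx fun V : s => UDef.isValue V.1
    ((f.hom.left.appLE U V.1 (hs V V.2)).hom a) 0 1).congr fun j v => ?_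
  simp only [Model.isValue, modelMap_eq_ofPoint, modelMap_eq_emb]
  constructor
  · rintro ⟨_, hU, ⟨p, hp, rfl⟩, hv⟩
    obtain ⟨V, hV, hpV⟩ := hcov p.pt.center ((p.pt.mem_iff _).1 hU)
    refine ⟨⟨V, hV⟩, p, (p.pt.mem_iff _).2 hpV, hp, hv.trans (congrArg Model.emb ?_)⟩
    exact Point.value_map f.hom p.pt U V (hs V hV) _ hU a
  · rintro ⟨V, p, hpV, hp, hv⟩
    have hU : (p.map f.hom (rfl : j.emb.comp (constMap f.hom) = _)).pt.Mem U :=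
      hpV.mono (hs V V.2)
    refine ⟨_, hU, ⟨p, hp, rfl⟩, hv.trans (congrArg Model.emb ?_)⟩
    exact (Point.value_map f.hom p.pt U V (hs V V.2) hpV hU a).symm

theorem udef_pull_relMap {n : ℕ} (R : (lang X.obj).Relations n) :
    UDef (lang Y.obj) (fun j : ConstEmb Y.obj => j.model)
      (fun j (v : Fin n → j.model) => Structure.RelMap R (fun i => j.pull f (v i))) := by
  cases R with
  | sortX =>
    refine (UDef.isPoint Y.obj 0).congr fun j v => ?_
    refine Iff.trans (b := ∃ y, j.pull f (v 0) = Model.ofPoint y) Iff.rfl ?_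
    simp only [modelMap_eq_ofPoint, Model.isPoint]
    exact ⟨fun ⟨y, p, hp, _⟩ => ⟨p, hp⟩, fun ⟨p, hp⟩ => ⟨_, p, hp, rfl⟩⟩
  | sortF =>
    refine (UDef.isScalar Y.obj 0).congr fun j v => ?_
    refine Iff.trans (b := ∃ y, j.pull f (v 0) = Model.emb y) Iff.rfl ?_
    simp only [modelMap_eq_emb, Model.isScalar]
  | add =>
    refine (UDef.isSum Y.obj 0 1 2).congr fun j v => ?_
    refine Iff.trans (b := ∃ s t, j.pull f (v 0) = Model.emb s ∧ j.pull f (v 1) = Model.emb t ∧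
      j.pull f (v 2) = Model.emb (s + t)) Iff.rfl ?_
    simp only [modelMap_eq_emb, Model.isSum]
  | mul =>
    refine (UDef.isProd Y.obj 0 1 2).congr fun j v => ?_
    refine Iff.trans (b := ∃ s t, j.pull f (v 0) = Model.emb s ∧ j.pull f (v 1) = Model.emb t ∧
      j.pull f (v 2) = Model.emb (s * t)) Iff.rfl ?_
    simp only [modelMap_eq_emb, Model.isProd]
  | const c =>
    refine (UDef.isConst Y.obj c 0).congr fun j v => ?_
    refine Iff.trans (b := j.pull f (v 0) = Model.emb (algebraMap k j.F c)) Iff.rfl ?_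
    simp only [modelMap_eq_emb, Model.isConst]
  | mem U => exact ((udef_pull_isMem f U).comp fun _ => 0).congr fun j v => Iff.rfl
  | fn U a => exact (udef_pull_isValue f U a).congr fun j v => Iff.rfl

theorem Model.eq_ofPoint_iff {F : Type u} [Field F] [Algebra k F] {α : constField X.obj →ₐ[k] F}
    {c : CoordSystem X.obj} {t : Fin c.n → F} {z : Model X.obj α} :
    (∃ x, z = Model.ofPoint x ∧ HasCoords c t x) ↔
      IsMem c.U z ∧ ∀ l, IsValue c.U (c.gen l) z (Model.emb (t l)) := by
  simp only [Model.isMem, Model.isValue]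
  constructor
  · rintro ⟨x, rfl, hx, h⟩
    exact ⟨⟨x, rfl, hx⟩, fun l => ⟨x, hx, rfl, congrArg Model.emb (h l).symm⟩⟩
  · rintro ⟨⟨x, rfl, hx⟩, h⟩
    refine ⟨x, rfl, hx, fun l => ?_⟩
    obtain ⟨y, hy, hxy, hv⟩ := h l
    obtain rfl := Model.ofPoint_inj.1 hxy
    exact (Model.emb_inj.1 hv).symm

/-- Elements are equal if they are equal scalars or points with equal coordinates. -/
theorem Charts.eq_iff (C : Charts X) {F : Type u} [Field F] [Algebra k F]
    {α : constField X.obj →ₐ[k] F} {z z' : Model X.obj α} :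
    z = z' ↔ (∃ t, z = Model.emb t ∧ z' = Model.emb t) ∨
      ∃ i, IsMem (C.chart i).U z ∧ IsMem (C.chart i).U z' ∧
        ∀ l, ∃ t : F, IsValue (C.chart i).U ((C.chart i).gen l) z (Model.emb t) ∧
          IsValue (C.chart i).U ((C.chart i).gen l) z' (Model.emb t) := by
  constructor
  · rintro rfl
    obtain ⟨o, t, h⟩ := C.exists_crd z
    rcases o with _ | i
    · exact Or.inl ⟨_, h, h⟩
    · obtain ⟨h1, h2⟩ := Model.eq_ofPoint_iff.1 h
      exact Or.inr ⟨i, h1, h1, fun l => ⟨_, h2 l, h2 l⟩⟩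
  · rintro (⟨t, rfl, rfl⟩ | ⟨i, h1, h2, h⟩)
    · rfl
    · choose t ht using h
      obtain ⟨x, rfl, hx⟩ := Model.eq_ofPoint_iff.2 ⟨h1, fun l => (ht l).1⟩
      obtain ⟨y, rfl, hy⟩ := Model.eq_ofPoint_iff.2 ⟨h2, fun l => (ht l).2⟩
      rw [hx.unique hy]

/-- A constant `c` of `X` has the value of the constant `constMap f.hom c` of `Y`, hence a value
definable over `Y`. This is all that the coordinate description of `X_α(F)` requires beyond the
field. -/
theorem exists_interprets : ∃ I γ, Interprets f.hom I γ := by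
  obtain ⟨C⟩ := nonempty_charts X
  obtain ⟨I, π, hπ, hI⟩ := exists_interpretation_model (D := modelDefField Y.obj)
    (α := fun j : ConstEmb Y.obj => j.emb.comp (constMap f.hom)) C
    (fun c => udef_constant Y (constMap f.hom c))
  obtain ⟨γ, hγ⟩ := hI (fun j => j.pull f) (fun o => by
    have hsc : UDef (lang Y.obj) (fun j : ConstEmb Y.obj => j.model)
        (fun j (v : Unit ⊕ C.Coord → j.model) => ∀ l, IsScalar Y.obj (v (Sum.inr l))) :=
      UDef.finAll fun l => UDef.isScalar Y.obj _
    rcases o with _ | i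
    · refine (hsc.and (UDef.eq (Sum.inl ()) (Sum.inr (Sum.inr ())))).congr fun j v => ?_
      constructor
      · rintro ⟨t, ht, h⟩
        refine ⟨fun l => ⟨t l, ht l⟩, ?_⟩
        rw [ht]
        exact modelMap_eq_emb.1 h
      · rintro ⟨ht, h⟩
        choose t ht using ht
        refine ⟨t, ht, ?_⟩
        exact modelMap_eq_emb.2 (h.trans (ht _))
    · refine (hsc.and (((udef_pull_isMem f (C.chart i).U).comp fun _ => Sum.inl ()).and
        (UDef.finAll fun l => (udef_pull_isValue f (C.chart i).U ((C.chart i).gen l)).comp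
          ![Sum.inl (), Sum.inr (Sum.inl ⟨i, l⟩)]))).congr fun j v => ?_
      constructor
      · rintro ⟨t, ht, h⟩
        refine ⟨fun l => ⟨t l, ht l⟩, (Model.eq_ofPoint_iff.1 h).1, fun l => ?_⟩
        have := (Model.eq_ofPoint_iff.1 h).2 l
        have h2 : j.pull f (v (Sum.inr (Sum.inl ⟨i, l⟩))) = Model.emb (t (Sum.inl ⟨i, l⟩)) := by
          exact modelMap_eq_emb.2 (ht _)
        rwa [← h2] at this
      · rintro ⟨ht, hm, h⟩
        choose t ht using ht
        refine ⟨t, ht, Model.eq_ofPoint_iff.2 ⟨hm, fun l => ?_⟩⟩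
        have h2 : j.pull f (v (Sum.inr (Sum.inl ⟨i, l⟩))) = Model.emb (t (Sum.inl ⟨i, l⟩)) := by
          exact modelMap_eq_emb.2 (ht _)
        rw [← h2]
        exact h l)
  refine ⟨I, γ, fun F _ _ _ α β h => ?_⟩
  subst h
  exact ⟨π ⟨F, β⟩, hπ ⟨F, β⟩, hγ ⟨F, β⟩⟩

/-- All relations are pulled back along the induced map of structures. Its kernel is definable since
equality in `X_α(F)` reduces, by `Charts.eq_iff`, to charts and scalars, and the map fixes scalars.
Surjectivity serves only to reach every element. -/
theorem exists_quotient_interpretation :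
    ∃ (ε : (lang Y.obj).Formula (Fin 1 ⊕ Fin 1))
      (ρ : ∀ {m : ℕ}, (lang X.obj).Relations m → (lang Y.obj).Formula (Fin m × Fin 1)),
      ∀ (F : Type u) [Field F] [IsAlgClosed F] [Algebra k F]
        (α : constField X.obj →ₐ[k] F) (β : constField Y.obj →ₐ[k] F)
        (h : β.comp (constMap f.hom) = α), Function.Surjective (VPoint.map f.hom h) →
        Interpretation.IsRealizedBy (L := lang X.obj) (L' := lang Y.obj)
          { dim := 1, dom := ⊤, eqv := ε, rel := ρ }
          (fun d : Interpretation.Dom _ (Model Y.obj β) =>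
            modelMap (VPoint.map f.hom h) (d.1 0)) := by
  obtain ⟨C⟩ := nonempty_charts X
  have hε : UDef (lang Y.obj) (fun j : ConstEmb Y.obj => j.model)
      (fun j (v : Fin 1 ⊕ Fin 1 → j.model) => j.pull f (v (Sum.inl 0)) = j.pull f (v (Sum.inr 0))) := by
    refine (UDef.or (UDef.and (UDef.isScalar Y.obj (Sum.inl 0)) (UDef.eq (Sum.inl 0) (Sum.inr 0)))
      (UDef.finEx fun i => UDef.and ((udef_pull_isMem f (C.chart i).U).comp fun _ => Sum.inl 0)
        (UDef.and ((udef_pull_isMem f (C.chart i).U).comp fun _ => Sum.inr 0)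
        (UDef.finAll fun l => UDef.ex (Q := fun (j : ConstEmb Y.obj) v t => IsScalar Y.obj t ∧
          IsValue (C.chart i).U ((C.chart i).gen l) (j.pull f (v (Sum.inl 0))) (j.pull f t) ∧
          IsValue (C.chart i).U ((C.chart i).gen l) (j.pull f (v (Sum.inr 0))) (j.pull f t))
          (UDef.and (UDef.isScalar Y.obj (Sum.inr ()))
          (UDef.and ((udef_pull_isValue f (C.chart i).U ((C.chart i).gen l)).comp
            ![Sum.inl (Sum.inl 0), Sum.inr ()])
          ((udef_pull_isValue f (C.chart i).U ((C.chart i).gen l)).comp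
            ![Sum.inl (Sum.inr 0), Sum.inr ()]))))))).congr fun j v => ?_
    refine C.eq_iff.trans (or_congr ?_ (exists_congr fun i => and_congr_right fun _ =>
      and_congr_right fun _ => forall_congr' fun l => ?_))
    · simp only [modelMap_eq_emb, Model.isScalar]
      exact ⟨fun ⟨t, h, h'⟩ => ⟨⟨t, h⟩, h.trans h'.symm⟩, fun ⟨⟨t, h⟩, h'⟩ => ⟨t, h, h' ▸ h⟩⟩
    · constructor
      · rintro ⟨t, h⟩
        exact ⟨Model.emb t, ⟨t, rfl⟩, h⟩
      · rintro ⟨_, ⟨t, rfl⟩, h⟩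
        exact ⟨t, h⟩
  refine ⟨hε.choose, fun R => (((udef_pull_relMap f R).comp fun i => (i, (0 : Fin 1)))).choose, ?_⟩
  intro F _ _ _ α β h hsurj
  subst h
  refine ⟨?_, fun d e => hε.choose_spec ⟨F, β⟩ _, fun R d =>
    ((udef_pull_relMap f R).comp fun i => (i, (0 : Fin 1))).choose_spec ⟨F, β⟩ _⟩
  rintro (x | t)
  · obtain ⟨y, rfl⟩ := hsurj x
    exact ⟨⟨fun _ => Model.ofPoint y, Formula.realize_top.2 trivial⟩, rfl⟩
  · exact ⟨⟨fun _ => Model.emb t, Formula.realize_top.2 trivial⟩, rfl⟩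

end Pullback

/-! ### Translation of formulas along an interpretation. -/

section Translation

universe w
variable {L L' : FirstOrder.Language.{u, u}} {J : Type w} {𝔐 N : J → Type u}
  [∀ j, L'.Structure (𝔐 j)] [∀ j, L.Structure (N j)] {I : Interpretation L L'}
  {π : ∀ j, I.Dom (𝔐 j) → N j} {ι κ : Type}

/-- The predicate on tuples of tuples obtained from `P` by means of `π`. -/
def Pulled (π : ∀ j, I.Dom (𝔐 j) → N j) (P : ∀ j, (ι → N j) → Prop) (j : J)
    (v : ι × Fin I.dim → 𝔐 j) : Prop :=
  ∃ hd : ∀ i, I.dom.Realize (fun l => v (i, l)), P j (fun i => π j ⟨_, hd i⟩)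

theorem udef_dom [Finite ι] : UDef L' 𝔐 (fun j (v : ι × Fin I.dim → 𝔐 j) =>
    ∀ i, I.dom.Realize (fun l => v (i, l))) :=
  UDef.finAll fun i => UDef.comp (P := fun _ v => I.dom.Realize v) ⟨I.dom, fun _ _ => Iff.rfl⟩
    fun l => (i, l)

theorem exists_var_of_term [L.IsRelational] {α : Type} (t : L.Term α) : ∃ a, t = var a := by
  cases t with
  | var a => exact ⟨a, rfl⟩
  | func f _ => exact isEmptyElim f

theorem exists_prop_iff {p r : Prop} {q : p → Prop} (h : ∀ hp, q hp ↔ r) :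
    (∃ hp : p, q hp) ↔ p ∧ r :=
  ⟨fun ⟨hp, hq⟩ => ⟨hp, (h hp).1 hq⟩, fun ⟨hp, hr⟩ => ⟨hp, (h hp).2 hr⟩⟩

/-- Induction on formulas: equality becomes `I.eqv`, a basic relation becomes its defining formula,
and quantifiers are relativized to the domain of the interpretation. The result is the same formula
for all `j`. -/
theorem udef_pulled_realize [L.IsRelational] [Finite ι] (hπ : ∀ j, I.IsRealizedBy (π j)) {n : ℕ}
    (φ : L.BoundedFormula ι n) : UDef L' 𝔐 (Pulled π (fun j (w : ι ⊕ Fin n → N j) =>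
      φ.Realize (fun i => w (Sum.inl i)) (fun i => w (Sum.inr i)))) := by
  induction φ with
  | falsum => exact (UDef.const False).congr fun j v => ⟨fun ⟨_, h⟩ => h, False.elim⟩
  | @equal n t₁ t₂ =>
    obtain ⟨a, rfl⟩ := exists_var_of_term t₁
    obtain ⟨b, rfl⟩ := exists_var_of_term t₂
    have h : UDef L' 𝔐 (fun j (v : Fin I.dim ⊕ Fin I.dim → 𝔐 j) => I.eqv.Realize v) :=
      ⟨I.eqv, fun _ _ => Iff.rfl⟩
    refine (udef_dom.and (h.comp (Sum.elim (fun l => (a, l)) (fun l => (b, l))))).congr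
      fun j v => exists_prop_iff fun hd => ?_
    refine Iff.trans ?_ (((hπ j).eqv_iff ⟨_, hd a⟩ ⟨_, hd b⟩).symm.trans (iff_of_eq (congrArg _ ?_)))
    · rcases a with a | a <;> rcases b with b | b <;> rfl
    · ext l
      rcases l with l | l <;> rfl
  | @rel n l R ts =>
    choose g hg using fun i => exists_var_of_term (ts i)
    have h : UDef L' 𝔐 (fun j (v : Fin l × Fin I.dim → 𝔐 j) => (I.rel R).Realize v) :=
      ⟨I.rel R, fun _ _ => Iff.rfl⟩
    refine (udef_dom.and (h.comp (fun i => (g i.1, i.2)))).congr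
      fun j v => exists_prop_iff fun hd => ?_
    refine Iff.trans ?_ ((hπ j).rel_iff R fun i => ⟨_, hd (g i)⟩).symm
    refine iff_of_eq (congrArg (Structure.RelMap R) (funext fun i => ?_))
    rw [hg]
    rcases g i with a | a <;> rfl
  | @imp n φ ψ hφ hψ =>
    refine (udef_dom.and (hφ.imp hψ)).congr fun j v => ?_
    constructor
    · rintro ⟨hd, h⟩
      exact ⟨hd, fun ⟨_, h'⟩ => ⟨hd, h h'⟩⟩
    · rintro ⟨hd, h⟩
      exact ⟨hd, fun h' => (h ⟨hd, h'⟩).2⟩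
  | @all n φ hφ =>
    -- The quantified variable is the last one; its coordinates are moved to a separate block, over
    -- which one can quantify.
    have h1 := hφ.comp (fun al : (ι ⊕ Fin (n + 1)) × Fin I.dim =>
      (Sum.elim (fun i => Sum.inl (Sum.inl i, al.2))
        (Fin.lastCases (Sum.inr al.2) (fun q => Sum.inl (Sum.inr q, al.2))) al.1 :
          ((ι ⊕ Fin n) × Fin I.dim) ⊕ Fin I.dim))
    have h2 : UDef L' 𝔐 (fun j (v : Fin I.dim → 𝔐 j) => I.dom.Realize v) :=
      ⟨I.dom, fun _ _ => Iff.rfl⟩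
    have h3 : UDef L' 𝔐 (fun j (v : (ι ⊕ Fin n) × Fin I.dim → 𝔐 j) => ∀ t, I.dom.Realize t →
        Pulled π (fun j (w : ι ⊕ Fin (n + 1) → N j) =>
          φ.Realize (fun i => w (Sum.inl i)) (fun i => w (Sum.inr i))) j
          (fun al => Sum.elim (fun i => v (Sum.inl i, al.2))
            (Fin.lastCases (t al.2) (fun q => v (Sum.inr q, al.2))) al.1)) := by
      refine UDef.allTuple ((h2.comp Sum.inr).imp (h1.congr fun j v => iff_of_eq (congrArg _ ?_)))
      ext ⟨i | i, l⟩
      · rfl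
      · induction i using Fin.lastCases with
        | last => simp only [Sum.elim_inr, Fin.lastCases_last]
        | cast i => simp only [Sum.elim_inr, Fin.lastCases_castSucc]
    refine (udef_dom.and h3).congr fun j v => exists_prop_iff fun hd => ?_
    refine BoundedFormula.realize_all.trans ?_
    have key : ∀ d : I.Dom (𝔐 j), φ.Realize (fun i => π j ⟨_, hd (Sum.inl i)⟩)
          (Fin.snoc (fun q => π j ⟨_, hd (Sum.inr q)⟩) (π j d) : Fin (n + 1) → N j) ↔
        Pulled π (fun j (w : ι ⊕ Fin (n + 1) → N j) =>
          φ.Realize (fun i => w (Sum.inl i)) (fun i => w (Sum.inr i))) j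
          (fun al => Sum.elim (fun i => v (Sum.inl i, al.2))
            (Fin.lastCases (d.1 al.2) (fun q => v (Sum.inr q, al.2))) al.1) := by
      intro d
      have hd' : ∀ a : ι ⊕ Fin (n + 1), ∃ h : I.dom.Realize (fun l => (Sum.elim
          (fun i => v (Sum.inl i, l)) (Fin.lastCases (d.1 l) (fun q => v (Sum.inr q, l))) a : 𝔐 j)),
          π j ⟨_, h⟩ = Sum.elim (fun i => π j ⟨_, hd (Sum.inl i)⟩)
            (Fin.snoc (fun q => π j ⟨_, hd (Sum.inr q)⟩) (π j d) : Fin (n + 1) → N j) a := by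
        rintro (i | i)
        · exact ⟨hd (Sum.inl i), rfl⟩
        · induction i using Fin.lastCases with
          | last =>
            simp only [Sum.elim_inr, Fin.lastCases_last, Fin.snoc_last]
            exact ⟨d.2, trivial⟩
          | cast i =>
            simp only [Sum.elim_inr, Fin.lastCases_castSucc, Fin.snoc_castSucc]
            exact ⟨hd (Sum.inr i), trivial⟩
      choose hd1 hd2 using hd'
      constructor
      · intro h
        refine ⟨hd1, ?_⟩
        simp only [hd2]
        exact h
      · rintro ⟨_, h⟩
        simp only [hd2] at h
        exact h
    constructor
    · intro h t ht
      exact (key ⟨t, ht⟩).1 (h _)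
    · intro h a
      obtain ⟨d, rfl⟩ := (hπ j).surjective a
      exact (key d).2 (h d.1 d.2)

theorem UDef.pulled [L.IsRelational] [Finite ι] (hπ : ∀ j, I.IsRealizedBy (π j))
    {P : ∀ j, (ι → N j) → Prop} (hP : UDef L N P) : UDef L' 𝔐 (Pulled π P) := by
  obtain ⟨φ, hφ⟩ := hP
  refine ((udef_pulled_realize hπ φ).comp
    fun al : (ι ⊕ Fin 0) × Fin I.dim => (Sum.elim id Fin.elim0 al.1, al.2)).congr fun j v => ?_
  constructor
  · rintro ⟨hd, h⟩
    refine ⟨?_, ?_⟩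
    · rintro (i | i)
      · exact hd i
      · exact i.elim0
    · have := (hφ j _).2 h
      exact (iff_of_eq (congrArg (BoundedFormula.Realize φ _) (Subsingleton.elim _ _))).1 this
  · rintro ⟨hd, h⟩
    refine ⟨fun i => hd (Sum.inl i), (hφ j _).1 ?_⟩
    exact (iff_of_eq (congrArg (BoundedFormula.Realize φ _) (Subsingleton.elim _ _))).1 h

/-- The mixed version of `Pulled`, with some variables treated by means of `h`. -/
theorem UDef.pulled_tracked [L.IsRelational] [Finite ι] [Finite κ] (hπ : ∀ j, I.IsRealizedBy (π j))
    {γ : L'.Formula (Unit ⊕ Fin I.dim)} {h : ∀ j, 𝔐 j → N j}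
    (hγ : ∀ j, Interpretation.Tracks (π j) γ (h j))
    {P : ∀ j, (ι ⊕ κ → N j) → Prop} (hP : UDef L N P) :
    UDef L' 𝔐 (fun j (v : (ι × Fin I.dim) ⊕ κ → 𝔐 j) =>
      ∃ hd : ∀ i, I.dom.Realize (fun l => v (Sum.inl (i, l))),
        P j (Sum.elim (fun i => π j ⟨_, hd i⟩) (fun i => h j (v (Sum.inr i))))) := by
  have h1 := hP.pulled hπ
  have h2 : UDef L' 𝔐 (fun j (v : Unit ⊕ Fin I.dim → 𝔐 j) => γ.Realize v) := ⟨γ, fun _ _ => Iff.rfl⟩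
  -- A variable `x` treated through `h` is replaced by some tuple `e` representing `h x`, as
  -- recognized by `γ`.
  refine (UDef.exTuple (κ := κ × Fin I.dim) (Q := fun j v e =>
    Pulled π P j (fun al => Sum.elim (fun i => v (Sum.inl (i, al.2))) (fun i => e (i, al.2)) al.1) ∧
      ∀ i, γ.Realize (Sum.elim (fun _ => v (Sum.inr i)) (fun l => e (i, l)))) ?_).congr fun j v => ?_
  · refine ((h1.comp fun al => Sum.elim (fun i => Sum.inl (Sum.inl (i, al.2)))
      (fun i => Sum.inr (i, al.2)) al.1).and (UDef.finAll fun i => h2.comp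
        (Sum.elim (fun _ => Sum.inl (Sum.inr i)) (fun l => Sum.inr (i, l))))).congr fun j v => ?_
    refine and_congr (iff_of_eq (congrArg _ ?_)) (forall_congr' fun i => iff_of_eq (congrArg _ ?_))
    · ext ⟨a | a, l⟩ <;> rfl
    · ext (a | a) <;> rfl
  · constructor
    · rintro ⟨hd, hP'⟩
      choose d hd' using fun i => (hπ j).surjective (h j (v (Sum.inr i)))
      refine ⟨fun al => (d al.1).1 al.2, ⟨?_, ?_⟩, fun i => (hγ j _ _).2 (hd' i)⟩
      · rintro (i | i)
        · exact hd i
        · exact (d i).2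
      · refine (iff_of_eq (congrArg _ ?_)).1 hP'
        ext (i | i)
        · rfl
        · exact (hd' i).symm
    · rintro ⟨e, ⟨hd, hP'⟩, he⟩
      refine ⟨fun i => hd (Sum.inl i), (iff_of_eq (congrArg _ ?_)).1 hP'⟩
      ext (i | i)
      · rfl
      · exact (hγ j _ ⟨_, hd (Sum.inr i)⟩).1 (he i)

end Translation

/-! ### Automorphisms induced along an interpretation. -/

section Automorphisms

variable {L L' : FirstOrder.Language.{u, u}} {M N : Type u} [L'.Structure M]
  {I : Interpretation L L'} {π : I.Dom M → N}

/-- The action of an automorphism on the domain of an interpretation. -/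
def domMap (σ : M ≃[L'] M) (d : I.Dom M) : I.Dom M :=
  ⟨σ ∘ d.1, (StrongHomClass.realize_formula σ I.dom).2 d.2⟩

theorem Interpretation.Tracks.map_domMap {γ : L'.Formula (Unit ⊕ Fin I.dim)} {h : M → N}
    (hγ : Interpretation.Tracks π γ h) (σ : M ≃[L'] M) {d : I.Dom M} {x : M} (hd : π d = h x) :
    π (domMap σ d) = h (σ x) := by
  refine (hγ _ _).1 ?_
  have := (StrongHomClass.realize_formula σ γ).2 ((hγ x d).2 hd)
  refine (iff_of_eq (congrArg _ ?_)).1 this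
  ext (i | i) <;> rfl

variable [L.Structure N]

theorem domMap_eq_iff (hπ : I.IsRealizedBy π) (σ : M ≃[L'] M) (d e : I.Dom M) :
    π (domMap σ d) = π (domMap σ e) ↔ π d = π e := by
  rw [← hπ.eqv_iff, ← hπ.eqv_iff]
  refine Iff.trans (iff_of_eq (congrArg _ ?_)) (StrongHomClass.realize_formula σ I.eqv)
  ext (i | i) <;> rfl

/-- An automorphism preserves the definable domain, equivalence relation and basic relations, so it
acts on the quotient. The action is computed with a section `s` of `π`, whose choice is immaterial
by `domMap_eq_iff`. -/
theorem exists_induced_aut [L.IsRelational] (hπ : I.IsRealizedBy π) (σ : M ≃[L'] M) :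
    ∃ τ : N ≃[L] N, ∀ d, τ (π d) = π (domMap σ d) := by
  choose s hs using hπ.surjective
  have h : ∀ (σ : M ≃[L'] M) d, π (domMap σ (s (π d))) = π (domMap σ d) := fun σ d =>
    (domMap_eq_iff hπ σ _ _).2 (hs _)
  have hinv : ∀ (σ σ' : M ≃[L'] M), (∀ x, σ (σ' x) = x) → ∀ z,
      π (domMap σ (s (π (domMap σ' (s z))))) = z := by
    intro σ σ' hσ z
    rw [h]
    have : domMap σ (domMap σ' (s z)) = s z := Subtype.ext (funext fun i => hσ _)
    rw [this, hs]
  refine ⟨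
    { toFun := fun z => π (domMap σ (s z))
      invFun := fun z => π (domMap σ.symm (s z))
      left_inv := hinv _ _ σ.symm_apply_apply
      right_inv := hinv _ _ σ.apply_symm_apply
      map_fun' := fun f => isEmptyElim f
      map_rel' := fun R v => ?_ }, fun d => h σ d⟩
  have h1 : v = fun i => π (s (v i)) := funext fun i => (hs _).symm
  conv_rhs => rw [h1]
  refine Iff.trans ?_ (hπ.rel_iff R _)
  rw [← StrongHomClass.realize_formula σ (I.rel R)]
  exact (hπ.rel_iff R fun i => domMap σ (s (v i))).symm

end Automorphisms

/-! ### Definable comparison of elements through their scalar coordinates. -/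

section Comparison

universe w
variable {k : Type u} [Field k]

instance (X : KScheme k) : (lang X).IsRelational := fun _ => inferInstanceAs (IsEmpty PEmpty)

variable {L' : FirstOrder.Language.{u, u}} {J : Type w} {𝔐 : J → Type u}
  [∀ j, L'.Structure (𝔐 j)] {F : J → Type u} [∀ j, Field (F j)] [∀ j, Algebra k (F j)]
  {D : DefField k L' 𝔐 F} {X : QProj k} {α : ∀ j, constField X.obj →ₐ[k] F j} {ι κ : Type}

/-- Restriction of a definable family of fields to a subfamily. -/
def DefField.restrict {J' : Type*} (D : DefField k L' 𝔐 F) (r : J' → J) :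
    DefField k L' (fun j => 𝔐 (r j)) (fun j => F (r j)) where
  emb j := D.emb (r j)
  inj j := D.inj (r j)
  range := UDef.restrict r D.range
  add := UDef.restrict r D.add
  mul := UDef.restrict r D.mul
  const c := UDef.restrict r (D.const c)

/-- A correspondence between tuples of `𝔐` and elements of models of `T^X` under which definable
relations between an element and a scalar correspond to definable relations. -/
def Traceable (D : DefField k L' 𝔐 F) (α : ∀ j, constField X.obj →ₐ[k] F j)
    (G : ∀ j, (ι → 𝔐 j) → Model X.obj (α j) → Prop) : Prop :=
  ∀ P : ∀ j, Model X.obj (α j) → Model X.obj (α j) → Prop,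
    UDef (lang X.obj) (fun j => Model X.obj (α j)) (fun j w => P j (w (Sum.inl ())) (w (Sum.inr ()) : _)
      : ∀ j, (Unit ⊕ Unit → Model X.obj (α j)) → Prop) →
    UDef L' 𝔐 (fun j (v : ι ⊕ Unit → 𝔐 j) => ∃ z t, G j (fun i => v (Sum.inl i)) z ∧
      v (Sum.inr ()) = D.emb j t ∧ P j z (Model.emb t))

/-- Equality reduces to being the same scalar, or lying in a common chart with the same coordinates.
Each such clause relates one element to one scalar, and both correspondences use the same copy of
the field, so a common scalar links the two sides. -/
theorem Traceable.udef_eq {G : ∀ j, (ι → 𝔐 j) → Model X.obj (α j) → Prop}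
    {G' : ∀ j, (κ → 𝔐 j) → Model X.obj (α j) → Prop} (hG : Traceable D α G)
    (hG' : Traceable D α G') (h : ∀ j a z z', G j a z → G j a z' → z = z')
    (h' : ∀ j a z z', G' j a z → G' j a z' → z = z') :
    UDef L' 𝔐 (fun j (v : ι ⊕ κ → 𝔐 j) =>
      ∃ z, G j (fun i => v (Sum.inl i)) z ∧ G' j (fun i => v (Sum.inr i)) z) := by
  obtain ⟨C⟩ := nonempty_charts X
  have hboth : ∀ P : ∀ j, Model X.obj (α j) → Model X.obj (α j) → Prop,
      UDef (lang X.obj) (fun j => Model X.obj (α j)) (fun j w => P j (w (Sum.inl ())) (w (Sum.inr ()))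
        : ∀ j, (Unit ⊕ Unit → Model X.obj (α j)) → Prop) →
      UDef L' 𝔐 (fun j (v : ι ⊕ κ → 𝔐 j) => ∃ x : 𝔐 j,
        (∃ z t, G j (fun i => v (Sum.inl i)) z ∧ x = D.emb j t ∧ P j z (Model.emb t)) ∧
        (∃ z t, G' j (fun i => v (Sum.inr i)) z ∧ x = D.emb j t ∧ P j z (Model.emb t))) := by
    intro P hP
    refine UDef.ex (UDef.and ((hG P hP).comp (Sum.elim (fun i => Sum.inl (Sum.inl i)) Sum.inr))
      ((hG' P hP).comp (Sum.elim (fun i => Sum.inl (Sum.inr i)) Sum.inr)))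
  have h1 := UDef.or (hboth (fun _ z x => z = x) (UDef.eq _ _)) (UDef.finEx fun i : Fin C.num =>
    UDef.and (hboth (fun _ z _ => IsMem (C.chart i).U z) (UDef.isMem _ _))
      (UDef.finAll fun l => hboth (fun _ z x => IsValue (C.chart i).U ((C.chart i).gen l) z x)
        (UDef.isValue _ _ _ _)))
  refine h1.congr fun j v => ?_
  constructor
  · rintro ⟨z, hz, hz'⟩
    rcases C.eq_iff.1 (rfl : z = z) with ⟨t, rfl, -⟩ | ⟨i, hm, -, hv⟩
    · exact Or.inl ⟨D.emb j t, ⟨_, t, hz, rfl, rfl⟩, _, t, hz', rfl, rfl⟩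
    -- Membership in a chart involves no scalar; `0` fills the vacant place.
    · refine Or.inr ⟨i, ⟨D.emb j 0, ⟨_, 0, hz, rfl, hm⟩, _, 0, hz', rfl, hm⟩, fun l => ?_⟩
      obtain ⟨t, ht, -⟩ := hv l
      exact ⟨D.emb j t, ⟨_, t, hz, rfl, ht⟩, _, t, hz', rfl, ht⟩
  · rintro (⟨_, ⟨z, t, hz, rfl, rfl⟩, z', t', hz', htt, rfl⟩ | ⟨i, ⟨x, ⟨z, t, hz, rfl, hm⟩,
      z', t', hz', htt, hm'⟩, hv⟩)
    · rw [D.inj j htt] at hz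
      exact ⟨_, hz, hz'⟩
    · refine ⟨z, hz, ?_⟩
      have : z = z' := C.eq_iff.2 (Or.inr ⟨i, hm, hm', fun l => ?_⟩)
      · rwa [this]
      · obtain ⟨_, ⟨y, s, hy, rfl, hys⟩, y', s', hy', hss, hys'⟩ := hv l
        rw [← D.inj j hss, h' j _ _ _ hy' hz'] at hys'
        rw [h j _ _ _ hy hz] at hys
        exact ⟨s, hys, hys'⟩

/-- The formula `γ` tracks a map which identifies the field of the structure with that of the
interpreted one, so a true scalar may be used in place of its representing tuples. -/
theorem traceable_interpretation {I : Interpretation (lang X.obj) L'}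
    {π : ∀ j, I.Dom (𝔐 j) → Model X.obj (α j)} (hπ : ∀ j, I.IsRealizedBy (π j))
    {γ : L'.Formula (Unit ⊕ Fin I.dim)} {h : ∀ j, 𝔐 j → Model X.obj (α j)}
    (hγ : ∀ j, Interpretation.Tracks (π j) γ (h j))
    (hh : ∀ j t, h j (D.emb j t) = Model.emb t) :
    Traceable D α (fun j (d : Fin I.dim → 𝔐 j) z =>
      ∃ hd : I.dom.Realize d, π j ⟨d, hd⟩ = z) := by
  intro P hP
  refine (((UDef.pulled_tracked hπ hγ hP).comp (Sum.elim (fun il => Sum.inl il.2) Sum.inr)).and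
    (D.range.comp Sum.inr)).congr fun j v => ?_
  constructor
  · rintro ⟨_, t, ⟨hd, rfl⟩, ht, hP'⟩
    refine ⟨⟨fun _ => hd, ?_⟩, t, ht⟩
    change P j _ (h j (v (Sum.inr ())))
    rw [ht, hh]
    exact hP'
  · rintro ⟨⟨hd, hP'⟩, t, ht⟩
    refine ⟨_, t, ⟨hd (), rfl⟩, ht, ?_⟩
    change P j _ (h j (v (Sum.inr ()))) at hP'
    rw [show h j (v (Sum.inr ())) = Model.emb t from (congrArg (h j) ht).trans (hh j t)] at hP'
    exact hP'

end Comparison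

/-! ### Uniqueness of the interpretation up to definable bijection. -/

section Uniqueness

variable {k : Type u} [Field k] {X Y : QProj k} (f : Y ⟶ X)

/-- A standard structure together with two interpretations in it of the standard structure of `X`. -/
structure TrackedPair (I I' : Interpretation (lang X.obj) (lang Y.obj))
    (γ : (lang Y.obj).Formula (Unit ⊕ Fin I.dim)) (γ' : (lang Y.obj).Formula (Unit ⊕ Fin I'.dim)) where
  /-- the structure -/
  base : ConstEmb Y.obj
  /-- the first interpretation -/
  π : I.Dom base.model → Model X.obj (base.emb.comp (constMap f.hom))
  /-- the second interpretation -/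
  π' : I'.Dom base.model → Model X.obj (base.emb.comp (constMap f.hom))
  realized : I.IsRealizedBy π
  tracks : Interpretation.Tracks π γ (base.pull f)
  realized' : I'.IsRealizedBy π'
  tracks' : Interpretation.Tracks π' γ' (base.pull f)

/-- The comparison is applied to the family of all structures equipped with both interpretations,
which makes `θ` independent of the field, the embeddings, and of `π` and `π'`. -/
theorem exists_comparison (I : Interpretation (lang X.obj) (lang Y.obj)) (γ)
    (I' : Interpretation (lang X.obj) (lang Y.obj)) (γ') :
    ∃ θ : (lang Y.obj).Formula (Fin I.dim ⊕ Fin I'.dim),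
      ∀ (F : Type u) [Field F] [IsAlgClosed F] [Algebra k F]
        (α : constField X.obj →ₐ[k] F) (β : constField Y.obj →ₐ[k] F)
        (h : β.comp (constMap f.hom) = α)
        (π : I.Dom (Model Y.obj β) → Model X.obj α)
        (π' : I'.Dom (Model Y.obj β) → Model X.obj α),
        I.IsRealizedBy π → Interpretation.Tracks π γ (modelMap (VPoint.map f.hom h)) →
        I'.IsRealizedBy π' → Interpretation.Tracks π' γ' (modelMap (VPoint.map f.hom h)) →
        ∀ d d', θ.Realize (Sum.elim d.1 d'.1) ↔ π d = π' d' := by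
  let D := (modelDefField Y.obj).restrict (TrackedPair.base (f := f) (γ := γ) (γ' := γ'))
  obtain ⟨θ, hθ⟩ := (traceable_interpretation (D := D) (fun j => j.realized) (fun j => j.tracks)
    (fun _ _ => rfl)).udef_eq (traceable_interpretation (D := D) (fun j => j.realized')
      (fun j => j.tracks') (fun _ _ => rfl))
    (fun j a z z' ⟨_, h⟩ ⟨_, h'⟩ => h.symm.trans h') (fun j a z z' ⟨_, h⟩ ⟨_, h'⟩ => h.symm.trans h')
  refine ⟨θ, fun F _ _ _ α β h π π' h1 h2 h3 h4 d d' => ?_⟩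
  subst h
  refine (hθ ⟨⟨F, β⟩, π, π', h1, h2, h3, h4⟩ _).trans ?_
  constructor
  · rintro ⟨z, ⟨hd, rfl⟩, ⟨hd', h⟩⟩
    exact h.symm
  · intro h
    exact ⟨_, ⟨d.2, rfl⟩, d'.2, h.symm⟩

end Uniqueness

/-! ### Embedding-interpretations when the constants agree. -/

section Embedding

variable {k : Type u} [Field k] {X Y : QProj k} (f : Y ⟶ X)

/-- If `k^X → k^Y` is surjective, the structures of `Y` are uniformly interpreted in those of `X`. -/
theorem exists_reverse_interpretation (hf : Function.Surjective (constMap f.hom)) {F : Type u}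
    [Field F] [IsAlgClosed F] [Algebra k F] (β : constField Y.obj →ₐ[k] F) :
    ∃ (I : Interpretation (lang Y.obj) (lang X.obj)) (γ : _)
      (π : I.Dom (Model X.obj (β.comp (constMap f.hom))) → Model Y.obj β)
      (h : Model X.obj (β.comp (constMap f.hom)) → Model Y.obj β),
      I.IsRealizedBy π ∧ Interpretation.Tracks π γ h ∧ ∀ t, h (Model.emb t) = Model.emb t := by
  obtain ⟨C⟩ := nonempty_charts Y
  let r : Unit → ConstEmb X.obj := fun _ => ⟨F, β.comp (constMap f.hom)⟩
  let D := (modelDefField X.obj).restrict r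
  obtain ⟨I, π, hπ, hI⟩ := exists_interpretation_model (D := D)
    (α := fun _ : Unit => β) C (fun c => by
      -- Here surjectivity on constants enters: each constant of `Y` comes from one of `X`, so its
      -- value is definable in the structure of `X`.
      obtain ⟨c, rfl⟩ := hf c
      exact (udef_constant X c).restrict r)
  -- There need not be a map from points of `X` to points of `Y`, and only the effect on scalars
  -- matters. Points are sent to `0` arbitrarily.
  let h : Model X.obj (β.comp (constMap f.hom)) → Model Y.obj β := Sum.elim (fun _ => Model.emb 0)
    Model.emb
  obtain ⟨γ, hγ⟩ := hI (fun _ => h) (fun o => by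
    have hsc : UDef (lang X.obj) (fun _ : Unit => Model X.obj (β.comp (constMap f.hom)))
        (fun j v => ∀ l, IsScalar X.obj (v (Sum.inr l)) :
          ∀ j : Unit, (Unit ⊕ C.Coord → Model X.obj (β.comp (constMap f.hom))) → Prop) :=
      UDef.finAll fun l => UDef.isScalar X.obj _
    rcases o with _ | i
    · refine (hsc.and (((UDef.isPoint X.obj (Sum.inl ())).and
        (UDef.isConst X.obj 0 (Sum.inr (Sum.inr ())))).or
          (UDef.eq (Sum.inl ()) (Sum.inr (Sum.inr ()))))).congr fun j v => ?_
      constructor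
      · rintro ⟨t, ht, hz⟩
        refine ⟨fun l => ⟨t l, ht l⟩, ?_⟩
        rcases hx : v (Sum.inl ()) with x | s
        · refine Or.inl ⟨⟨x, rfl⟩, ?_⟩
          rw [hx] at hz
          rw [Model.isConst, map_zero, Model.emb_inj.1 hz]
          exact ht _
        · rw [hx] at hz
          refine Or.inr (Eq.trans ?_ (ht _).symm)
          exact congrArg Model.emb (Model.emb_inj.1 hz)
      · rintro ⟨ht, hz⟩
        choose t ht using fun l => Model.isScalar.1 (ht l)
        refine ⟨t, ht, ?_⟩
        rcases hz with ⟨hx, hz⟩ | hz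
        · obtain ⟨x, hx⟩ := Model.isPoint.1 hx
          rw [hx]
          rw [Model.isConst, map_zero, ht] at hz
          exact congrArg Model.emb (Model.emb_inj.1 hz).symm
        · rw [hz, ht]
          rfl
    · refine (UDef.const False).congr fun j v => ⟨?_, False.elim⟩
      rintro ⟨t, -, x, hx, -⟩
      rcases hv : v (Sum.inl ()) with y | s <;> rw [hv] at hx
      · exact Model.ofPoint_ne_emb hx.symm
      · exact Model.ofPoint_ne_emb hx.symm)
  exact ⟨I, γ, π (), h, hπ (), hγ (), fun _ => rfl⟩

section

variable {X : KScheme k} {M : Type u} [(lang X).Structure M] (σ : M ≃[lang X] M)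

theorem isScalar_map (x : M) : IsScalar X (σ x) ↔ IsScalar X x := by
  have h : ![σ x] = σ ∘ ![x] := by
    ext i; fin_cases i; rfl
  have h' := StrongHomClass.map_rel σ (VarRel.sortF : (lang X).Relations 1) ![x]
  rw [← h] at h'
  exact h'

theorem isMem_map {U : X.left.affineOpens} (x : M) : IsMem U (σ x) ↔ IsMem U x := by
  have h : ![σ x] = σ ∘ ![x] := by
    ext i; fin_cases i; rfl
  have h' := StrongHomClass.map_rel σ (VarRel.mem U : (lang X).Relations 1) ![x]
  rw [← h] at h'
  exact h'

theorem isValue_map {U : X.left.affineOpens} {a : Γ(X.left, U)} (x y : M) :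
    IsValue U a (σ x) (σ y) ↔ IsValue U a x y := by
  have h : ![σ x, σ y] = σ ∘ ![x, y] := by
    ext i; fin_cases i <;> rfl
  have h' := StrongHomClass.map_rel σ (VarRel.fn U a : (lang X).Relations 2) ![x, y]
  rw [← h] at h'
  exact h'

end

theorem definable_iff_udef {L : FirstOrder.Language.{u, u}} {M : Type u} [L.Structure M] {ι : Type}
    {S : Set (ι → M)} : (∅ : Set M).Definable L S ↔
      UDef L (fun _ : Unit => M) (fun _ v => v ∈ S) := by
  rw [Set.empty_definable_iff]
  exact exists_congr fun φ => ⟨fun h _ v => by rw [h]; rfl,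
    fun h => Set.ext fun v => (h () v).symm⟩

variable {f} {F : Type u} [Field F] [IsAlgClosed F] [Algebra k F] {β : constField Y.obj →ₐ[k] F}
  {I : Interpretation (lang X.obj) (lang Y.obj)} {γ : (lang Y.obj).Formula (Unit ⊕ Fin I.dim)}
  {π : I.Dom (Model Y.obj β) → Model X.obj (β.comp (constMap f.hom))}

/-- Composing with the reverse interpretation gives an interpretation of the structure of `X` in
itself, which the comparison of traceable correspondences identifies definably with the identity. A
relation definable over `Y` is translated back and then read through this identification. -/
theorem isEmbedding (hf : Function.Surjective (constMap f.hom)) (hπ : I.IsRealizedBy π)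
    (hγ : Interpretation.Tracks π γ (modelMap (VPoint.map f.hom rfl))) :
    Interpretation.IsEmbedding π := by
  obtain ⟨K, δ, ρ, h, hρ, hδ, hh⟩ := exists_reverse_interpretation f hf β
  intro m S hS
  rw [definable_iff_udef] at hS ⊢
  let rX : Unit → ConstEmb X.obj := fun _ => ⟨F, β.comp (constMap f.hom)⟩
  let rY : Unit → ConstEmb Y.obj := fun _ => ⟨F, β⟩
  let DX := (modelDefField X.obj).restrict rX
  let DY := (modelDefField Y.obj).restrict rY
  have h1 := hS.pulled (I := K) (π := fun _ => ρ) (fun _ => hρ)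
  have hid : Traceable (X := X) DX (fun _ : Unit => β.comp (constMap f.hom))
      (fun _ (a : Unit → Model X.obj (β.comp (constMap f.hom))) z => a () = z) := by
    intro P hP
    refine (hP.and ((UDef.isScalar X.obj (Sum.inr ())))).congr fun j v => ?_
    constructor
    · rintro ⟨z, t, hz, ht, hP'⟩
      refine ⟨?_, t, ht⟩
      rw [show v (Sum.inl ()) = z from hz, show v (Sum.inr ()) = Model.emb t from ht]
      exact hP'
    · rintro ⟨hP', t, ht⟩
      refine ⟨_, t, rfl, ht, ?_⟩
      rw [show v (Sum.inr ()) = Model.emb t from ht] at hP'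
      exact hP'
  -- Traceability is applied twice, first along `π` and then along `ρ`; scalars survive both
  -- passages because `h` fixes them.
  have hcomp : Traceable (X := X) DX (fun _ : Unit => β.comp (constMap f.hom))
      (fun _ (e : Fin I.dim × Fin K.dim → Model X.obj (β.comp (constMap f.hom))) z =>
        ∃ (he : ∀ i, K.dom.Realize fun l => e (i, l))
          (hd : I.dom.Realize fun i => ρ ⟨_, he i⟩), π ⟨_, hd⟩ = z) := by
    intro P hP
    have h2 := traceable_interpretation (D := DY) (fun _ : Unit => hπ) (fun _ => hγ)
      (fun _ _ => rfl) P hP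
    have h3 := UDef.pulled_tracked (I := K) (π := fun _ => ρ) (fun _ => hρ) (fun _ => hδ) h2
    refine (h3.and (UDef.isScalar X.obj (Sum.inr ()))).congr fun j v => ?_
    constructor
    · rintro ⟨_, t, ⟨he, hd, rfl⟩, ht, hP'⟩
      refine ⟨⟨he, _, t, ⟨hd, rfl⟩, ?_, hP'⟩, t, ht⟩
      exact (congrArg h ht).trans (hh t)
    · rintro ⟨⟨he, _, t, ⟨hd, rfl⟩, ht, hP'⟩, s, hs⟩
      refine ⟨_, t, ⟨he, hd, rfl⟩, hs.trans ?_, hP'⟩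
      have : h (v (Sum.inr ())) = Model.emb s := (congrArg h hs).trans (hh s)
      exact congrArg Model.emb (Model.emb_inj.1 (this.symm.trans ht))
  have h4 := hid.udef_eq hcomp (fun j a z z' h h' => h.symm.trans h')
    (fun j a z z' ⟨_, _, h⟩ ⟨_, _, h'⟩ => h.symm.trans h')
  -- `v` lies in `S` exactly if some tuples of tuples `e` represent the entries of `v` under the
  -- composite and the tuple they represent under `ρ` lies in the pull-back of `S`.
  refine (UDef.exTuple (κ := Fin m × (Fin I.dim × Fin K.dim)) (Q := fun _ v e =>
    Pulled (fun _ => ρ) (fun _ v => v ∈ Interpretation.pullback π S) ()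
      (fun i => e (i.1.1, (i.1.2, i.2))) ∧
    ∀ i, ∃ z, v i = z ∧ ∃ (he : ∀ j, K.dom.Realize fun l => e (i, (j, l)))
          (hd : I.dom.Realize fun i => ρ ⟨_, he i⟩), π ⟨_, hd⟩ = z)
    ((h1.comp fun i => Sum.inr (i.1.1, (i.1.2, i.2))).and (UDef.finAll fun i =>
      h4.comp (Sum.elim (fun _ => Sum.inl i) (fun j => Sum.inr (i, j)))))).congr fun _ v => ?_
  constructor
  · intro hv
    choose d hd using fun i => hπ.surjective (v i)
    choose e he using fun i j => hρ.surjective ((d i).1 j)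
    have hed : ∀ i, (fun j => ρ ⟨_, (e i j).2⟩) = (d i).1 := fun i => funext fun j => he i j
    refine ⟨fun x => (e x.1 x.2.1).1 x.2.2, ⟨fun i => (e i.1 i.2).2, d, fun i j => he i j, ?_⟩,
      fun i => ⟨_, rfl, fun j => (e i j).2, ?_⟩⟩
    · simpa only [hd] using hv
    · have h5 : I.dom.Realize (fun j => ρ ⟨_, (e i j).2⟩) := by
        rw [hed]
        exact (d i).2
      refine ⟨h5, ?_⟩
      rw [← hd i]
      exact congrArg π (Subtype.ext (hed i))
  · rintro ⟨e, ⟨he, d, hd, hS'⟩, hv⟩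
    have : v = fun i => π (d i) := funext fun i => by
      obtain ⟨z, hz, he', hd', hπz⟩ := hv i
      rw [hz, ← hπz]
      exact congrArg π (Subtype.ext (funext fun j => hd i j))
    rw [this]
    exact hS'

/-- An automorphism `σ` of the structure of `X` induces `τ` on that of `Y`, which in turn induces
`σ'` on that of `X`. The two automorphisms `σ'` and `σ` coincide, so invariance under `τ` gives
invariance under `σ`. -/
theorem isInvariantEmbedding (hf : Function.Surjective (constMap f.hom)) (hπ : I.IsRealizedBy π)
    (hγ : Interpretation.Tracks π γ (modelMap (VPoint.map f.hom rfl))) :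
    Interpretation.IsInvariantEmbedding π := by
  obtain ⟨K, δ, ρ, h, hρ, hδ, hh⟩ := exists_reverse_interpretation f hf β
  intro m S hS σ v hv
  obtain ⟨τ, hτ⟩ := exists_induced_aut hρ σ
  obtain ⟨σ', hσ'⟩ := exists_induced_aut hπ τ
  -- Both interpretations track the identity on scalars, so the action on the field is unchanged by
  -- the two passages.
  have hemb : ∀ t, σ' (Model.emb t) = σ (Model.emb t) := by
    intro t
    obtain ⟨s, hs⟩ := Model.isScalar.1 ((isScalar_map σ (Model.emb t)).2 ⟨t, rfl⟩)
    obtain ⟨e, he⟩ := hρ.surjective (Model.emb t)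
    have h1 : τ (Model.emb t) = Model.emb s := by
      rw [← he, hτ, hδ.map_domMap σ (he.trans (hh t).symm), hs, hh]
    obtain ⟨d, hd⟩ := hπ.surjective (Model.emb t)
    rw [← hd, hσ', hγ.map_domMap τ (x := Model.emb t) hd, h1, hd, hs]
    rfl
  -- Automorphisms preserve charts and coordinate functions, so a point goes to the point of the
  -- same chart with transformed coordinates; agreement on scalars is enough.
  have hσσ : ∀ z, σ' z = σ z := by
    obtain ⟨C⟩ := nonempty_charts X
    intro z
    rcases C.eq_iff.1 (rfl : z = z) with ⟨t, rfl, -⟩ | ⟨i, hm, -, hv⟩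
    · exact hemb t
    · refine C.eq_iff.2 (Or.inr ⟨i, (isMem_map σ' z).2 hm, (isMem_map σ z).2 hm, fun l => ?_⟩)
      obtain ⟨t, ht, -⟩ := hv l
      obtain ⟨s, hs⟩ := Model.isScalar.1 ((isScalar_map σ (Model.emb t)).2 ⟨t, rfl⟩)
      refine ⟨s, ?_, ?_⟩
      · rw [← hs, ← hemb, isValue_map]
        exact ht
      · rw [← hs, isValue_map]
        exact ht
  choose d hd using fun i => hπ.surjective (v i)
  have h1 : (fun ij : Fin m × Fin I.dim => (d ij.1).1 ij.2) ∈ Interpretation.pullback π S :=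
    ⟨d, fun _ _ => rfl, by simpa only [hd] using hv⟩
  obtain ⟨d', hd', hS'⟩ := hS τ _ h1
  convert hS' using 2 with i
  rw [← hσσ, ← hd i, hσ']
  exact congrArg π (Subtype.ext (funext fun j => hd' i j))

end Embedding

end VarietyTheory

end

open VarietyTheory in
theorem theorem3p9 (k : Type u) [Field k] :
    -- the models of the theory of `X` are the two-sorted structures `(X_α(F), F_{/k})`
    (∀ (X : QProj k) (M : Type u) [(lang X.obj).Structure M],
      FirstOrder.Language.Theory.Model M (theory X.obj) ↔
        ∃ (F : Type u) (_ : Field F) (_ : IsAlgClosed F) (_ : Algebra k F)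
          (α : constField X.obj →ₐ[k] F),
          Nonempty (FirstOrder.Language.Equiv (lang X.obj) M (Model X.obj α))) ∧
    -- the category of schemes is equivalent to the category of theories
    (theoryFunctor k).IsEquivalence ∧
    -- the constants form a field
    (∀ X : QProj k, IsField (constField X.obj)) ∧
    -- morphisms act as regular maps from `k[β]`-varieties to `k[α]`-varieties, `k[α] ⊆ k[β]`
    (∀ {X Y : QProj k} (f : Y ⟶ X) (F : Type u) [Field F] [IsAlgClosed F] [Algebra k F]
      (α : constField X.obj →ₐ[k] F) (β : constField Y.obj →ₐ[k] F)
      (h : β.comp (constMap f.hom) = α),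
      Function.Injective (constMap f.hom) ∧ α.range ≤ β.range ∧
      IsVarietyOver α.range (atlas X.obj α) ∧ IsVarietyOver β.range (atlas Y.obj β) ∧
      IsRegularOver β.range (atlas Y.obj β) (atlas X.obj α) (VPoint.map f.hom h)) ∧
    -- every `f` determines an interpretation, uniformly in the models, ...
    (∀ {X Y : QProj k} (f : Y ⟶ X), ∃ I γ, Interprets f.hom I γ) ∧
    -- ... which is unique up to definable bijection, ...
    (∀ {X Y : QProj k} (f : Y ⟶ X) (I γ I' γ'), Interprets f.hom I γ → Interprets f.hom I' γ' →
      ∃ θ : (lang Y.obj).Formula (Fin I.dim ⊕ Fin I'.dim),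
        ∀ (F : Type u) [Field F] [IsAlgClosed F] [Algebra k F]
          (α : constField X.obj →ₐ[k] F) (β : constField Y.obj →ₐ[k] F)
          (h : β.comp (constMap f.hom) = α)
          (π : I.Dom (Model Y.obj β) → Model X.obj α)
          (π' : I'.Dom (Model Y.obj β) → Model X.obj α),
          I.IsRealizedBy π → Interpretation.Tracks π γ (modelMap (VPoint.map f.hom h)) →
          I'.IsRealizedBy π' → Interpretation.Tracks π' γ' (modelMap (VPoint.map f.hom h)) →
          ∀ d d', θ.Realize (Sum.elim d.1 d'.1) ↔ π d = π' d') ∧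
    -- ... and is given by the quotient map `f^*` itself where `f^*` is surjective
    (∀ {X Y : QProj k} (f : Y ⟶ X),
      ∃ (ε : (lang Y.obj).Formula (Fin 1 ⊕ Fin 1))
        (ρ : ∀ {m : ℕ}, (lang X.obj).Relations m → (lang Y.obj).Formula (Fin m × Fin 1)),
        ∀ (F : Type u) [Field F] [IsAlgClosed F] [Algebra k F]
          (α : constField X.obj →ₐ[k] F) (β : constField Y.obj →ₐ[k] F)
          (h : β.comp (constMap f.hom) = α), Function.Surjective (VPoint.map f.hom h) →
          Interpretation.IsRealizedBy (L := lang X.obj) (L' := lang Y.obj)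
            { dim := 1, dom := ⊤, eqv := ε, rel := ρ }
            (fun d : Interpretation.Dom _ (Model Y.obj β) =>
              modelMap (VPoint.map f.hom h) (d.1 0))) ∧
    -- if `f(k^X) = k^Y`, it is an embedding-interpretation
    (∀ {X Y : QProj k} (f : Y ⟶ X), Function.Surjective (constMap f.hom) →
      ∀ I γ, Interprets f.hom I γ →
        ∀ (F : Type u) [Field F] [IsAlgClosed F] [Algebra k F]
          (α : constField X.obj →ₐ[k] F) (β : constField Y.obj →ₐ[k] F)
          (h : β.comp (constMap f.hom) = α) (π : I.Dom (Model Y.obj β) → Model X.obj α),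
          I.IsRealizedBy π → Interpretation.Tracks π γ (modelMap (VPoint.map f.hom h)) →
          Interpretation.IsEmbedding π ∧ Interpretation.IsInvariantEmbedding π) := by
  refine ⟨model_theory_iff, theoryFunctor_isEquivalence, isField_constField, ?_,
    fun f => exists_interprets f, fun f I γ I' γ' _ _ => exists_comparison f I γ I' γ',
    fun f => exists_quotient_interpretation f, ?_⟩
  · intro X Y f F _ _ _ α β h
    exact ⟨constMap_injective f.hom, range_le_range h, isVarietyOver_atlas X α,
      isVarietyOver_atlas Y β, isRegularOver_map f.hom h _⟩
  · intro X Y f hf I γ _ F _ _ _ α β h π hπ hγ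
    subst h
    exact ⟨isEmbedding hf hπ hγ, isInvariantEmbedding hf hπ hγ⟩
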